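/- Let $d\ge 2$, let $\Omega\subset\mathbb R^d$ be a non-empty bounded open set with smooth boundary, let $q>d$ and $1<r\le q$, and write $q'=q/(q-1)$, $r'=r/(r-1)$; $|\cdot|$ is the Euclidean norm. Put $$A_{r'}=\{(a,b)\in\mathbb R\times\mathbb R^d:\ a+\tfrac1{r'}|b|^{r'}\le 0\},\qquad \mathcal A_{r'}=\{(a,b)\in L^\infty(\Omega)\times L^\infty(\Omega)^d:\ (a(x),b(x))\in A_{r'}\text{ for a.e. }x\in\Omega\},$$ $$\ell_r(a,b)=\begin{cases}\frac1r\frac{|b|^r}{a^{r-1}},&a>0,\\ 0,&(a,b)=(0,0),\\ +\infty,&\text{otherwise},\end{cases}\qquad \mathcal L_r(m,w)=\int_\Omega \ell_r(m(x),w(x))\,dx .$$ Each $m\in W^{1,q}(\Omega)$ has a unique representative continuous on $\overline\Omega$, still denoted $m$. A function $a\in L^\infty(\Omega)$ and a finite signed Radon measure $\alpha\in\mathfrak M(\overline\Omega)$ are identified with the elements $m\mapsto\int_\Omega a\,m\,dx$ and $m\mapsto\int_{\overline\Omega}m\,d\alpha$ of $(W^{1,q}(\Omega))^*$. (i) The closure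 of $\mathcal A_{r'}$ in $(W^{1,q}(\Omega))^*\times L^{q'}(\Omega)^d$ (norm topology) is $$\overline{\mathcal A_{r'}}=\Big\{(\alpha,\beta)\in\mathfrak M(\overline\Omega)\times L^{r'}(\Omega)^d:\ \alpha+\tfrac1{r'}|\beta|^{r'}\le0\Big\},$$ where the inequality means that $\int_{\overline\Omega}\phi\,d\alpha+\frac1{r'}\int_\Omega\phi\,|\beta|^{r'}dx\le0$ for every non-negative $\phi\in C(\overline\Omega)$. (ii) On $W^{1,q}(\Omega)\times L^q(\Omega)^d$ the functional $\mathcal L_r$ is convex and lower semicontinuous, and for every $(m,w)$ in this space $$\mathcal L_r(m,w)=\sup_{(\alpha,\beta)\in\mathcal A_{r'}}\int_\Omega[\alpha m+\beta\cdot w]\,dx=\sup_{(\alpha,\beta)\in\overline{\mathcal A_{r'}}}\Big[\int_{\overline\Omega}m\,d\alpha+\int_\Omega\beta\cdot w\,dx\Big].$$ Moreover, for all $(\alpha,\beta)\in(W^{1,q}(\Omega))^*\times L^{q'}(\Omega)^d$ the Fenchel conjugate $$\mathcal L_r^*(\alpha,\beta)=\sup_{(m,w)\in W^{1,q}(\Omega)\times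 L^q(\Omega)^d}\Big[\langle\alpha,m\rangle+\int_\Omega\beta\cdot w\,dx-\mathcal L_r(m,w)\Big]$$ equals $0$ if $(\alpha,\beta)\in\overline{\mathcal A_{r'}}$ and $+\infty$ otherwise. -/

import Mathlib

open MeasureTheory Set
open scoped ENNReal NNReal ContDiff

/-- `ℝ^d` with the Euclidean norm. -/
abbrev Rd (d : ℕ) : Type := EuclideanSpace ℝ (Fin d)

/-- The boundary of `Ω` is smooth: near each of its boundary points, `Ω` is the sublevel set
`{g < 0}` of a smooth function `g` with non-vanishing differential at that point (so `Ω` lies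
locally on one side of its boundary, which is a smooth hypersurface). -/
def HasSmoothBoundary {d : ℕ} (Ω : Set (Rd d)) : Prop :=
  ∀ x₀ ∈ frontier Ω, ∃ U : Set (Rd d), IsOpen U ∧ x₀ ∈ U ∧
    ∃ g : Rd d → ℝ, ContDiff ℝ ∞ g ∧ fderiv ℝ g x₀ ≠ 0 ∧ Ω ∩ U = {x ∈ U | g x < 0}

/-- `L^p(Ω; F)`, with respect to Lebesgue measure on `Ω`. -/
noncomputable abbrev LpOn {d : ℕ} (Ω : Set (Rd d)) (F : Type) [NormedAddCommGroup F] (p : ℝ≥0∞) :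
    AddSubgroup (Rd d →ₘ[volume.restrict Ω] F) :=
  Lp F p (volume.restrict Ω)

instance fact_one_le_ofReal (q : ℝ) [h : Fact (1 < q)] : Fact (1 ≤ ENNReal.ofReal q) :=
  ⟨by
    have := ENNReal.ofReal_le_ofReal h.out.le
    rwa [ENNReal.ofReal_one] at this⟩

instance fact_one_lt_conjExponent (q : ℝ) [h : Fact (1 < q)] : Fact (1 < q.conjExponent) :=
  ⟨(Real.HolderConjugate.conjExponent h.out).symm.lt⟩

/-- `G` is the weak gradient of `u` on `Ω`: `∫_Ω u ∂_i φ = - ∫_Ω G_i φ` for every coordinate `i`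
and every smooth `φ` with compact support in `Ω`. -/
def IsWeakGradient {d : ℕ} (Ω : Set (Rd d)) (u : Rd d → ℝ) (G : Rd d → Rd d) : Prop :=
  ∀ φ : Rd d → ℝ, ContDiff ℝ ∞ φ → HasCompactSupport φ → tsupport φ ⊆ Ω → ∀ i : Fin d,
    ∫ x in Ω, u x * fderiv ℝ φ x (EuclideanSpace.single i 1) = - ∫ x in Ω, G x i * φ x

theorem integrable_mul_test {d : ℕ} {Ω : Set (Rd d)} {p : ℝ≥0∞} (hp : 1 ≤ p) {u : Rd d → ℝ}
    (hu : MemLp u p (volume.restrict Ω)) {ψ : Rd d → ℝ} (hψ : Continuous ψ)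
    (hc : HasCompactSupport ψ) : Integrable (fun x => u x * ψ x) (volume.restrict Ω) := by
  simpa only [smul_eq_mul] using
    (hu.locallyIntegrable hp).integrable_smul_right_of_hasCompactSupport hψ hc

theorem continuous_partial {d : ℕ} {φ : Rd d → ℝ} (hφ : ContDiff ℝ ∞ φ) (v : Rd d) :
    Continuous (fun x => fderiv ℝ φ x v) :=
  (hφ.continuous_fderiv (by simp)).clm_apply continuous_const

theorem hasCompactSupport_partial {d : ℕ} {φ : Rd d → ℝ} (hc : HasCompactSupport φ) (v : Rd d) :
    HasCompactSupport (fun x => fderiv ℝ φ x v) :=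
  (hc.fderiv ℝ).comp_left (g := fun L : Rd d →L[ℝ] ℝ => L v) rfl

theorem memLp_coord {d : ℕ} {Ω : Set (Rd d)} {p : ℝ≥0∞} {G : Rd d → Rd d}
    (hG : MemLp G p (volume.restrict Ω)) (i : Fin d) :
    MemLp (fun x => G x i) p (volume.restrict Ω) :=
  (EuclideanSpace.proj (𝕜 := ℝ) i).comp_memLp' hG

/-- The Sobolev space `W^{1,q}(Ω)`, realized as the space of pairs `(u, ∇u)` with `u ∈ L^q(Ω)` and
weak gradient `∇u ∈ L^q(Ω)^d` (which `u` determines). Its norm, inherited from the product,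
`max (‖u‖_q, ‖∇u‖_q)`, is equivalent to the usual ones. -/
def SobolevW1 {d : ℕ} (Ω : Set (Rd d)) (q : ℝ) [Fact (1 < q)] :
    Submodule ℝ (LpOn Ω ℝ (ENNReal.ofReal q) × LpOn Ω (Rd d) (ENNReal.ofReal q)) where
  carrier := {m | IsWeakGradient Ω m.1 m.2}
  zero_mem' := by
    intro φ _ _ _ i
    have e1 : ∫ x in Ω, (0 : LpOn Ω ℝ (ENNReal.ofReal q) × LpOn Ω (Rd d) (ENNReal.ofReal q)).1 x
        * fderiv ℝ φ x (EuclideanSpace.single i 1) = 0 := by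
      refine integral_eq_zero_of_ae ?_
      filter_upwards [Lp.coeFn_zero ℝ (ENNReal.ofReal q) (volume.restrict Ω)] with x hx
      rw [Prod.fst_zero, hx, Pi.zero_apply, zero_mul]
    have e2 : ∫ x in Ω, (0 : LpOn Ω ℝ (ENNReal.ofReal q) × LpOn Ω (Rd d) (ENNReal.ofReal q)).2 x i
        * φ x = 0 := by
      refine integral_eq_zero_of_ae ?_
      filter_upwards [Lp.coeFn_zero (Rd d) (ENNReal.ofReal q) (volume.restrict Ω)] with x hx
      rw [Prod.snd_zero, hx]
      simp
    rw [e1, e2, neg_zero]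
  add_mem' := by
    intro a b ha hb φ hφ hc hs i
    have hq : 1 ≤ ENNReal.ofReal q := Fact.out
    have hD := continuous_partial hφ (EuclideanSpace.single i 1)
    have hDc := hasCompactSupport_partial hc (EuclideanSpace.single i (1 : ℝ))
    have e1 : ∫ x in Ω, (a + b).1 x * fderiv ℝ φ x (EuclideanSpace.single i 1)
        = ∫ x in Ω, (a.1 x * fderiv ℝ φ x (EuclideanSpace.single i 1)
          + b.1 x * fderiv ℝ φ x (EuclideanSpace.single i 1)) := by
      refine integral_congr_ae ?_
      filter_upwards [Lp.coeFn_add a.1 b.1] with x hx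
      rw [Prod.fst_add, hx, Pi.add_apply, add_mul]
    have e2 : ∫ x in Ω, (a + b).2 x i * φ x
        = ∫ x in Ω, (a.2 x i * φ x + b.2 x i * φ x) := by
      refine integral_congr_ae ?_
      filter_upwards [Lp.coeFn_add a.2 b.2] with x hx
      rw [Prod.snd_add, hx, Pi.add_apply, PiLp.add_apply, add_mul]
    rw [e1, e2, integral_add (integrable_mul_test hq (Lp.memLp a.1) hD hDc)
        (integrable_mul_test hq (Lp.memLp b.1) hD hDc),
      integral_add (integrable_mul_test hq (memLp_coord (Lp.memLp a.2) i) hφ.continuous hc)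
        (integrable_mul_test hq (memLp_coord (Lp.memLp b.2) i) hφ.continuous hc),
      ha φ hφ hc hs i, hb φ hφ hc hs i]
    ring
  smul_mem' := by
    intro c a ha φ hφ hc hs i
    have e1 : ∫ x in Ω, (c • a).1 x * fderiv ℝ φ x (EuclideanSpace.single i 1)
        = ∫ x in Ω, c * (a.1 x * fderiv ℝ φ x (EuclideanSpace.single i 1)) := by
      refine integral_congr_ae ?_
      filter_upwards [Lp.coeFn_smul c a.1] with x hx
      rw [Prod.smul_fst, hx, Pi.smul_apply, smul_eq_mul, mul_assoc]
    have e2 : ∫ x in Ω, (c • a).2 x i * φ x = ∫ x in Ω, c * (a.2 x i * φ x) := by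
      refine integral_congr_ae ?_
      filter_upwards [Lp.coeFn_smul c a.2] with x hx
      rw [Prod.smul_snd, hx, Pi.smul_apply, PiLp.smul_apply, smul_eq_mul, mul_assoc]
    rw [e1, e2, integral_const_mul, integral_const_mul, ha φ hφ hc hs i]
    ring

/-- The primal space `W^{1,q}(Ω) × L^q(Ω)^d`. -/
abbrev PrimalSpace {d : ℕ} (Ω : Set (Rd d)) (q : ℝ) [Fact (1 < q)] : Type :=
  SobolevW1 Ω q × LpOn Ω (Rd d) (ENNReal.ofReal q)

/-- The dual space `(W^{1,q}(Ω))^* × L^{q'}(Ω)^d`, with its norm topology. -/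
abbrev DualSpace {d : ℕ} (Ω : Set (Rd d)) (q : ℝ) [Fact (1 < q)] : Type :=
  (SobolevW1 Ω q →L[ℝ] ℝ) × LpOn Ω (Rd d) (ENNReal.ofReal q.conjExponent)

/-- `f` is a representative of `m` that is continuous on the closure of `Ω`; its values on
`closure Ω` are determined by `m`. -/
def IsContRep {d : ℕ} {Ω : Set (Rd d)} {q : ℝ} [Fact (1 < q)]
    (m : SobolevW1 Ω q) (f : Rd d → ℝ) : Prop :=
  ContinuousOn f (closure Ω) ∧ m.1.1 =ᵐ[volume.restrict Ω] f

/-- The function `ℓ_r`, with values in `[0, +∞]`. -/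
noncomputable def ellFun {d : ℕ} (r : ℝ) (a : ℝ) (b : Rd d) : ℝ≥0∞ :=
  open Classical in
  if 0 < a then ENNReal.ofReal (1 / r * (‖b‖ ^ r / a ^ (r - 1)))
  else if a = 0 ∧ b = 0 then 0
  else ⊤

/-- The functional `𝓛_r(m, w) = ∫_Ω ℓ_r(m(x), w(x)) dx` on `W^{1,q}(Ω) × L^q(Ω)^d`. -/
noncomputable def costL {d : ℕ} {Ω : Set (Rd d)} {q : ℝ} [Fact (1 < q)] (r : ℝ)
    (z : PrimalSpace Ω q) : ℝ≥0∞ :=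
  ∫⁻ x in Ω, ellFun r (z.1.1.1 x) (z.2 x)

/-- The set `A_s ⊆ ℝ × ℝ^d`. -/
def setA (d : ℕ) (s : ℝ) : Set (ℝ × Rd d) := {c | c.1 + 1 / s * ‖c.2‖ ^ s ≤ 0}

/-- The set `𝓐_s ⊆ L^∞(Ω) × L^∞(Ω)^d`. -/
def calA {d : ℕ} (Ω : Set (Rd d)) (s : ℝ) : Set (LpOn Ω ℝ ∞ × LpOn Ω (Rd d) ∞) :=
  {c | ∀ᵐ x ∂(volume.restrict Ω), (c.1 x, c.2 x) ∈ setA d s}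

/-- The set `𝓐_s` seen in `(W^{1,q}(Ω))^* × L^{q'}(Ω)^d`: the function `a` is identified with
the functional `m ↦ ∫_Ω a m dx`. -/
def calADual {d : ℕ} (Ω : Set (Rd d)) (q : ℝ) [Fact (1 < q)] (s : ℝ) : Set (DualSpace Ω q) :=
  {p | ∃ c ∈ calA Ω s, (∀ m : SobolevW1 Ω q, p.1 m = ∫ x in Ω, c.1 x * m.1.1 x) ∧
    p.2 =ᵐ[volume.restrict Ω] c.2}

/-- The pairs `(α, β)` of a signed (automatically Radon) measure `α` on the closure of `Ω` and
`β ∈ L^s(Ω)^d` such that `α + (1/s) |β|^s ≤ 0` as measures, i.e. tested with the non-negative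
continuous functions on the closure of `Ω`. -/
def measA {d : ℕ} (Ω : Set (Rd d)) (s : ℝ) :
    Set (SignedMeasure (closure Ω) × LpOn Ω (Rd d) (ENNReal.ofReal s)) :=
  {c | ∀ φ : Rd d → ℝ, ContinuousOn φ (closure Ω) → (∀ x ∈ closure Ω, 0 ≤ φ x) →
    (∫ᵛ x : closure Ω, φ x ∂<•c.1) + 1 / s * ∫ x in Ω, φ x * ‖c.2 x‖ ^ s ≤ 0}

/-- The element `p` of `(W^{1,q}(Ω))^* × L^{q'}(Ω)^d` is (identified with) the pair `c = (α, β)` of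
a measure on the closure of `Ω` and a vector field: the first component of `p` is
`m ↦ ∫ m dα`, where `m` is replaced by its continuous representative, and the second is `β`. -/
def IsMeasPair {d : ℕ} {Ω : Set (Rd d)} {q : ℝ} [Fact (1 < q)] {s : ℝ} (p : DualSpace Ω q)
    (c : SignedMeasure (closure Ω) × LpOn Ω (Rd d) (ENNReal.ofReal s)) : Prop :=
  (∀ m : SobolevW1 Ω q, ∃ f : Rd d → ℝ, IsContRep m f ∧ p.1 m = ∫ᵛ x : closure Ω, f x ∂<•c.1) ∧
    p.2 =ᵐ[volume.restrict Ω] c.2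

/-- The duality pairing `⟨α, m⟩ + ∫_Ω β · w dx`. -/
noncomputable def dualPairing {d : ℕ} {Ω : Set (Rd d)} {q : ℝ} [Fact (1 < q)]
    (p : DualSpace Ω q) (z : PrimalSpace Ω q) : ℝ :=
  p.1 z.1 + ∫ x in Ω, inner ℝ (p.2 x) (z.2 x)

/-- The Fenchel conjugate `F^*` of `F : W^{1,q}(Ω) × L^q(Ω)^d → [0, +∞]`. -/
noncomputable def fenchelConj {d : ℕ} {Ω : Set (Rd d)} {q : ℝ} [Fact (1 < q)]
    (F : PrimalSpace Ω q → ℝ≥0∞) (p : DualSpace Ω q) : EReal :=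
  ⨆ z : PrimalSpace Ω q, ((dualPairing p z : ℝ) : EReal) - ((F z : ℝ≥0∞) : EReal)

/-- The function `χ_S` of convex analysis: `0` on `S` and `+∞` elsewhere. -/
noncomputable def convexIndicator {X : Type*} (S : Set X) (x : X) : EReal :=
  open Classical in if x ∈ S then 0 else ⊤

/-!
The functional `𝓛_r` is an integral of `ℓ_r`, the support function of `A_{r'}`: Young's inequality
gives `a m + b · w ≤ ℓ_r(m, w)` on `A_{r'}` (`ofReal_pairing_le_ellFun`), and truncated pointwise
maximizers are bounded measurable functions with values in `A_{r'}`, so that Fatou's lemma shows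
that `𝓛_r` is the supremum of the pairings with the elements of `𝓐_{r'}` (`costL_eq_iSup`).
Convexity and lower semicontinuity follow, and so does positive homogeneity, by which the Fenchel
conjugate is `0` at the dual elements `p` with `p ≤ 𝓛_r` and `+∞` at all others.

Everything else rests on the chain of inclusions
closure of `𝓐_{r'}` ⊆ `{p | p ≤ 𝓛_r}` ⊆ measure pairs ⊆ closure of `𝓐_{r'}`.
The first holds because `p ≤ 𝓛_r` is a closed condition. No separation theorem is needed.

* For `q > d` and a smooth boundary, the evaluations `m ↦ m(x)`, `x ∈ closure Ω`, are a norm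
  continuous family in the dual of `W^{1,q}(Ω)` (`exists_continuousOn_eval`). Smoothness is only
  used through a locally uniform interior cone condition: mollifying with a kernel supported in the
  cone, the change in the scale `t` is an integral against the weak gradient, of order
  `t^{-d/q}`, which is integrable at `t = 0`; Lebesgue's theorem identifies the limit.
* If `p = (α, β) ≤ 𝓛_r`, testing with `(m, m v)` for `m ≥ 0` and `v` a truncation of
  `|β|^{r'-2} β` gives `⟨α, m⟩ + (1/r') ∫ m |β|^{r'} ≤ 0`, and in particular `β ∈ L^{r'}` from
  `m = 1`. The left-hand side is a non-positive functional on `W^{1,q}(Ω) ⊆ C(closure Ω)`. It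
  extends to a non-positive functional on `C(closure Ω)` by M. Riesz' extension theorem and is a
  measure by the Riesz representation theorem (`exists_mem_measA_of_forall_le_costL`).
* If `(α, β)` is a measure pair, then the defect `α + (1/r') |β|^{r'}` is a non-positive measure.
  Truncating `β` and averaging the defect over small balls gives elements of `𝓐_{r'}`, which
  converge in the dual norm since the unit ball of `W^{1,q}(Ω)` is bounded and equicontinuous on
  `closure Ω` (`mem_closure_of_isMeasPair`).
-/

open Filter Topology Metric

/-! ### Integration functionals on the Sobolev space -/

instance ennreal_holderConjugate (q : ℝ) [h : Fact (1 < q)] :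
    (ENNReal.ofReal q).HolderConjugate (ENNReal.ofReal q.conjExponent) :=
  (Real.HolderConjugate.conjExponent h.out).ennrealOfReal

instance ennreal_holderConjugate_symm (q : ℝ) [h : Fact (1 < q)] :
    (ENNReal.ofReal q.conjExponent).HolderConjugate (ENNReal.ofReal q) :=
  (Real.HolderConjugate.conjExponent h.out).symm.ennrealOfReal

/-- The functional `m ↦ ∫_Ω a m dx` on `W^{1,q}(Ω)` attached to `a ∈ L^{q'}(Ω)`, as a continuous
linear function of `a`. -/
noncomputable def integralFunctional {d : ℕ} (Ω : Set (Rd d)) (q : ℝ) [Fact (1 < q)] :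
    LpOn Ω ℝ (ENNReal.ofReal q.conjExponent) →L[ℝ] (SobolevW1 Ω q →L[ℝ] ℝ) :=
  ((ContinuousLinearMap.compL ℝ (SobolevW1 Ω q) (LpOn Ω ℝ (ENNReal.ofReal q)) ℝ).flip
    ((ContinuousLinearMap.fst ℝ _ _) ∘L (SobolevW1 Ω q).subtypeL)) ∘L
    ((ContinuousLinearMap.mul ℝ ℝ).lpPairing (volume.restrict Ω)
      (ENNReal.ofReal q.conjExponent) (ENNReal.ofReal q))

section
variable {d : ℕ} {Ω : Set (Rd d)} {q : ℝ} [Fact (1 < q)]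

theorem integralFunctional_apply (a : LpOn Ω ℝ (ENNReal.ofReal q.conjExponent))
    (m : SobolevW1 Ω q) : integralFunctional Ω q a m = ∫ x in Ω, a x * m.1.1 x := by
  simp [integralFunctional, ContinuousLinearMap.lpPairing_eq_integral]

theorem integralFunctional_toLp_apply {a : Rd d → ℝ}
    (ha : MemLp a (ENNReal.ofReal q.conjExponent) (volume.restrict Ω)) (m : SobolevW1 Ω q) :
    integralFunctional Ω q (ha.toLp a) m = ∫ x in Ω, a x * m.1.1 x := by
  rw [integralFunctional_apply]
  refine integral_congr_ae ?_
  filter_upwards [ha.coeFn_toLp] with x hx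
  rw [hx]

theorem isFiniteMeasure_restrict_of_isBounded (hΩ : Bornology.IsBounded Ω) :
    IsFiniteMeasure (volume.restrict Ω) :=
  ⟨by simpa using hΩ.measure_lt_top⟩

/-- Hölder's inequality on a subset. -/
theorem setIntegral_norm_le_norm_mul_rpow {F : Type} [NormedAddCommGroup F]
    {μ : Measure (Rd d)} [IsFiniteMeasure μ] (g : Lp F (ENNReal.ofReal q) μ) (s : Set (Rd d)) :
    ∫ x in s, ‖g x‖ ∂μ ≤ ‖g‖ * μ.real s ^ (1 - 1 / q) := by
  have hq : 1 ≤ ENNReal.ofReal q := Fact.out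
  have hq1 : 1 < q := Fact.out
  have hg := Lp.memLp g
  have h1 := eLpNorm_le_eLpNorm_mul_rpow_measure_univ (μ := μ.restrict s) hq
    hg.aestronglyMeasurable.restrict
  rw [eLpNorm_one_eq_lintegral_enorm] at h1
  rw [integral_norm_eq_lintegral_enorm hg.aestronglyMeasurable.restrict, Lp.norm_def,
    measureReal_def, ENNReal.toReal_rpow, ← ENNReal.toReal_mul]
  have hexp : 0 ≤ 1 - 1 / q := by
    rw [sub_nonneg, div_le_one (by linarith)]; exact hq1.le
  refine ENNReal.toReal_mono (ENNReal.mul_ne_top hg.eLpNorm_ne_top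
    (ENNReal.rpow_ne_top_of_nonneg hexp (measure_ne_top _ _))) (h1.trans ?_)
  rw [ENNReal.toReal_ofReal (by linarith), Measure.restrict_apply_univ]
  simp only [ENNReal.toReal_one, div_one]
  gcongr
  exact Measure.restrict_le_self

end

/-! ### Mollification by a kernel supported in a cone -/

/-- The kernel `y ↦ t^{-d} ρ((y - x) / t)`, whose mass is that of `ρ` and which concentrates
at `x` as `t → 0`. -/
noncomputable def scaledKernel {d : ℕ} (ρ : Rd d → ℝ) (t : ℝ) (x y : Rd d) : ℝ :=
  (t ^ d)⁻¹ * ρ (t⁻¹ • (y - x))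

section
variable {d : ℕ} {ρ : Rd d → ℝ} {e : Rd d} {η : ℝ}

theorem smul_sub_mem_closedBall_iff {t : ℝ} (ht : 0 < t) (x y : Rd d) :
    t⁻¹ • (y - x) ∈ closedBall e η ↔ y ∈ closedBall (x + t • e) (t * η) := by
  have h : y - (x + t • e) = t • (t⁻¹ • (y - x) - e) := by
    rw [smul_sub, smul_inv_smul₀ ht.ne']; abel
  rw [mem_closedBall, mem_closedBall, dist_eq_norm, dist_eq_norm, h, norm_smul, Real.norm_eq_abs,
    abs_of_pos ht, mul_le_mul_iff_right₀ ht]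

theorem contDiff_scaledKernel (hρ : ContDiff ℝ ∞ ρ) (t : ℝ) (x : Rd d) :
    ContDiff ℝ ∞ (scaledKernel ρ t x) := by
  unfold scaledKernel
  exact contDiff_const.mul (hρ.comp ((contDiff_id.sub contDiff_const).const_smul _))

theorem scaledKernel_eq_zero (hs : tsupport ρ ⊆ closedBall e η) {t : ℝ} (ht : 0 < t) {x y : Rd d}
    (hy : y ∉ closedBall (x + t • e) (t * η)) : scaledKernel ρ t x y = 0 := by
  rw [← smul_sub_mem_closedBall_iff ht] at hy
  rw [scaledKernel, image_eq_zero_of_notMem_tsupport (fun h => hy (hs h)), mul_zero]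

theorem abs_scaledKernel_le {M : ℝ} (hM : ∀ z, |ρ z| ≤ M) {t : ℝ} (ht : 0 < t) (x y : Rd d) :
    |scaledKernel ρ t x y| ≤ (t ^ d)⁻¹ * M := by
  rw [scaledKernel, abs_mul, abs_of_pos (by positivity)]
  exact mul_le_mul_of_nonneg_left (hM _) (by positivity)

theorem integral_scaledKernel (h1 : ∫ z, ρ z = 1) {t : ℝ} (ht : 0 < t) (x : Rd d) :
    ∫ y, scaledKernel ρ t x y = 1 := by
  unfold scaledKernel
  rw [integral_const_mul, integral_sub_right_eq_self (fun y => ρ (t⁻¹ • y)) x,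
    Measure.integral_comp_inv_smul_of_nonneg _ _ ht.le, h1]
  simp [ht.ne']

theorem abs_scaledKernel_sub_le {L : ℝ≥0} (hL : LipschitzWith L ρ) {t : ℝ} (ht : 0 < t)
    (x x' y : Rd d) :
    |scaledKernel ρ t x y - scaledKernel ρ t x' y| ≤ (t ^ d)⁻¹ * (L * t⁻¹) * dist x x' := by
  rw [scaledKernel, scaledKernel, ← mul_sub, abs_mul, abs_of_pos (by positivity), mul_assoc]
  refine mul_le_mul_of_nonneg_left ?_ (by positivity)
  have := hL.dist_le_mul (t⁻¹ • (y - x)) (t⁻¹ • (y - x'))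
  rw [Real.dist_eq, dist_smul₀, dist_sub_left, Real.norm_eq_abs,
    abs_of_pos (inv_pos.2 ht)] at this
  rw [mul_assoc]; exact this

/-- The `i`-th component of the vector field whose negative divergence is the `t`-derivative of
`scaledKernel ρ t x`. -/
noncomputable def scaledField {d : ℕ} (ρ : Rd d → ℝ) (t : ℝ) (x : Rd d) (i : Fin d) (y : Rd d) :
    ℝ :=
  scaledKernel ρ t x y * (t⁻¹ • (y - x)) i

theorem contDiff_scaledField (hρ : ContDiff ℝ ∞ ρ) (t : ℝ) (x : Rd d) (i : Fin d) :
    ContDiff ℝ ∞ (scaledField ρ t x i) := by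
  unfold scaledField
  refine (contDiff_scaledKernel hρ t x).mul ?_
  exact (EuclideanSpace.proj (𝕜 := ℝ) i).contDiff.comp
    ((contDiff_id.sub contDiff_const).const_smul t⁻¹)

theorem tsupport_scaledField_subset (hs : tsupport ρ ⊆ closedBall e η) {t : ℝ} (ht : 0 < t)
    (x : Rd d) (i : Fin d) :
    tsupport (scaledField ρ t x i) ⊆ closedBall (x + t • e) (t * η) := by
  refine closure_minimal ?_ isClosed_closedBall
  intro y hy
  by_contra h
  exact hy (by rw [scaledField, scaledKernel_eq_zero hs ht h, zero_mul])

/-- The `t`-derivative of the kernel, as a function of `y`. -/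
noncomputable def scaledKernelDeriv {d : ℕ} (ρ : Rd d → ℝ) (t : ℝ) (x y : Rd d) : ℝ :=
  -(t⁻¹ * (t ^ d)⁻¹ * (d * ρ (t⁻¹ • (y - x)) +
    fderiv ℝ ρ (t⁻¹ • (y - x)) (t⁻¹ • (y - x))))

theorem hasDerivAt_scaledKernel (hρ : ContDiff ℝ ∞ ρ) {t : ℝ} (ht : 0 < t) (x y : Rd d) :
    HasDerivAt (fun t => scaledKernel ρ t x y) (scaledKernelDeriv ρ t x y) t := by
  have h1 : HasDerivAt (fun t : ℝ => t⁻¹ • (y - x)) (-(t ^ 2)⁻¹ • (y - x)) t :=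
    (hasDerivAt_inv ht.ne').smul_const _
  have h2 : HasFDerivAt ρ (fderiv ℝ ρ (t⁻¹ • (y - x))) (t⁻¹ • (y - x)) :=
    ((hρ.differentiable (by simp)) _).hasFDerivAt
  have h3 := h2.comp_hasDerivAt t h1
  have h4 : HasDerivAt (fun t : ℝ => (t ^ d)⁻¹) (-(d * t ^ (d - 1)) / (t ^ d) ^ 2) t :=
    (hasDerivAt_pow d t).fun_inv (by positivity)
  have h5 := h4.mul h3
  unfold scaledKernel
  refine h5.congr_deriv ?_
  have h6 : -(t ^ 2)⁻¹ • (y - x) = (-t⁻¹) • (t⁻¹ • (y - x)) := by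
    rw [smul_smul]; congr 1; field_simp
  have h7 : -(d * t ^ (d - 1)) / (t ^ d) ^ 2 = -(d : ℝ) * (t⁻¹ * (t ^ d)⁻¹) := by
    rcases d with _ | d
    · simp
    · rw [Nat.add_sub_cancel]; field_simp; ring
  rw [h6, map_smul, h7, scaledKernelDeriv]
  simp only [Function.comp_apply, smul_eq_mul]
  ring

/-- The derivative of the kernel in the scale is minus a divergence: the mass is only
moved around. -/
theorem sum_fderiv_scaledField (hρ : ContDiff ℝ ∞ ρ) (t : ℝ) (x y : Rd d) :
    ∑ i, fderiv ℝ (scaledField ρ t x i) y (EuclideanSpace.single i 1)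
      = - scaledKernelDeriv ρ t x y := by
  set z : Rd d := t⁻¹ • (y - x) with hz
  have hzd : HasFDerivAt (fun y : Rd d => t⁻¹ • (y - x))
      (t⁻¹ • ContinuousLinearMap.id ℝ (Rd d)) y :=
    ((hasFDerivAt_id y).sub_const x).const_smul t⁻¹
  have h2 : HasFDerivAt ρ (fderiv ℝ ρ z) z := ((hρ.differentiable (by simp)) _).hasFDerivAt
  have hterm : ∀ i : Fin d, fderiv ℝ (scaledField ρ t x i) y (EuclideanSpace.single i 1)
      = t⁻¹ * (t ^ d)⁻¹ * (ρ z + z i * fderiv ℝ ρ z (EuclideanSpace.single i 1)) := by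
    intro i
    have hp : HasFDerivAt (fun y : Rd d => (t⁻¹ • (y - x)) i)
        ((EuclideanSpace.proj (𝕜 := ℝ) i) ∘L (t⁻¹ • ContinuousLinearMap.id ℝ (Rd d))) y :=
      (EuclideanSpace.proj (𝕜 := ℝ) i).hasFDerivAt.comp y hzd
    have hk : HasFDerivAt (scaledKernel ρ t x)
        ((t ^ d)⁻¹ • (fderiv ℝ ρ z ∘L (t⁻¹ • ContinuousLinearMap.id ℝ (Rd d)))) y := by
      have := (h2.comp y hzd).const_mul (t ^ d)⁻¹
      exact this
    have := (hk.mul hp).fderiv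
    have e1 : scaledField ρ t x i = scaledKernel ρ t x * fun y : Rd d => (t⁻¹ • (y - x)) i := rfl
    rw [e1, this]
    simp [scaledKernel, ← hz]
    ring
  rw [Finset.sum_congr rfl (fun i _ => hterm i), ← Finset.mul_sum, Finset.sum_add_distrib,
    scaledKernelDeriv, neg_neg, ← hz]
  congr 2
  · simp
  · have h := congrArg (fderiv ℝ ρ z) ((EuclideanSpace.basisFun (Fin d) ℝ).sum_repr z)
    simpa [map_sum] using h

end

section
variable {d : ℕ} {ρ : Rd d → ℝ} {e : Rd d} {η : ℝ} {Ω : Set (Rd d)} {q : ℝ} [Fact (1 < q)]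

theorem hasCompactSupport_of_tsupport_subset (hs : tsupport ρ ⊆ closedBall e η) :
    HasCompactSupport ρ :=
  (isCompact_closedBall e η).of_isClosed_subset (isClosed_tsupport ρ) hs

theorem exists_abs_le_of_continuous {f : Rd d → ℝ} (hf : Continuous f) (hc : HasCompactSupport f) :
    ∃ M, 0 ≤ M ∧ ∀ z, |f z| ≤ M := by
  obtain ⟨M, hM⟩ := hf.bounded_above_of_compact_support hc
  exact ⟨M, (norm_nonneg _).trans (hM 0), hM⟩

theorem memLp_scaledKernel [IsFiniteMeasure (volume.restrict Ω)] (hρ : ContDiff ℝ ∞ ρ)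
    (hs : tsupport ρ ⊆ closedBall e η) {t : ℝ} (ht : 0 < t) (x : Rd d) (p : ℝ≥0∞) :
    MemLp (scaledKernel ρ t x) p (volume.restrict Ω) := by
  obtain ⟨M, -, hM⟩ :=
    exists_abs_le_of_continuous hρ.continuous (hasCompactSupport_of_tsupport_subset hs)
  exact MemLp.of_bound (contDiff_scaledKernel hρ t x).continuous.aestronglyMeasurable _
    (.of_forall fun y => abs_scaledKernel_le hM ht x y)

/-- The functional `m ↦ ∫_Ω m(y) t^{-d} ρ((y - x)/t) dy` on `W^{1,q}(Ω)`, an approximation of the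
evaluation at `x` (it is set to `0` if the kernel is not in `L^{q'}(Ω)`). -/
noncomputable def mollifiedEval {d : ℕ} (Ω : Set (Rd d)) (q : ℝ) [Fact (1 < q)] (ρ : Rd d → ℝ)
    (t : ℝ) (x : Rd d) : SobolevW1 Ω q →L[ℝ] ℝ :=
  open Classical in
  if h : MemLp (scaledKernel ρ t x) (ENNReal.ofReal q.conjExponent) (volume.restrict Ω) then
    integralFunctional Ω q (h.toLp _) else 0

theorem mollifiedEval_apply [IsFiniteMeasure (volume.restrict Ω)] (hρ : ContDiff ℝ ∞ ρ)
    (hs : tsupport ρ ⊆ closedBall e η) {t : ℝ} (ht : 0 < t) (x : Rd d) (m : SobolevW1 Ω q) :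
    mollifiedEval Ω q ρ t x m = ∫ y in Ω, scaledKernel ρ t x y * m.1.1 y := by
  rw [mollifiedEval, dif_pos (memLp_scaledKernel hρ hs ht x _), integralFunctional_toLp_apply]

theorem integrable_of_memLp_sobolev [IsFiniteMeasure (volume.restrict Ω)] {F : Type}
    [NormedAddCommGroup F] (g : LpOn Ω F (ENNReal.ofReal q)) :
    Integrable g (volume.restrict Ω) :=
  (Lp.memLp g).integrable Fact.out

theorem integrable_scaledKernel_mul [IsFiniteMeasure (volume.restrict Ω)] (hρ : ContDiff ℝ ∞ ρ)
    (hs : tsupport ρ ⊆ closedBall e η) {t : ℝ} (ht : 0 < t) (x : Rd d) (m : SobolevW1 Ω q) :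
    Integrable (fun y => scaledKernel ρ t x y * m.1.1 y) (volume.restrict Ω) := by
  obtain ⟨M, -, hM⟩ :=
    exists_abs_le_of_continuous hρ.continuous (hasCompactSupport_of_tsupport_subset hs)
  exact (integrable_of_memLp_sobolev m.1.1).bdd_mul
    (contDiff_scaledKernel hρ t x).continuous.aestronglyMeasurable
    (.of_forall fun y => abs_scaledKernel_le hM ht x y)

theorem norm_mollifiedEval_sub_le [IsFiniteMeasure (volume.restrict Ω)] (hρ : ContDiff ℝ ∞ ρ)
    (hs : tsupport ρ ⊆ closedBall e η) {L : ℝ≥0} (hL : LipschitzWith L ρ) {t : ℝ} (ht : 0 < t)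
    (x x' : Rd d) :
    ‖mollifiedEval Ω q ρ t x - mollifiedEval Ω q ρ t x'‖
      ≤ (t ^ d)⁻¹ * (L * t⁻¹) * (volume.restrict Ω).real univ ^ (1 - 1 / q) * dist x x' := by
  refine ContinuousLinearMap.opNorm_le_bound _ (by positivity) fun m => ?_
  rw [sub_apply, mollifiedEval_apply hρ hs ht, mollifiedEval_apply hρ hs ht,
    ← integral_sub (integrable_scaledKernel_mul hρ hs ht x m)
      (integrable_scaledKernel_mul hρ hs ht x' m)]
  have hu := integrable_of_memLp_sobolev m.1.1
  calc ‖∫ y in Ω, (scaledKernel ρ t x y * m.1.1 y - scaledKernel ρ t x' y * m.1.1 y)‖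
      ≤ ∫ y in Ω, (t ^ d)⁻¹ * (L * t⁻¹) * dist x x' * ‖m.1.1 y‖ := by
        refine norm_integral_le_of_norm_le (hu.norm.const_mul _) (.of_forall fun y => ?_)
        rw [← sub_mul, norm_mul]
        exact mul_le_mul_of_nonneg_right (abs_scaledKernel_sub_le hL ht x x' y) (norm_nonneg _)
    _ = (t ^ d)⁻¹ * (L * t⁻¹) * dist x x' * ∫ y in Ω, ‖m.1.1 y‖ := integral_const_mul _ _
    _ ≤ (t ^ d)⁻¹ * (L * t⁻¹) * dist x x' *
          (‖m‖ * (volume.restrict Ω).real univ ^ (1 - 1 / q)) := by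
        refine mul_le_mul_of_nonneg_left ?_ (by positivity)
        have := setIntegral_norm_le_norm_mul_rpow m.1.1 univ
        rw [Measure.restrict_univ] at this
        exact this.trans (mul_le_mul_of_nonneg_right (norm_fst_le m.1) (by positivity))
    _ = _ := by ring

/-- Differentiation of the mollification in the scale: the weak gradient appears because the
`t`-derivative of the kernel is a divergence. -/
theorem hasDerivAt_mollifiedEval [IsFiniteMeasure (volume.restrict Ω)] (hρ : ContDiff ℝ ∞ ρ)
    (hs : tsupport ρ ⊆ closedBall e η) {t : ℝ} (ht : 0 < t) {x : Rd d}
    (hx : closedBall (x + t • e) (t * η) ⊆ Ω) (m : SobolevW1 Ω q) :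
    HasDerivAt (fun t => mollifiedEval Ω q ρ t x m)
      (∑ i, ∫ y in Ω, m.1.2 y i * scaledField ρ t x i y) t := by
  have hc := hasCompactSupport_of_tsupport_subset hs
  have hu := integrable_of_memLp_sobolev m.1.1
  have hcont : Continuous fun z : Rd d => d * ρ z + fderiv ℝ ρ z z :=
    (continuous_const.mul hρ.continuous).add
      ((hρ.continuous_fderiv (by simp)).clm_apply continuous_id)
  obtain ⟨N, hN0, hN⟩ := exists_abs_le_of_continuous hcont
    ((hc.mul_left (f := fun _ : Rd d => (d : ℝ))).add
      ((hc.fderiv ℝ).mono fun z hz => by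
        contrapose! hz; simp only [Function.mem_support, not_not] at hz ⊢; simp [hz]))
  have hcontD : Continuous (scaledKernelDeriv ρ t x) := by
    have := hcont.comp (f := fun y : Rd d => t⁻¹ • (y - x)) (by fun_prop)
    exact (continuous_const.mul this).neg
  have hev : (fun s => mollifiedEval Ω q ρ s x m)
      =ᶠ[𝓝 t] fun s => ∫ y in Ω, scaledKernel ρ s x y * m.1.1 y := by
    filter_upwards [lt_mem_nhds ht] with s hs0
    exact mollifiedEval_apply hρ hs hs0 x m
  refine HasDerivAt.congr_of_eventuallyEq ?_ hev
  have key := (hasDerivAt_integral_of_dominated_loc_of_deriv_le (μ := volume.restrict Ω)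
    (F := fun s y => scaledKernel ρ s x y * m.1.1 y)
    (F' := fun s y => scaledKernelDeriv ρ s x y * m.1.1 y)
    (bound := fun y => (t / 2)⁻¹ * ((t / 2) ^ d)⁻¹ * N * ‖m.1.1 y‖)
    (s := Ioi (t / 2)) (Ioi_mem_nhds (by linarith))
    (.of_forall fun s => (contDiff_scaledKernel hρ s x).continuous.aestronglyMeasurable.mul
      hu.aestronglyMeasurable)
    (integrable_scaledKernel_mul hρ hs ht x m)
    (hcontD.aestronglyMeasurable.mul hu.aestronglyMeasurable)
    (.of_forall fun y s hs' => ?_) (hu.norm.const_mul _)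
    (.of_forall fun y s hs' => (hasDerivAt_scaledKernel hρ
      (lt_trans (by linarith) hs') x y).mul_const _)).2
  · refine key.congr_deriv ?_
    have hterm : ∀ i : Fin d, ∫ y in Ω, m.1.2 y i * scaledField ρ t x i y
        = - ∫ y in Ω, m.1.1 y * fderiv ℝ (scaledField ρ t x i) y (EuclideanSpace.single i 1) := by
      intro i
      have hsub := tsupport_scaledField_subset hs ht x i
      rw [m.2 _ (contDiff_scaledField hρ t x i)
        ((isCompact_closedBall _ _).of_isClosed_subset (isClosed_tsupport _) hsub)
        (hsub.trans hx) i, neg_neg]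
    rw [Finset.sum_congr rfl (fun i _ => hterm i), Finset.sum_neg_distrib,
      ← integral_finsetSum, ← integral_neg]
    · refine integral_congr_ae (.of_forall fun y => ?_)
      simp only
      rw [← Finset.mul_sum, sum_fderiv_scaledField hρ]
      ring
    · intro i _
      have hsub := tsupport_scaledField_subset hs ht x i
      have hcc : HasCompactSupport (scaledField ρ t x i) :=
        (isCompact_closedBall _ _).of_isClosed_subset (isClosed_tsupport _) hsub
      exact integrable_mul_test Fact.out (Lp.memLp m.1.1)
        (continuous_partial (contDiff_scaledField hρ t x i) _) (hasCompactSupport_partial hcc _)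
  · have hs2 : t / 2 < s := hs'
    have hs0 : 0 < s := by linarith
    rw [norm_mul]
    refine mul_le_mul_of_nonneg_right ?_ (norm_nonneg _)
    rw [scaledKernelDeriv, norm_neg, norm_mul, norm_mul, Real.norm_eq_abs, Real.norm_eq_abs,
      Real.norm_eq_abs, abs_of_pos (by positivity : 0 < s⁻¹),
      abs_of_pos (by positivity : 0 < (s ^ d)⁻¹)]
    gcongr
    exact hN _

theorem abs_deriv_mollifiedEval_le [IsFiniteMeasure (volume.restrict Ω)] (hρ : ContDiff ℝ ∞ ρ)
    (hs : tsupport ρ ⊆ closedBall e η) (hη : 0 ≤ η) {M : ℝ} (hM : ∀ z, |ρ z| ≤ M) {t : ℝ}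
    (ht : 0 < t) (x : Rd d) (m : SobolevW1 Ω q) :
    |∑ i, ∫ y in Ω, m.1.2 y i * scaledField ρ t x i y|
      ≤ (M * (‖e‖ + η) * (η ^ d * volume.real (closedBall (0 : Rd d) 1)) ^ (1 - 1 / q))
        * t ^ (-(d / q)) * ‖m‖ := by
  have hM0 : 0 ≤ M := (abs_nonneg _).trans (hM 0)
  have hq1 : 1 < q := Fact.out
  have hexp : 0 ≤ 1 - 1 / q := by
    rw [sub_nonneg, div_le_one (by linarith)]; exact hq1.le
  set B := closedBall (x + t • e) (t * η) with hB
  have hG := integrable_of_memLp_sobolev m.1.2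
  have hint : ∀ i ∈ Finset.univ, Integrable (fun y => m.1.2 y i * scaledField ρ t x i y)
      (volume.restrict Ω) := by
    intro i _
    have hsub := tsupport_scaledField_subset hs ht x i
    exact integrable_mul_test Fact.out (memLp_coord (Lp.memLp m.1.2) i)
      (contDiff_scaledField hρ t x i).continuous
      ((isCompact_closedBall _ _).of_isClosed_subset (isClosed_tsupport _) hsub)
  rw [← integral_finsetSum _ hint, ← Real.norm_eq_abs]
  have hpt : ∀ y, ‖∑ i, m.1.2 y i * scaledField ρ t x i y‖
      ≤ B.indicator (fun y => (t ^ d)⁻¹ * M * (‖e‖ + η) * ‖m.1.2 y‖) y := by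
    intro y
    have hsum : ∑ i, m.1.2 y i * scaledField ρ t x i y
        = scaledKernel ρ t x y * inner ℝ (m.1.2 y) (t⁻¹ • (y - x)) := by
      rw [PiLp.inner_apply, Finset.mul_sum]
      refine Finset.sum_congr rfl fun i _ => ?_
      simp only [scaledField, Real.inner_apply]
      ring
    rw [hsum]
    by_cases hy : y ∈ B
    · rw [indicator_of_mem hy, norm_mul]
      have hz : ‖t⁻¹ • (y - x)‖ ≤ ‖e‖ + η := by
        have := (smul_sub_mem_closedBall_iff ht x y).2 hy
        have h2 := norm_le_norm_add_norm_sub' (t⁻¹ • (y - x)) e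
        rw [mem_closedBall, dist_eq_norm] at this
        linarith
      calc ‖scaledKernel ρ t x y‖ * ‖inner ℝ (m.1.2 y) (t⁻¹ • (y - x))‖
          ≤ ((t ^ d)⁻¹ * M) * (‖m.1.2 y‖ * (‖e‖ + η)) := by
            refine mul_le_mul (abs_scaledKernel_le hM ht x y) ?_ (norm_nonneg _) (by positivity)
            exact (norm_inner_le_norm _ _).trans (mul_le_mul_of_nonneg_left hz (norm_nonneg _))
        _ = _ := by ring
    · rw [indicator_of_notMem hy, scaledKernel_eq_zero hs ht hy]
      simp
  have hBm : MeasurableSet B := measurableSet_closedBall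
  have hvol : (volume.restrict Ω).real B
      ≤ t ^ d * (η ^ d * volume.real (closedBall (0 : Rd d) 1)) := by
    have h1 : (volume.restrict Ω).real B ≤ volume.real B :=
      ENNReal.toReal_mono measure_closedBall_lt_top.ne (Measure.restrict_apply_le _ _)
    refine h1.trans (le_of_eq ?_)
    rw [hB, Measure.addHaar_real_closedBall' _ _ (by positivity), finrank_euclideanSpace_fin]
    ring
  calc ‖∫ y in Ω, ∑ i, m.1.2 y i * scaledField ρ t x i y‖
      ≤ ∫ y in Ω, B.indicator (fun y => (t ^ d)⁻¹ * M * (‖e‖ + η) * ‖m.1.2 y‖) y :=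
        norm_integral_le_of_norm_le ((hG.norm.const_mul _).indicator hBm) (.of_forall hpt)
    _ = (t ^ d)⁻¹ * M * (‖e‖ + η) * ∫ y in B, ‖m.1.2 y‖ ∂(volume.restrict Ω) := by
        rw [integral_indicator hBm, integral_const_mul]
    _ ≤ (t ^ d)⁻¹ * M * (‖e‖ + η) *
          (‖m‖ * (t ^ d * (η ^ d * volume.real (closedBall (0 : Rd d) 1))) ^ (1 - 1 / q)) := by
        refine mul_le_mul_of_nonneg_left ?_ (by positivity)
        refine (setIntegral_norm_le_norm_mul_rpow m.1.2 B).trans ?_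
        gcongr
        exact norm_snd_le m.1
    _ = _ := by
        rw [Real.mul_rpow (by positivity) (by positivity)]
        have : (t ^ d)⁻¹ * (t ^ d) ^ (1 - 1 / q) = t ^ (-(d / q)) := by
          rw [← Real.rpow_natCast, ← Real.rpow_neg ht.le, ← Real.rpow_mul ht.le,
            ← Real.rpow_add ht]
          congr 1; field_simp; ring
        rw [← this]
        ring

/-- A function on `(0, 1)` whose derivative is `O(t^{γ - 1})` oscillates by `O(t^γ)` on `(0, t]`. -/
theorem abs_sub_le_of_deriv_le_rpow {f f' : ℝ → ℝ} {A γ : ℝ} (hA : 0 ≤ A) (hγ : 0 < γ)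
    (hf : ∀ t ∈ Ioo (0 : ℝ) 1, HasDerivAt f (f' t) t)
    (hf' : ∀ t ∈ Ioo (0 : ℝ) 1, |f' t| ≤ A * t ^ (γ - 1)) {s t : ℝ} (hs : s ∈ Ioo (0 : ℝ) 1)
    (ht : t ∈ Ioo (0 : ℝ) 1) (hst : s ≤ t) : |f t - f s| ≤ A / γ * t ^ γ := by
  have hmono : ∀ σ : ℝ, |σ| = 1 →
      MonotoneOn (fun t => A / γ * t ^ γ + σ * f t) (Ioo (0 : ℝ) 1) := by
    intro σ hσ
    have hd : ∀ t ∈ Ioo (0 : ℝ) 1, HasDerivAt (fun t => A / γ * t ^ γ + σ * f t)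
        (A / γ * (γ * t ^ (γ - 1)) + σ * f' t) t := fun t ht =>
      ((Real.hasDerivAt_rpow_const (Or.inl ht.1.ne')).const_mul _).add ((hf t ht).const_mul σ)
    refine monotoneOn_of_deriv_nonneg (convex_Ioo 0 1)
      (fun t ht => (hd t ht).continuousAt.continuousWithinAt)
      (fun t ht => ((hd t (interior_subset ht)).differentiableAt.differentiableWithinAt)) ?_
    intro t ht
    have ht := interior_subset ht
    rw [(hd t ht).deriv, ← mul_assoc, div_mul_cancel₀ _ hγ.ne']
    have h2 : |σ * f' t| ≤ A * t ^ (γ - 1) := by rw [abs_mul, hσ, one_mul]; exact hf' t ht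
    linarith [neg_abs_le (σ * f' t)]
  have h1 := hmono 1 (by simp) hs ht hst
  have h2 := hmono (-1) (by simp) hs ht hst
  simp only at h1 h2
  have h3 : 0 ≤ A / γ * s ^ γ := mul_nonneg (by positivity) (Real.rpow_nonneg hs.1.le _)
  rw [abs_le]
  constructor <;> linarith

/-- Morrey's estimate: the mollifications at two scales differ by `O(t^{1 - d/q})`. -/
theorem norm_mollifiedEval_sub_scale_le [IsFiniteMeasure (volume.restrict Ω)] (hq : (d : ℝ) < q)
    (hρ : ContDiff ℝ ∞ ρ) (hs : tsupport ρ ⊆ closedBall e η) (hη : 0 ≤ η) :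
    ∃ C, ∀ x : Rd d, (∀ t ∈ Ioo (0 : ℝ) 1, closedBall (x + t • e) (t * η) ⊆ Ω) →
      ∀ s ∈ Ioo (0 : ℝ) 1, ∀ t ∈ Ioo (0 : ℝ) 1, s ≤ t →
        ‖mollifiedEval Ω q ρ t x - mollifiedEval Ω q ρ s x‖ ≤ C * t ^ (1 - d / q) := by
  obtain ⟨M, hM0, hM⟩ :=
    exists_abs_le_of_continuous hρ.continuous (hasCompactSupport_of_tsupport_subset hs)
  have hq1 : 1 < q := Fact.out
  have hγ : 0 < 1 - d / q := by
    rw [sub_pos, div_lt_one (by linarith)]; exact hq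
  obtain ⟨A, hA0, hA⟩ : ∃ A : ℝ, 0 ≤ A ∧ ∀ t ∈ Ioo (0 : ℝ) 1, ∀ (x : Rd d) (m : SobolevW1 Ω q),
      |∑ i, ∫ y in Ω, m.1.2 y i * scaledField ρ t x i y| ≤ A * t ^ (-(d / q)) * ‖m‖ :=
    ⟨_, by positivity, fun t ht x m => abs_deriv_mollifiedEval_le hρ hs hη hM ht.1 x m⟩
  refine ⟨A / (1 - d / q), fun x hx s hs1 t ht hst => ?_⟩
  refine ContinuousLinearMap.opNorm_le_bound _
    (mul_nonneg (by positivity) (Real.rpow_nonneg ht.1.le _)) fun m => ?_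
  have h := abs_sub_le_of_deriv_le_rpow (A := A * ‖m‖) (by positivity) hγ
    (fun t ht => hasDerivAt_mollifiedEval hρ hs ht.1 (hx t ht) m)
    (fun t ht => by
      rw [show 1 - d / q - 1 = -(d / q) by ring, mul_right_comm]
      exact hA t ht x m) hs1 ht hst
  rw [sub_apply, Real.norm_eq_abs]
  refine h.trans (le_of_eq ?_)
  ring

end

section
variable {d : ℕ} {ρ : Rd d → ℝ} {e : Rd d} {η : ℝ} {Ω : Set (Rd d)} {q : ℝ} [Fact (1 < q)]

theorem inv_mul_mul_eq_of_ne_zero {b c : ℝ} (hb : b ≠ 0) (hc : c ≠ 0) (M I : ℝ) :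
    b⁻¹ * M * I = M * c * ((b * c)⁻¹ * I) := by
  field_simp

/-- Lebesgue's differentiation theorem for the mollifications, whose kernels live on balls that
need not be centred at `x` but shrink to `x` regularly. -/
theorem ae_tendsto_mollifiedEval [IsFiniteMeasure (volume.restrict Ω)] (hΩ : MeasurableSet Ω)
    (hρ : ContDiff ℝ ∞ ρ) (hs : tsupport ρ ⊆ closedBall e η) (hη : 0 < η) (h1 : ∫ z, ρ z = 1)
    {T : ℕ → ℝ} (hT : Tendsto T atTop (𝓝 0)) (hT0 : ∀ n, 0 < T n) (m : SobolevW1 Ω q) :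
    ∀ᵐ x ∂(volume.restrict Ω),
      Tendsto (fun n => mollifiedEval Ω q ρ (T n) x m) atTop (𝓝 (m.1.1 x)) := by
  obtain ⟨M, hM0, hM⟩ :=
    exists_abs_le_of_continuous hρ.continuous (hasCompactSupport_of_tsupport_subset hs)
  set u : Rd d → ℝ := Ω.indicator m.1.1 with hu
  have hui : Integrable u volume :=
    (integrable_indicator_iff hΩ).2 (integrable_of_memLp_sobolev m.1.1)
  have hleb := IsUnifLocDoublingMeasure.ae_tendsto_average_norm_sub (μ := volume)
    hui.locallyIntegrable (‖e‖ / η)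
  filter_upwards [ae_restrict_of_ae hleb, ae_restrict_mem hΩ] with x hx hxΩ
  have havg := hx (l := atTop) (fun n => x + T n • e) (fun n => T n * η)
    (tendsto_nhdsWithin_iff.2 ⟨by simpa using hT.mul_const η,
      .of_forall fun n => mul_pos (hT0 n) hη⟩)
    (.of_forall fun n => by
      rw [mem_closedBall, dist_self_add_right, norm_smul, Real.norm_eq_abs, abs_of_pos (hT0 n)]
      field_simp; exact le_rfl)
  have hux : u x = m.1.1 x := indicator_of_mem hxΩ _
  rw [← hux, tendsto_iff_norm_sub_tendsto_zero]
  refine squeeze_zero (fun n => norm_nonneg _) (fun n => ?_)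
    (by simpa using havg.const_mul (M * (η ^ d * volume.real (closedBall (0 : Rd d) 1))))
  have ht := hT0 n
  set t := T n with htdef
  set B := closedBall (x + t • e) (t * η) with hB
  have hvol : volume.real B = t ^ d * (η ^ d * volume.real (closedBall (0 : Rd d) 1)) := by
    rw [hB, Measure.addHaar_real_closedBall' _ _ (by positivity), finrank_euclideanSpace_fin]
    ring
  have hvpos : 0 < volume.real (closedBall (0 : Rd d) 1) :=
    ENNReal.toReal_pos (measure_closedBall_pos _ _ one_pos).ne' measure_closedBall_lt_top.ne
  have hk := (contDiff_scaledKernel hρ t x).continuous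
  have hkc : HasCompactSupport (scaledKernel ρ t x) := by
    refine HasCompactSupport.intro (isCompact_closedBall (x + t • e) (t * η)) fun y hy => ?_
    exact scaledKernel_eq_zero hs ht hy
  have hki : Integrable (scaledKernel ρ t x) volume := hk.integrable_of_hasCompactSupport hkc
  have hkui : Integrable (fun y => scaledKernel ρ t x y * u y) volume :=
    hui.bdd_mul hk.aestronglyMeasurable (.of_forall fun y => abs_scaledKernel_le hM ht x y)
  have hdiff : mollifiedEval Ω q ρ t x m - u x
      = ∫ y, scaledKernel ρ t x y * (u y - u x) := by
    have e1 : mollifiedEval Ω q ρ t x m = ∫ y, scaledKernel ρ t x y * u y := by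
      rw [mollifiedEval_apply hρ hs ht, ← integral_indicator hΩ]
      congr 1; ext y
      rw [hu, indicator_mul_right]
    simp_rw [mul_sub]
    rw [integral_sub hkui (hki.mul_const _), integral_mul_const, integral_scaledKernel h1 ht,
      one_mul, e1]
  have hint : Integrable (fun y => ‖u y - u x‖) (volume.restrict B) :=
    (hui.integrableOn.sub (integrableOn_const measure_closedBall_lt_top.ne)).norm
  rw [hdiff]
  calc ‖∫ y, scaledKernel ρ t x y * (u y - u x)‖
      ≤ ∫ y, B.indicator (fun y => (t ^ d)⁻¹ * M * ‖u y - u x‖) y := by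
        refine norm_integral_le_of_norm_le
          ((integrable_indicator_iff measurableSet_closedBall).2 (hint.const_mul _))
          (.of_forall fun y => ?_)
        by_cases hy : y ∈ B
        · rw [indicator_of_mem hy, norm_mul]
          exact mul_le_mul_of_nonneg_right (abs_scaledKernel_le hM ht x y) (norm_nonneg _)
        · rw [indicator_of_notMem hy, scaledKernel_eq_zero hs ht hy]
          simp
    _ = (t ^ d)⁻¹ * M * ∫ y in B, ‖u y - u x‖ := by
        rw [integral_indicator measurableSet_closedBall, integral_const_mul]
    _ = _ := by
        rw [setAverage_eq, hvol, smul_eq_mul]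
        exact inv_mul_mul_eq_of_ne_zero (pow_pos ht d).ne' (mul_pos (pow_pos hη d) hvpos).ne' _ _

/-- A sequence of continuous functions that is Cauchy uniformly on `S` has a continuous limit. -/
theorem exists_continuousOn_limit {X E : Type*} [TopologicalSpace X] [NormedAddCommGroup E]
    [CompleteSpace E] {S : Set X} {Φ : ℕ → X → E} (hΦ : ∀ n, ContinuousOn (Φ n) S) {b : ℕ → ℝ}
    (hb : Tendsto b atTop (𝓝 0)) (h : ∀ i j, i ≤ j → ∀ x ∈ S, ‖Φ i x - Φ j x‖ ≤ b i) :
    ∃ F : X → E, ContinuousOn F S ∧ ∀ x ∈ S, Tendsto (fun n => Φ n x) atTop (𝓝 (F x)) := by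
  have hcauchy : UniformCauchySeqOn Φ atTop S := by
    rw [Metric.uniformCauchySeqOn_iff]
    intro ε hε
    obtain ⟨N, hN⟩ := eventually_atTop.1 (hb.eventually (gt_mem_nhds hε))
    refine ⟨N, fun i hi j hj x hx => ?_⟩
    rw [dist_eq_norm]
    rcases le_total i j with h' | h'
    · exact (h i j h' x hx).trans_lt (hN i hi)
    · rw [norm_sub_rev]
      exact (h j i h' x hx).trans_lt (hN j hj)
  have hex : ∀ x, ∃ l, x ∈ S → Tendsto (fun n => Φ n x) atTop (𝓝 l) := by
    intro x
    by_cases hx : x ∈ S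
    · obtain ⟨l, hl⟩ := cauchySeq_tendsto_of_complete (hcauchy.cauchySeq hx)
      exact ⟨l, fun _ => hl⟩
    · exact ⟨0, fun h => absurd h hx⟩
  choose F hF using hex
  exact ⟨F, (hcauchy.tendstoUniformlyOn_of_tendsto hF).continuousOn (.of_forall hΦ), hF⟩

theorem continuous_mollifiedEval [IsFiniteMeasure (volume.restrict Ω)] (hρ : ContDiff ℝ ∞ ρ)
    (hs : tsupport ρ ⊆ closedBall e η) {t : ℝ} (ht : 0 < t) :
    Continuous (mollifiedEval Ω q ρ t) := by
  obtain ⟨L, hL⟩ := hρ.lipschitzWith_of_hasCompactSupport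
    (hasCompactSupport_of_tsupport_subset hs) (by simp)
  obtain ⟨A, hA0, hA⟩ : ∃ A : ℝ, 0 ≤ A ∧ ∀ x y,
      ‖mollifiedEval Ω q ρ t x - mollifiedEval Ω q ρ t y‖ ≤ A * dist x y :=
    ⟨_, by positivity, norm_mollifiedEval_sub_le hρ hs hL ht⟩
  have hlip : LipschitzWith A.toNNReal (mollifiedEval Ω q ρ t) := by
    refine LipschitzWith.of_dist_le_mul fun x y => ?_
    rw [dist_eq_norm, Real.coe_toNNReal _ hA0]
    exact hA x y
  exact hlip.continuous

theorem exists_smooth_kernel (e : Rd d) (hη : 0 < η) :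
    ∃ ρ : Rd d → ℝ, ContDiff ℝ ∞ ρ ∧ tsupport ρ ⊆ closedBall e η ∧ ∫ z, ρ z = 1 := by
  let b : ContDiffBump e := ⟨η / 2, η, by positivity, by linarith⟩
  exact ⟨b.normed volume, b.contDiff_normed, b.tsupport_normed_eq.subset, b.integral_normed⟩

theorem exists_antitone_seq_tendsto_zero :
    ∃ T : ℕ → ℝ, Antitone T ∧ Tendsto T atTop (𝓝 0) ∧ ∀ n, T n ∈ Ioo (0 : ℝ) 1 := by
  obtain ⟨T, hT, hT0, hlim⟩ := exists_seq_strictAnti_tendsto' (one_pos : (0 : ℝ) < 1)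
  exact ⟨T, hT.antitone, hlim, hT0⟩

set_option maxHeartbeats 800000 in
/-- On a set of points which all carry a scaled copy of the same cone inside `Ω`, the evaluations
`m ↦ m(x)` are limits of mollifications, uniformly for the dual norm. -/
theorem exists_continuousOn_eval_of_cone [IsFiniteMeasure (volume.restrict Ω)]
    (hΩ : MeasurableSet Ω) (hq : (d : ℝ) < q) (hη : 0 < η) {S : Set (Rd d)}
    (hS : ∀ x ∈ S, ∀ t ∈ Ioo (0 : ℝ) 1, closedBall (x + t • e) (t * η) ⊆ Ω) :
    ∃ F : Rd d → (SobolevW1 Ω q →L[ℝ] ℝ), ContinuousOn F S ∧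
      ∀ m : SobolevW1 Ω q, ∀ᵐ x ∂(volume.restrict Ω), x ∈ S → m.1.1 x = F x m := by
  obtain ⟨ρ, hρ, hs, h1⟩ := exists_smooth_kernel e hη
  obtain ⟨C, hC⟩ := norm_mollifiedEval_sub_scale_le (Ω := Ω) hq hρ hs hη.le
  have hq1 : 1 < q := Fact.out
  have hγ : 0 < 1 - d / q := by rw [sub_pos, div_lt_one (by linarith)]; exact hq
  obtain ⟨T, hanti, hT, hT0⟩ := exists_antitone_seq_tendsto_zero
  have hTlim : Tendsto (fun n => C * T n ^ (1 - d / q)) atTop (𝓝 0) := by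
    have := (hT.rpow_const (p := 1 - d / q) (Or.inr hγ.le)).const_mul C
    rwa [Real.zero_rpow hγ.ne', mul_zero] at this
  obtain ⟨F, hF, hFlim⟩ := exists_continuousOn_limit (S := S)
    (Φ := fun n x => mollifiedEval Ω q ρ (T n) x)
    (fun n => (continuous_mollifiedEval hρ hs (hT0 n).1).continuousOn) hTlim
    (fun i j hij x hx => hC x (hS x hx) _ (hT0 j) _ (hT0 i) (hanti hij))
  refine ⟨F, hF, fun m => ?_⟩
  filter_upwards [ae_tendsto_mollifiedEval hΩ hρ hs hη h1 hT (fun n => (hT0 n).1) m] with x hx hxS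
  exact tendsto_nhds_unique hx (((continuous_eval_const m).tendsto _).comp (hFlim x hxS))

/-! ### Smooth boundaries satisfy a uniform interior cone condition -/

/-- Near a boundary point `Ω` is `{g < 0}` and `closure Ω` lies in `{g ≤ 0}`, so a thin cone around
a direction of decrease of `g`, attached to any nearby point of `closure Ω`, lies inside `Ω`. -/
theorem exists_cone_of_mem_frontier (hΩ : HasSmoothBoundary Ω) {x₀ : Rd d}
    (hx₀ : x₀ ∈ frontier Ω) :
    ∃ V : Set (Rd d), IsOpen V ∧ x₀ ∈ V ∧ ∃ (e : Rd d) (η : ℝ), 0 < η ∧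
      ∀ x ∈ V ∩ closure Ω, ∀ t ∈ Ioo (0 : ℝ) 1, closedBall (x + t • e) (t * η) ⊆ Ω := by
  obtain ⟨U, hUo, hxU, g, hg, hdg, hU⟩ := hΩ x₀ hx₀
  -- a direction along which `g` decreases
  obtain ⟨v, hv⟩ : ∃ v, fderiv ℝ g x₀ v < 0 := by
    obtain ⟨v, hv⟩ : ∃ v, fderiv ℝ g x₀ v ≠ 0 := by
      by_contra! h
      exact hdg (ContinuousLinearMap.ext h)
    rcases lt_or_gt_of_ne hv with h | h
    · exact ⟨v, h⟩
    · exact ⟨-v, by rw [map_neg]; linarith⟩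
  have hcont : Continuous fun z : Rd d × Rd d => fderiv ℝ g z.1 z.2 :=
    ((hg.continuous_fderiv (by simp)).comp continuous_fst).clm_apply continuous_snd
  have hmem : {z : Rd d × Rd d | z.1 ∈ U ∧ fderiv ℝ g z.1 z.2 < 0} ∈ 𝓝 (x₀, v) :=
    ((hUo.preimage continuous_fst).inter (isOpen_Iio.preimage hcont)).mem_nhds ⟨hxU, hv⟩
  obtain ⟨δ, hδ, hball⟩ := Metric.mem_nhds_iff.1 hmem
  have key : ∀ x w : Rd d, dist x x₀ < δ → dist w v < δ → x ∈ U ∧ fderiv ℝ g x w < 0 := by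
    intro x w hx hw
    have hmem' : (x, w) ∈ ball (x₀, v) δ := by
      rw [mem_ball, Prod.dist_eq]; exact max_lt hx hw
    exact hball hmem'
  -- scale the cone so that it stays in the ball of radius `δ` around `x₀`
  set c : ℝ := δ / 2 / (‖v‖ + δ) with hc
  have hc0 : 0 < c := by positivity
  refine ⟨ball x₀ (δ / 2), isOpen_ball, mem_ball_self (by positivity), c • v, c * (δ / 2),
    by positivity, ?_⟩
  rintro x ⟨hxV, hxcl⟩ t ht y hy
  have hxV' : dist x x₀ < δ / 2 := hxV
  have hgx : g x ≤ 0 := by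
    have h1 : x ∈ closure (Ω ∩ U) := by
      rw [inter_comm]
      exact hUo.inter_closure ⟨(key x v (by linarith) (by simpa using hδ)).1, hxcl⟩
    have h2 : closure (Ω ∩ U) ⊆ {x | g x ≤ 0} := by
      refine closure_minimal ?_ (isClosed_le hg.continuous continuous_const)
      rw [hU]
      exact fun z hz => le_of_lt hz.2
    exact h2 h1
  set w : Rd d := (t * c)⁻¹ • (y - x) with hw
  have htc : 0 < t * c := mul_pos ht.1 hc0
  have hyw : y = x + (t * c) • w := by
    rw [hw, smul_inv_smul₀ htc.ne', add_sub_cancel]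
  have hwv : dist w v < δ := by
    have h1 : y - (x + t • c • v) = (t * c) • (w - v) := by
      rw [hyw, smul_sub, smul_smul t c v]; abel
    rw [mem_closedBall, dist_eq_norm, h1, norm_smul, Real.norm_eq_abs, abs_of_pos htc,
      ← mul_assoc, mul_le_mul_iff_right₀ htc, ← dist_eq_norm] at hy
    linarith
  have hwn : ‖w‖ < ‖v‖ + δ := by
    have := norm_le_norm_add_norm_sub' w v
    rw [dist_eq_norm] at hwv
    linarith
  have hseg : ∀ s ∈ Icc (0 : ℝ) (t * c), dist (x + s • w) x₀ < δ := by
    intro s hs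
    have h1 : dist (x + s • w) x ≤ δ / 2 := by
      rw [dist_self_add_left, norm_smul, Real.norm_eq_abs, abs_of_nonneg hs.1]
      calc s * ‖w‖ ≤ c * (‖v‖ + δ) := by
            refine mul_le_mul (hs.2.trans ?_) hwn.le (norm_nonneg _) hc0.le
            nlinarith [ht.2]
        _ = δ / 2 := by rw [hc]; field_simp
    linarith [dist_triangle (x + s • w) x x₀]
  have hder : ∀ s : ℝ, HasDerivAt (fun s : ℝ => g (x + s • w)) (fderiv ℝ g (x + s • w) w) s := by
    intro s
    have h1 : HasDerivAt (fun s : ℝ => x + s • w) w s := by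
      simpa using ((hasDerivAt_id s).smul_const w).const_add x
    exact ((hg.differentiable (by simp)) _).hasFDerivAt.comp_hasDerivAt s h1
  have hanti : StrictAntiOn (fun s : ℝ => g (x + s • w)) (Icc 0 (t * c)) := by
    refine strictAntiOn_of_deriv_neg (convex_Icc _ _)
      (fun s _ => (hder s).continuousAt.continuousWithinAt) fun s hs => ?_
    rw [(hder s).deriv]
    exact (key _ w (hseg s (interior_subset hs)) hwv).2
  have hlt := hanti (left_mem_Icc.2 htc.le) (right_mem_Icc.2 htc.le) htc
  simp only [zero_smul, add_zero] at hlt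
  have : y ∈ Ω ∩ U := by
    rw [hU, hyw]
    exact ⟨(key _ w (hseg _ (right_mem_Icc.2 htc.le)) hwv).1, by linarith⟩
  exact this.1

theorem exists_cone_of_mem_closure (hΩo : IsOpen Ω) (hΩ : HasSmoothBoundary Ω) {x₀ : Rd d}
    (hx₀ : x₀ ∈ closure Ω) :
    ∃ V : Set (Rd d), IsOpen V ∧ x₀ ∈ V ∧ ∃ (e : Rd d) (η : ℝ), 0 < η ∧
      ∀ x ∈ V ∩ closure Ω, ∀ t ∈ Ioo (0 : ℝ) 1, closedBall (x + t • e) (t * η) ⊆ Ω := by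
  by_cases h : x₀ ∈ Ω
  · obtain ⟨δ, hδ, hball⟩ := Metric.isOpen_iff.1 hΩo x₀ h
    refine ⟨ball x₀ (δ / 2), isOpen_ball, mem_ball_self (by positivity), 0, δ / 2, by positivity,
      fun x hx t ht y hy => hball ?_⟩
    have hx1 : dist x x₀ < δ / 2 := hx.1
    rw [smul_zero, add_zero, mem_closedBall] at hy
    rw [mem_ball]
    have : t * (δ / 2) < δ / 2 := by nlinarith [ht.2]
    linarith [dist_triangle y x x₀]
  · exact exists_cone_of_mem_frontier hΩ (by rw [hΩo.frontier_eq]; exact ⟨hx₀, h⟩)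

/-! ### Evaluation at points of the closure -/

/-- Two functions continuous on a relatively open part of `closure Ω` which agree almost everywhere
on `Ω` agree on that part, as `Ω` is dense in it and non-empty open sets have positive measure. -/
theorem eq_of_ae_eq_of_continuousOn (hΩ : IsOpen Ω) {V : Set (Rd d)} (hV : IsOpen V)
    {f g : Rd d → ℝ} (hf : ContinuousOn f (V ∩ closure Ω)) (hg : ContinuousOn g (V ∩ closure Ω))
    (h : ∀ᵐ x ∂(volume.restrict Ω), x ∈ V → f x = g x) {x : Rd d} (hx : x ∈ V ∩ closure Ω) :
    f x = g x := by
  have hsub : V ∩ Ω ⊆ V ∩ closure Ω := inter_subset_inter_right _ subset_closure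
  have heq : EqOn f g (V ∩ Ω) := by
    refine Measure.eqOn_open_of_ae_eq (μ := volume) ?_ (hV.inter hΩ) (hf.mono hsub) (hg.mono hsub)
    rw [Filter.EventuallyEq, ae_restrict_iff' (hV.inter hΩ).measurableSet]
    rw [ae_restrict_iff' hΩ.measurableSet] at h
    filter_upwards [h] with y hy hyV using hy hyV.2 hyV.1
  have hcl : x ∈ closure (V ∩ Ω) := hV.inter_closure hx
  have hW : (𝓝[V ∩ Ω] x).NeBot := mem_closure_iff_nhdsWithin_neBot.1 hcl
  have t1 : Tendsto f (𝓝[V ∩ Ω] x) (𝓝 (f x)) := (hf x hx).mono_left (nhdsWithin_mono _ hsub)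
  have t2 : Tendsto g (𝓝[V ∩ Ω] x) (𝓝 (g x)) := (hg x hx).mono_left (nhdsWithin_mono _ hsub)
  refine tendsto_nhds_unique (t1.congr' ?_) t2
  filter_upwards [self_mem_nhdsWithin] with y hy using heq hy

end

section
variable {d : ℕ} {Ω : Set (Rd d)} {q : ℝ} [Fact (1 < q)]

set_option maxHeartbeats 1600000 in
/-- Morrey's theorem for `q > d`: the evaluations at the points of `closure Ω` form a norm
continuous family of functionals on `W^{1,q}(Ω)`. As `closure Ω` is compact, this contains the
embedding into `C(closure Ω)` and the equicontinuity of its unit ball. -/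
theorem exists_continuousOn_eval (hΩo : IsOpen Ω) (hΩb : Bornology.IsBounded Ω)
    (hΩs : HasSmoothBoundary Ω) (hq : (d : ℝ) < q) :
    ∃ F : Rd d → (SobolevW1 Ω q →L[ℝ] ℝ), ContinuousOn F (closure Ω) ∧
      ∀ m : SobolevW1 Ω q, m.1.1 =ᵐ[volume.restrict Ω] fun x => F x m := by
  have := isFiniteMeasure_restrict_of_isBounded hΩb
  have hloc : ∀ x₀ : Rd d, ∃ (V : Set (Rd d)) (F : Rd d → (SobolevW1 Ω q →L[ℝ] ℝ)),
      x₀ ∈ closure Ω → IsOpen V ∧ x₀ ∈ V ∧ ContinuousOn F (V ∩ closure Ω) ∧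
      ∀ m : SobolevW1 Ω q, ∀ᵐ x ∂(volume.restrict Ω), x ∈ V ∩ closure Ω → m.1.1 x = F x m := by
    intro x₀
    by_cases hx₀ : x₀ ∈ closure Ω
    · obtain ⟨V, hV, hxV, e, η, hη, hcone⟩ := exists_cone_of_mem_closure hΩo hΩs hx₀
      obtain ⟨F, hF, hFm⟩ := exists_continuousOn_eval_of_cone hΩo.measurableSet hq hη hcone
      exact ⟨V, F, fun _ => ⟨hV, hxV, hF, hFm⟩⟩
    · exact ⟨∅, 0, fun h => absurd h hx₀⟩
  choose V F hVF using hloc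
  have hagree : ∀ x₀ ∈ closure Ω, ∀ x ∈ V x₀ ∩ closure Ω, F x x = F x₀ x := by
    intro x₀ hx₀ x hx
    obtain ⟨hV0, -, hc0, hm0⟩ := hVF x₀ hx₀
    obtain ⟨hV1, hxV1, hc1, hm1⟩ := hVF x hx.2
    ext m
    have ev : Continuous fun l : SobolevW1 Ω q →L[ℝ] ℝ => l m :=
      (ContinuousLinearMap.apply ℝ ℝ m).continuous
    refine eq_of_ae_eq_of_continuousOn (f := fun y => F x y m) (g := fun y => F x₀ y m) hΩo
      (hV0.inter hV1) ?_ ?_ ?_ ⟨⟨hx.1, hxV1⟩, hx.2⟩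
    · exact ev.comp_continuousOn (hc1.mono fun y hy => ⟨hy.1.2, hy.2⟩)
    · exact ev.comp_continuousOn (hc0.mono fun y hy => ⟨hy.1.1, hy.2⟩)
    · filter_upwards [hm0 m, hm1 m, ae_restrict_mem hΩo.measurableSet] with y h0 h1 hy hyV
      rw [← h0 ⟨hyV.1, subset_closure hy⟩, ← h1 ⟨hyV.2, subset_closure hy⟩]
  refine ⟨fun x => F x x, fun x₀ hx₀ => ?_, fun m => ?_⟩
  · obtain ⟨hV0, hxV, hc0, -⟩ := hVF x₀ hx₀
    have h1 : ContinuousWithinAt (F x₀) (V x₀ ∩ closure Ω) x₀ := hc0 x₀ ⟨hxV, hx₀⟩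
    have h2 : ContinuousWithinAt (fun x => F x x) (V x₀ ∩ closure Ω) x₀ :=
      h1.congr (fun y hy => hagree x₀ hx₀ y hy) rfl
    rw [inter_comm] at h2
    exact (continuousWithinAt_inter (hV0.mem_nhds hxV)).1 h2
  · -- countably many of the neighbourhoods cover `Ω`
    obtain ⟨c, hcs, hcount, hcov⟩ := TopologicalSpace.countable_cover_nhdsWithin
      (s := closure Ω) (f := V)
      (fun x hx => mem_nhdsWithin_of_mem_nhds ((hVF x hx).1.mem_nhds (hVF x hx).2.1))
    have hall : ∀ᵐ x ∂(volume.restrict Ω), ∀ i ∈ c, x ∈ V i ∩ closure Ω → m.1.1 x = F i x m :=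
      (ae_ball_iff hcount).2 fun i hi => (hVF i (hcs hi)).2.2.2 m
    filter_upwards [hall, ae_restrict_mem hΩo.measurableSet] with x hx hxΩ
    obtain ⟨i, hi, hxi⟩ := mem_iUnion₂.1 (hcov (subset_closure hxΩ))
    rw [hx i hi ⟨hxi, subset_closure hxΩ⟩, hagree i (hcs hi) x ⟨hxi, subset_closure hxΩ⟩]

end

/-! ### The integrand and its dual representation -/

section
variable {d : ℕ} {r : ℝ}

theorem ellFun_of_pos {a : ℝ} (ha : 0 < a) (b : Rd d) :
    ellFun r a b = ENNReal.ofReal (1 / r * (‖b‖ ^ r / a ^ (r - 1))) := if_pos ha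

theorem ellFun_zero_zero : ellFun r 0 (0 : Rd d) = 0 := by
  rw [ellFun, if_neg (lt_irrefl _), if_pos ⟨rfl, rfl⟩]

theorem ellFun_of_not {a : ℝ} {b : Rd d} (ha : ¬ 0 < a) (hab : ¬ (a = 0 ∧ b = 0)) :
    ellFun r a b = ⊤ := by rw [ellFun, if_neg ha, if_neg hab]

/-- On the ray `b = a v` the integrand is `a |v|^r / r`. -/
theorem ellFun_smul {a : ℝ} (ha : 0 ≤ a) (v : Rd d) :
    ellFun r a (a • v) = ENNReal.ofReal (1 / r * (a * ‖v‖ ^ r)) := by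
  rcases ha.eq_or_lt with rfl | ha
  · rw [zero_smul, ellFun_zero_zero]; simp
  · rw [ellFun_of_pos ha, norm_smul, Real.norm_eq_abs, abs_of_pos ha,
      Real.mul_rpow ha.le (norm_nonneg _), Real.rpow_sub_one ha.ne']
    have : 0 < a ^ r := Real.rpow_pos_of_pos ha r
    congr 2
    field_simp

/-- Young's inequality: elements of `A_{r'}` are minorants of the integrand. -/
theorem ofReal_pairing_le_ellFun (hr : 1 < r) {c : ℝ × Rd d} (hc : c ∈ setA d r.conjExponent)
    (m : ℝ) (w : Rd d) : ENNReal.ofReal (c.1 * m + inner ℝ c.2 w) ≤ ellFun r m w := by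
  have hconj : r.HolderConjugate r.conjExponent := Real.HolderConjugate.conjExponent hr
  set s := r.conjExponent with hs
  have hs1 : 1 < s := hconj.symm.lt
  have hc : c.1 + 1 / s * ‖c.2‖ ^ s ≤ 0 := hc
  by_cases hm : 0 < m
  · rw [ellFun_of_pos hm]
    refine ENNReal.ofReal_le_ofReal ?_
    have hy := Real.young_inequality_of_nonneg (norm_nonneg c.2)
      (div_nonneg (norm_nonneg w) hm.le) hconj.symm
    have hin : inner ℝ c.2 w ≤ m * (‖c.2‖ * (‖w‖ / m)) := by
      refine (real_inner_le_norm _ _).trans (le_of_eq ?_)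
      field_simp
    have hR : 1 / r * (‖w‖ ^ r / m ^ (r - 1)) = m * ((‖w‖ / m) ^ r / r) := by
      rw [Real.div_rpow (norm_nonneg w) hm.le, Real.rpow_sub_one hm.ne']
      have : 0 < m ^ r := Real.rpow_pos_of_pos hm r
      field_simp
    rw [hR]
    calc c.1 * m + inner ℝ c.2 w ≤ -(1 / s * ‖c.2‖ ^ s) * m + m * (‖c.2‖ * (‖w‖ / m)) := by
          gcongr; linarith
      _ ≤ -(1 / s * ‖c.2‖ ^ s) * m + m * (‖c.2‖ ^ s / s + (‖w‖ / m) ^ r / r) := by gcongr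
      _ = m * ((‖w‖ / m) ^ r / r) := by ring
  · by_cases hmw : m = 0 ∧ w = 0
    · rw [hmw.1, hmw.2, ellFun_zero_zero]; simp
    · rw [ellFun_of_not hm hmw]; exact le_top

/-- The norm of the vector component of the truncated maximizer of `a m + b · w` over `A_{r'}`. -/
noncomputable def maximizerNorm (r : ℝ) (n : ℕ) (m s : ℝ) : ℝ :=
  if 0 < m then min ((s / m) ^ (r - 1)) n else if m = 0 then n else 0

/-- The vector component of a maximizer of `a m + b · w` over the `(a, b) ∈ A_{r'}` bounded in
terms of `n`. -/
noncomputable def maximizerVec (r : ℝ) (n : ℕ) (m : ℝ) (w : Rd d) : Rd d :=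
  (maximizerNorm r n m ‖w‖ / ‖w‖) • w

/-- The scalar component belonging to `maximizerVec`. -/
noncomputable def maximizerScal (r : ℝ) (n : ℕ) (m : ℝ) (w : Rd d) : ℝ :=
  if m < 0 then -n else -(1 / r.conjExponent * ‖maximizerVec r n m w‖ ^ r.conjExponent)

theorem maximizerNorm_nonneg (n : ℕ) (m : ℝ) {s : ℝ} (hs : 0 ≤ s) : 0 ≤ maximizerNorm r n m s := by
  unfold maximizerNorm
  split_ifs with h1 h2
  · exact le_min (Real.rpow_nonneg (by positivity) _) n.cast_nonneg
  · exact n.cast_nonneg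
  · exact le_rfl

theorem maximizerNorm_le (n : ℕ) (m s : ℝ) : maximizerNorm r n m s ≤ n := by
  unfold maximizerNorm
  split_ifs with h1 h2
  · exact min_le_right _ _
  · exact le_rfl
  · exact n.cast_nonneg

theorem norm_maximizerVec (n : ℕ) (m : ℝ) {w : Rd d} (hw : w ≠ 0) :
    ‖maximizerVec r n m w‖ = maximizerNorm r n m ‖w‖ := by
  have : 0 < ‖w‖ := norm_pos_iff.2 hw
  rw [maximizerVec, norm_smul, Real.norm_eq_abs,
    abs_of_nonneg (div_nonneg (maximizerNorm_nonneg n m (norm_nonneg _)) this.le),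
    div_mul_cancel₀ _ this.ne']

theorem norm_maximizerVec_le (n : ℕ) (m : ℝ) (w : Rd d) : ‖maximizerVec r n m w‖ ≤ n := by
  by_cases hw : w = 0
  · simp [maximizerVec, hw]
  · rw [norm_maximizerVec n m hw]; exact maximizerNorm_le n m _

theorem inner_maximizerVec (n : ℕ) (m : ℝ) (w : Rd d) :
    inner ℝ (maximizerVec r n m w) w = maximizerNorm r n m ‖w‖ * ‖w‖ := by
  rw [maximizerVec, real_inner_smul_left, real_inner_self_eq_norm_sq]
  by_cases hw : w = 0
  · simp [hw]
  · have : ‖w‖ ≠ 0 := norm_ne_zero_iff.2 hw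
    field_simp

theorem maximizer_mem_setA (hr : 1 < r) (n : ℕ) (m : ℝ) (w : Rd d) :
    (maximizerScal r n m w, maximizerVec r n m w) ∈ setA d r.conjExponent := by
  have hs : 0 < r.conjExponent := (Real.HolderConjugate.conjExponent hr).symm.pos
  change maximizerScal r n m w + 1 / r.conjExponent * ‖maximizerVec r n m w‖ ^ r.conjExponent ≤ 0
  unfold maximizerScal
  split_ifs with h
  · have h0 : maximizerVec r n m w = 0 := by
      rw [maximizerVec, maximizerNorm, if_neg (not_lt.2 h.le), if_neg h.ne, zero_div, zero_smul]
    rw [h0, norm_zero, Real.zero_rpow hs.ne', mul_zero, add_zero]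
    exact neg_nonpos.2 n.cast_nonneg
  · linarith

theorem abs_maximizerScal_le (hr : 1 < r) (n : ℕ) (m : ℝ) (w : Rd d) :
    |maximizerScal r n m w| ≤ n + 1 / r.conjExponent * (n : ℝ) ^ r.conjExponent := by
  have hs : 0 < r.conjExponent := (Real.HolderConjugate.conjExponent hr).symm.pos
  have h1 : (0 : ℝ) ≤ n := n.cast_nonneg
  have h2 : 0 ≤ 1 / r.conjExponent * (n : ℝ) ^ r.conjExponent := by positivity
  unfold maximizerScal
  split_ifs with h
  · rw [abs_neg, abs_of_nonneg h1]; linarith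
  · rw [abs_neg, abs_of_nonneg (by positivity)]
    have : ‖maximizerVec r n m w‖ ^ r.conjExponent ≤ (n : ℝ) ^ r.conjExponent :=
      Real.rpow_le_rpow (norm_nonneg _) (norm_maximizerVec_le n m w) hs.le
    have := mul_le_mul_of_nonneg_left this (by positivity : 0 ≤ 1 / r.conjExponent)
    linarith

theorem measurable_maximizerVec (n : ℕ) :
    Measurable fun z : ℝ × Rd d => maximizerVec r n z.1 z.2 := by
  have hN : Measurable fun z : ℝ × Rd d => maximizerNorm r n z.1 ‖z.2‖ := by
    unfold maximizerNorm
    refine Measurable.ite (measurableSet_lt measurable_const measurable_fst) (by fun_prop)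
      (Measurable.ite (measurableSet_eq_fun measurable_fst measurable_const) (by fun_prop)
        (by fun_prop))
  exact (hN.div measurable_snd.norm).smul measurable_snd

theorem measurable_maximizerScal (n : ℕ) :
    Measurable fun z : ℝ × Rd d => maximizerScal r n z.1 z.2 := by
  have := measurable_maximizerVec (d := d) (r := r) n
  unfold maximizerScal
  refine Measurable.ite (measurableSet_lt measurable_fst measurable_const) measurable_const ?_
  fun_prop

/-- The value of the truncated problem for `m > 0`, where `c` is the norm of the maximizer. -/
theorem maximizer_value_of_pos (hr : 1 < r) (n : ℕ) {m : ℝ} (hm : 0 < m) (w : Rd d) :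
    maximizerScal r n m w * m + inner ℝ (maximizerVec r n m w) w
      = maximizerNorm r n m ‖w‖ * ‖w‖
        - m * (1 / r.conjExponent * maximizerNorm r n m ‖w‖ ^ r.conjExponent) := by
  have hs : 0 < r.conjExponent := (Real.HolderConjugate.conjExponent hr).symm.pos
  rw [inner_maximizerVec, maximizerScal, if_neg (not_lt.2 hm.le)]
  by_cases hw : w = 0
  · have : maximizerNorm r n m ‖w‖ = 0 := by
      rw [maximizerNorm, if_pos hm, hw, norm_zero, zero_div,
        Real.zero_rpow (sub_ne_zero.2 hr.ne'), min_eq_left n.cast_nonneg]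
    rw [this, maximizerVec, this, hw]
    simp [Real.zero_rpow hs.ne']
  · rw [norm_maximizerVec n m hw]; ring

theorem maximizer_value_nonneg (hr : 1 < r) (n : ℕ) (m : ℝ) (w : Rd d) :
    0 ≤ maximizerScal r n m w * m + inner ℝ (maximizerVec r n m w) w := by
  have hconj : r.HolderConjugate r.conjExponent := Real.HolderConjugate.conjExponent hr
  have hs : 0 < r.conjExponent := hconj.symm.pos
  have hN := maximizerNorm_nonneg (r := r) n m (norm_nonneg w)
  rcases lt_trichotomy m 0 with hm | hm | hm
  · rw [inner_maximizerVec, maximizerScal, if_pos hm]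
    have : 0 ≤ -(n : ℝ) * m := by nlinarith [(n.cast_nonneg : (0 : ℝ) ≤ n)]
    positivity
  · rw [inner_maximizerVec, hm, mul_zero, zero_add]
    rw [hm] at hN
    positivity
  · rw [maximizer_value_of_pos hr n hm]
    set c := maximizerNorm r n m ‖w‖ with hc
    rcases hN.eq_or_lt with h0 | hpos
    · rw [← h0, Real.zero_rpow hs.ne']; simp
    have hle : c ≤ (‖w‖ / m) ^ (r - 1) := by
      rw [hc, maximizerNorm, if_pos hm]; exact min_le_left _ _
    have h1 : c ^ (r.conjExponent - 1) ≤ ‖w‖ / m := by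
      have := Real.rpow_le_rpow hN hle (sub_nonneg.2 hconj.symm.lt.le)
      have e : (r - 1) * (r.conjExponent - 1) = 1 := by linarith [hconj.mul_eq_add]
      rwa [← Real.rpow_mul (by positivity), e, Real.rpow_one] at this
    have h2 : c ^ r.conjExponent = c * c ^ (r.conjExponent - 1) := by
      rw [Real.rpow_sub_one hpos.ne']; field_simp
    have h3 : m * c ^ (r.conjExponent - 1) ≤ ‖w‖ := by
      rw [mul_comm]; exact (le_div_iff₀ hm).1 h1
    have h4 : 1 / r.conjExponent ≤ 1 := by
      rw [div_le_one hs]; exact hconj.symm.lt.le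
    have h5 : 0 ≤ m * c ^ (r.conjExponent - 1) := by positivity
    have h6 : m * (1 / r.conjExponent * c ^ r.conjExponent)
        = c * (1 / r.conjExponent * (m * c ^ (r.conjExponent - 1))) := by rw [h2]; ring
    rw [h6, ← mul_sub]
    refine mul_nonneg hN (sub_nonneg.2 (le_trans ?_ h3))
    exact mul_le_of_le_one_left h5 h4

theorem tendsto_maximizer_value (hr : 1 < r) (m : ℝ) (w : Rd d) :
    Tendsto (fun n : ℕ => ENNReal.ofReal
      (maximizerScal r n m w * m + inner ℝ (maximizerVec r n m w) w)) atTop (𝓝 (ellFun r m w)) := by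
  have hconj : r.HolderConjugate r.conjExponent := Real.HolderConjugate.conjExponent hr
  rcases lt_trichotomy m 0 with hm | hm | hm
  · rw [ellFun_of_not (not_lt.2 hm.le) (fun h => hm.ne h.1)]
    refine ENNReal.tendsto_ofReal_nhds_top.2 ?_
    have : ∀ n : ℕ, maximizerScal r n m w * m + inner ℝ (maximizerVec r n m w) w = n * (-m) := by
      intro n
      rw [inner_maximizerVec, maximizerScal, if_pos hm, maximizerNorm, if_neg (not_lt.2 hm.le),
        if_neg hm.ne]
      ring
    simp_rw [this]
    exact tendsto_natCast_atTop_atTop.atTop_mul_const (neg_pos.2 hm)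
  · subst hm
    have hv : ∀ n : ℕ, maximizerScal r n 0 w * 0 + inner ℝ (maximizerVec r n 0 w) w = n * ‖w‖ := by
      intro n
      rw [inner_maximizerVec, maximizerNorm, if_neg (lt_irrefl _), if_pos rfl]
      ring
    simp_rw [hv]
    by_cases hw : w = 0
    · rw [hw, ellFun_zero_zero]; simp
    · rw [ellFun_of_not (lt_irrefl _) (fun h => hw h.2)]
      refine ENNReal.tendsto_ofReal_nhds_top.2 ?_
      exact tendsto_natCast_atTop_atTop.atTop_mul_const (norm_pos_iff.2 hw)
  · obtain ⟨N, hN⟩ := exists_nat_ge ((‖w‖ / m) ^ (r - 1))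
    refine tendsto_const_nhds.congr' ?_
    filter_upwards [eventually_ge_atTop N] with n hn
    have hmin : maximizerNorm r n m ‖w‖ = (‖w‖ / m) ^ (r - 1) := by
      rw [maximizerNorm, if_pos hm]
      exact min_eq_left (hN.trans (by exact_mod_cast hn))
    rw [ellFun_of_pos hm, maximizer_value_of_pos hr n hm, hmin]
    congr 1
    have hk : 0 ≤ ‖w‖ / m := by positivity
    rw [← Real.rpow_mul hk, hconj.sub_one_mul_conj]
    have h1 : ‖w‖ ^ r / m ^ (r - 1) = m * (‖w‖ / m) ^ r := by
      rw [Real.div_rpow (norm_nonneg w) hm.le, Real.rpow_sub_one hm.ne']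
      have : 0 < m ^ r := Real.rpow_pos_of_pos hm r
      field_simp
    have h2 : (‖w‖ / m) ^ (r - 1) * ‖w‖ = m * (‖w‖ / m) ^ r := by
      have e1 : (‖w‖ / m) ^ r = (‖w‖ / m) ^ (r - 1) * (‖w‖ / m) := by
        rw [← Real.rpow_add_one' hk (by linarith), sub_add_cancel]
      rw [e1]; field_simp
    have h3 : 1 / r = 1 - 1 / r.conjExponent := by
      have := hconj.inv_add_inv_eq_one
      rw [one_div, one_div]; linarith
    rw [h1, h2, h3]
    ring

end

/-! ### The functional as a supremum of continuous linear functionals -/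

section
variable {d : ℕ} {Ω : Set (Rd d)} {q : ℝ} [Fact (1 < q)]

theorem dualPairing_eq_lpPairing (p : DualSpace Ω q) (z : PrimalSpace Ω q) :
    dualPairing p z = p.1 z.1 + (innerSL ℝ).lpPairing (volume.restrict Ω)
      (ENNReal.ofReal q.conjExponent) (ENNReal.ofReal q) p.2 z.2 := by
  rw [dualPairing, ContinuousLinearMap.lpPairing_eq_integral]
  rfl

theorem continuous_dualPairing_left (z : PrimalSpace Ω q) :
    Continuous fun p : DualSpace Ω q => dualPairing p z := by
  simp_rw [dualPairing_eq_lpPairing]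
  exact ((continuous_eval_const z.1).comp continuous_fst).add
    ((((innerSL ℝ).lpPairing (volume.restrict Ω) (ENNReal.ofReal q.conjExponent)
      (ENNReal.ofReal q)).flip z.2).continuous.comp continuous_snd)

theorem continuous_dualPairing_right (p : DualSpace Ω q) :
    Continuous fun z : PrimalSpace Ω q => dualPairing p z := by
  simp_rw [dualPairing_eq_lpPairing]
  exact (p.1.continuous.comp continuous_fst).add
    ((ContinuousLinearMap.lpPairing _ _ _ _ p.2).continuous.comp continuous_snd)

theorem dualPairing_add (p : DualSpace Ω q) (z z' : PrimalSpace Ω q) :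
    dualPairing p (z + z') = dualPairing p z + dualPairing p z' := by
  simp only [dualPairing_eq_lpPairing, Prod.fst_add, Prod.snd_add, map_add]
  ring

theorem dualPairing_smul (p : DualSpace Ω q) (t : ℝ) (z : PrimalSpace Ω q) :
    dualPairing p (t • z) = t * dualPairing p z := by
  simp only [dualPairing_eq_lpPairing, Prod.smul_fst, Prod.smul_snd, map_smul, smul_eq_mul]
  ring

theorem integrable_inner_of_memLp {μ : Measure (Rd d)} {f g : Rd d → Rd d}
    (hf : MemLp f (ENNReal.ofReal q.conjExponent) μ) (hg : MemLp g (ENNReal.ofReal q) μ) :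
    Integrable (fun x => inner ℝ (f x) (g x)) μ := by
  refine Integrable.mono (hf.norm.integrable_mul hg.norm)
    (hf.aestronglyMeasurable.inner hg.aestronglyMeasurable) (.of_forall fun x => ?_)
  simpa using norm_inner_le_norm (𝕜 := ℝ) (f x) (g x)

theorem dualPairing_eq_integral {p : DualSpace Ω q} {a : Rd d → ℝ} {b : Rd d → Rd d}
    (ha : MemLp a (ENNReal.ofReal q.conjExponent) (volume.restrict Ω))
    (h1 : ∀ m : SobolevW1 Ω q, p.1 m = ∫ x in Ω, a x * m.1.1 x)
    (h2 : p.2 =ᵐ[volume.restrict Ω] b) (z : PrimalSpace Ω q) :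
    dualPairing p z = ∫ x in Ω, (a x * z.1.1.1 x + inner ℝ (b x) (z.2 x)) := by
  have hb : MemLp b (ENNReal.ofReal q.conjExponent) (volume.restrict Ω) :=
    (memLp_congr_ae h2).1 (Lp.memLp p.2)
  have hi : Integrable (fun x => a x * z.1.1.1 x) (volume.restrict Ω) :=
    ha.integrable_mul (Lp.memLp z.1.1.1)
  rw [integral_add hi (integrable_inner_of_memLp hb (Lp.memLp z.2)), dualPairing, h1]
  congr 1
  refine integral_congr_ae ?_
  filter_upwards [h2] with x hx
  rw [hx]

/-- Bounded functions `(a, b)` with values in `A_s` give an element of `𝓐_s`, and hence of the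
dual space. -/
theorem exists_mem_calADual [IsFiniteMeasure (volume.restrict Ω)] {s : ℝ} {a : Rd d → ℝ}
    {b : Rd d → Rd d} (ha : MemLp a ∞ (volume.restrict Ω)) (hb : MemLp b ∞ (volume.restrict Ω))
    (hab : ∀ᵐ x ∂(volume.restrict Ω), (a x, b x) ∈ setA d s) :
    ∃ p ∈ calADual Ω q s, (∀ m : SobolevW1 Ω q, p.1 m = ∫ x in Ω, a x * m.1.1 x) ∧
      p.2 =ᵐ[volume.restrict Ω] b := by
  have ha' := ha.mono_exponent (p := ENNReal.ofReal q.conjExponent) le_top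
  have hb' := hb.mono_exponent (p := ENNReal.ofReal q.conjExponent) le_top
  refine ⟨(integralFunctional Ω q (ha'.toLp a), hb'.toLp b), ⟨(ha.toLp a, hb.toLp b), ?_, ?_, ?_⟩,
    fun m => integralFunctional_toLp_apply ha' m, hb'.coeFn_toLp⟩
  · change ∀ᵐ x ∂(volume.restrict Ω), _
    filter_upwards [hab, ha.coeFn_toLp, hb.coeFn_toLp] with x hx h1 h2
    rwa [h1, h2]
  · intro m
    rw [integralFunctional_toLp_apply]
    refine integral_congr_ae ?_
    filter_upwards [ha.coeFn_toLp] with x hx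
    rw [hx]
  · exact hb'.coeFn_toLp.trans hb.coeFn_toLp.symm

theorem exists_mem_calADual_of_mem_calA [IsFiniteMeasure (volume.restrict Ω)] {s : ℝ}
    {c : LpOn Ω ℝ ∞ × LpOn Ω (Rd d) ∞} (hc : c ∈ calA Ω s) :
    ∃ p ∈ calADual Ω q s, ∀ z : PrimalSpace Ω q,
      dualPairing p z = ∫ x in Ω, (c.1 x * z.1.1.1 x + inner ℝ (c.2 x) (z.2 x)) := by
  obtain ⟨p, hp, h1, h2⟩ := exists_mem_calADual (q := q) (Lp.memLp c.1) (Lp.memLp c.2) hc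
  exact ⟨p, hp, dualPairing_eq_integral ((Lp.memLp c.1).mono_exponent le_top) h1 h2⟩

theorem exists_mem_calA_of_mem_calADual [IsFiniteMeasure (volume.restrict Ω)] {s : ℝ}
    {p : DualSpace Ω q} (hp : p ∈ calADual Ω q s) :
    ∃ c ∈ calA Ω s, ∀ z : PrimalSpace Ω q,
      dualPairing p z = ∫ x in Ω, (c.1 x * z.1.1.1 x + inner ℝ (c.2 x) (z.2 x)) := by
  obtain ⟨c, hc, h1, h2⟩ := hp
  exact ⟨c, hc, dualPairing_eq_integral ((Lp.memLp c.1).mono_exponent le_top) h1 h2⟩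

theorem zero_mem_calADual [IsFiniteMeasure (volume.restrict Ω)] {s : ℝ} (hs : 0 < s) :
    (0 : DualSpace Ω q) ∈ calADual Ω q s := by
  obtain ⟨p, hp, h1, h2⟩ := exists_mem_calADual (Ω := Ω) (q := q) (s := s) (a := 0) (b := 0)
    (MemLp.zero) (MemLp.zero) (.of_forall fun x => by simp [setA, Real.zero_rpow hs.ne'])
  have : p = 0 := by
    refine Prod.ext ?_ ?_
    · ext m; rw [h1]; simp
    · exact Lp.ext (h2.trans (Lp.coeFn_zero _ _ _).symm)
  rwa [← this]

theorem ofReal_integral_le_lintegral_ofReal {X : Type*} [MeasurableSpace X] {μ : Measure X}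
    (f : X → ℝ) : ENNReal.ofReal (∫ x, f x ∂μ) ≤ ∫⁻ x, ENNReal.ofReal (f x) ∂μ := by
  by_cases hf : Integrable f μ
  · rw [integral_eq_lintegral_pos_part_sub_lintegral_neg_part hf]
    refine (ENNReal.ofReal_le_ofReal (sub_le_self _ ENNReal.toReal_nonneg)).trans ?_
    exact ENNReal.ofReal_toReal_le
  · simp [integral_undef hf]

theorem ofReal_dualPairing_le_costL [IsFiniteMeasure (volume.restrict Ω)] {r : ℝ} (hr : 1 < r)
    {p : DualSpace Ω q} (hp : p ∈ calADual Ω q r.conjExponent) (z : PrimalSpace Ω q) :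
    ENNReal.ofReal (dualPairing p z) ≤ costL r z := by
  obtain ⟨c, hc, h⟩ := exists_mem_calA_of_mem_calADual hp
  rw [h z]
  refine (ofReal_integral_le_lintegral_ofReal _).trans (lintegral_mono_ae ?_)
  filter_upwards [show ∀ᵐ x ∂(volume.restrict Ω), (c.1 x, c.2 x) ∈ setA d r.conjExponent from hc]
    with x hx using ofReal_pairing_le_ellFun hr hx _ _

/-- The truncated pointwise maximizers, composed with `(m, w)`, belong to `𝓐_{r'}`; by Fatou's
lemma the supremum over `𝓐_{r'}` is the full integral. -/
theorem costL_eq_iSup [IsFiniteMeasure (volume.restrict Ω)] {r : ℝ} (hr : 1 < r)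
    (z : PrimalSpace Ω q) :
    costL r z = ⨆ p ∈ calADual Ω q r.conjExponent, ENNReal.ofReal (dualPairing p z) := by
  refine le_antisymm ?_ (iSup₂_le fun p hp => ofReal_dualPairing_le_costL hr hp z)
  have hm := (Lp.memLp z.1.1.1).aestronglyMeasurable.aemeasurable
  have hw := (Lp.memLp z.2).aestronglyMeasurable.aemeasurable
  have hmw := hm.prodMk hw
  set a : ℕ → Rd d → ℝ := fun n x => maximizerScal r n (z.1.1.1 x) (z.2 x) with ha
  set b : ℕ → Rd d → Rd d := fun n x => maximizerVec r n (z.1.1.1 x) (z.2 x) with hb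
  have ham : ∀ n, AEMeasurable (a n) (volume.restrict Ω) := fun n =>
    (measurable_maximizerScal n).comp_aemeasurable hmw
  have hbm : ∀ n, AEMeasurable (b n) (volume.restrict Ω) := fun n =>
    (measurable_maximizerVec n).comp_aemeasurable hmw
  have hatop : ∀ n, MemLp (a n) ∞ (volume.restrict Ω) := fun n =>
    memLp_top_of_bound (ham n).aestronglyMeasurable _
      (.of_forall fun x => abs_maximizerScal_le hr n _ _)
  have hbtop : ∀ n, MemLp (b n) ∞ (volume.restrict Ω) := fun n =>
    memLp_top_of_bound (hbm n).aestronglyMeasurable _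
      (.of_forall fun x => norm_maximizerVec_le n _ _)
  have hval : ∀ n, ∫⁻ x in Ω, ENNReal.ofReal (a n x * z.1.1.1 x + inner ℝ (b n x) (z.2 x))
      ≤ ⨆ p ∈ calADual Ω q r.conjExponent, ENNReal.ofReal (dualPairing p z) := by
    intro n
    obtain ⟨p, hp, h1, h2⟩ := exists_mem_calADual (q := q) (hatop n) (hbtop n)
      (.of_forall fun x => maximizer_mem_setA hr n _ _)
    have ha' := (hatop n).mono_exponent (p := ENNReal.ofReal q.conjExponent) le_top
    have hb' := (hbtop n).mono_exponent (p := ENNReal.ofReal q.conjExponent) le_top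
    have hint : Integrable (fun x => a n x * z.1.1.1 x + inner ℝ (b n x) (z.2 x))
        (volume.restrict Ω) :=
      (ha'.integrable_mul (Lp.memLp z.1.1.1)).add (integrable_inner_of_memLp hb' (Lp.memLp z.2))
    rw [← ofReal_integral_eq_lintegral_ofReal hint
      (.of_forall fun x => maximizer_value_nonneg hr n _ _), ← dualPairing_eq_integral ha' h1 h2]
    exact le_iSup₂_of_le p hp le_rfl
  have hlim : costL r z = ∫⁻ x in Ω, liminf (fun n =>
      ENNReal.ofReal (a n x * z.1.1.1 x + inner ℝ (b n x) (z.2 x))) atTop :=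
    lintegral_congr fun x => (tendsto_maximizer_value hr _ _).liminf_eq.symm
  rw [hlim]
  refine (lintegral_liminf_le' fun n => ?_).trans ?_
  · exact (((ham n).mul hm).add ((hbm n).inner hw)).ennreal_ofReal
  · exact (liminf_le_liminf (.of_forall hval)).trans (by simp)

/-- Truncating a supremum below at `0` has no effect if one of the terms is non-negative. -/
theorem coe_biSup_ofReal {ι : Type*} {S : Set ι} {x : ι → ℝ} {i₀ : ι} (hi₀ : i₀ ∈ S)
    (hx : 0 ≤ x i₀) :
    ((⨆ i ∈ S, ENNReal.ofReal (x i) : ℝ≥0∞) : EReal) = ⨆ i ∈ S, ((x i : ℝ) : EReal) := by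
  have h0 : (0 : EReal) ≤ ⨆ i ∈ S, ((x i : ℝ) : EReal) :=
    le_iSup₂_of_le i₀ hi₀ (by exact_mod_cast hx)
  refine le_antisymm ?_ (iSup₂_le fun i hi => ?_)
  · rw [← EReal.coe_toENNReal h0, EReal.coe_ennreal_le_coe_ennreal_iff]
    refine iSup₂_le fun i hi => ?_
    have := EReal.toENNReal_le_toENNReal (le_iSup₂_of_le (f := fun i (_ : i ∈ S) =>
      ((x i : ℝ) : EReal)) i hi le_rfl)
    rwa [EReal.toENNReal_of_ne_top (EReal.coe_ne_top _), EReal.toReal_coe] at this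
  · refine le_trans ?_ (EReal.coe_ennreal_le_coe_ennreal_iff.2
      (le_iSup₂_of_le i hi (le_refl (ENNReal.ofReal (x i)))))
    rw [EReal.coe_ennreal_ofReal]
    exact_mod_cast le_max_left _ _

theorem coe_costL_eq_iSup_calADual [IsFiniteMeasure (volume.restrict Ω)] {r : ℝ} (hr : 1 < r)
    (z : PrimalSpace Ω q) :
    ((costL r z : ℝ≥0∞) : EReal)
      = ⨆ p ∈ calADual Ω q r.conjExponent, ((dualPairing p z : ℝ) : EReal) := by
  have hs : 0 < r.conjExponent := (Real.HolderConjugate.conjExponent hr).symm.pos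
  rw [costL_eq_iSup hr]
  refine coe_biSup_ofReal (zero_mem_calADual hs) (le_of_eq ?_)
  simp [dualPairing_eq_lpPairing]

theorem coe_costL_eq_iSup_calA [IsFiniteMeasure (volume.restrict Ω)] {r : ℝ} (hr : 1 < r)
    (z : PrimalSpace Ω q) :
    ((costL r z : ℝ≥0∞) : EReal) = ⨆ c ∈ calA Ω r.conjExponent,
      ((∫ x in Ω, (c.1 x * z.1.1.1 x + inner ℝ (c.2 x) (z.2 x)) : ℝ) : EReal) := by
  rw [coe_costL_eq_iSup_calADual hr]
  refine le_antisymm (iSup₂_le fun p hp => ?_) (iSup₂_le fun c hc => ?_)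
  · obtain ⟨c, hc, h⟩ := exists_mem_calA_of_mem_calADual hp
    rw [h z]
    exact le_iSup₂_of_le c hc le_rfl
  · obtain ⟨p, hp, h⟩ := exists_mem_calADual_of_mem_calA (q := q) hc
    rw [← h z]
    exact le_iSup₂_of_le p hp le_rfl

theorem dualPairing_le_costL_of_mem_closure [IsFiniteMeasure (volume.restrict Ω)] {r : ℝ}
    (hr : 1 < r) {p : DualSpace Ω q} (hp : p ∈ closure (calADual Ω q r.conjExponent))
    (z : PrimalSpace Ω q) : ENNReal.ofReal (dualPairing p z) ≤ costL r z := by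
  have hcl : IsClosed {p : DualSpace Ω q | ENNReal.ofReal (dualPairing p z) ≤ costL r z} :=
    isClosed_le (ENNReal.continuous_ofReal.comp (continuous_dualPairing_left z)) continuous_const
  exact closure_minimal (fun p hp => ofReal_dualPairing_le_costL hr hp z) hcl hp

theorem coe_dualPairing_le_of_ofReal_le {x : ℝ} {y : ℝ≥0∞} (h : ENNReal.ofReal x ≤ y) :
    ((x : ℝ) : EReal) ≤ (y : EReal) := by
  refine le_trans ?_ (EReal.coe_ennreal_le_coe_ennreal_iff.2 h)
  rw [EReal.coe_ennreal_ofReal]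
  exact_mod_cast le_max_left _ _

theorem coe_costL_eq_iSup_closure [IsFiniteMeasure (volume.restrict Ω)] {r : ℝ} (hr : 1 < r)
    (z : PrimalSpace Ω q) :
    ((costL r z : ℝ≥0∞) : EReal)
      = ⨆ p ∈ closure (calADual Ω q r.conjExponent), ((dualPairing p z : ℝ) : EReal) := by
  refine le_antisymm ?_ (iSup₂_le fun p hp =>
    coe_dualPairing_le_of_ofReal_le (dualPairing_le_costL_of_mem_closure hr hp z))
  rw [coe_costL_eq_iSup_calADual hr]
  exact biSup_mono fun p hp => subset_closure hp

theorem lowerSemicontinuous_costL [IsFiniteMeasure (volume.restrict Ω)] {r : ℝ} (hr : 1 < r) :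
    LowerSemicontinuous (fun z : PrimalSpace Ω q => costL r z) := by
  simp_rw [costL_eq_iSup hr]
  exact lowerSemicontinuous_biSup fun p _ =>
    (ENNReal.continuous_ofReal.comp (continuous_dualPairing_right p)).lowerSemicontinuous

theorem costL_smul [IsFiniteMeasure (volume.restrict Ω)] {r : ℝ} (hr : 1 < r) {t : ℝ}
    (ht : 0 ≤ t) (z : PrimalSpace Ω q) : costL r (t • z) = ENNReal.ofReal t * costL r z := by
  simp_rw [costL_eq_iSup hr, dualPairing_smul, ENNReal.ofReal_mul ht, ENNReal.mul_iSup]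

theorem costL_add_le [IsFiniteMeasure (volume.restrict Ω)] {r : ℝ} (hr : 1 < r)
    (z z' : PrimalSpace Ω q) : costL r (z + z') ≤ costL r z + costL r z' := by
  rw [costL_eq_iSup hr (z + z')]
  refine iSup₂_le fun p hp => ?_
  rw [dualPairing_add]
  exact ENNReal.ofReal_add_le.trans
    (add_le_add (ofReal_dualPairing_le_costL hr hp z) (ofReal_dualPairing_le_costL hr hp z'))

set_option synthInstance.maxHeartbeats 200000 in
theorem convexOn_costL [IsFiniteMeasure (volume.restrict Ω)] {r : ℝ} (hr : 1 < r) :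
    ConvexOn ℝ≥0 Set.univ (fun z : PrimalSpace Ω q => costL r z) := by
  refine ⟨convex_univ, fun x _ y _ a b _ _ _ => ?_⟩
  have h : ∀ (a : ℝ≥0) (x : PrimalSpace Ω q), costL r (a • x) = a • costL r x := by
    intro a x
    have := costL_smul hr a.coe_nonneg x
    rw [ENNReal.ofReal_coe_nnreal] at this
    exact this
  simp only
  rw [← h, ← h]
  exact costL_add_le hr _ _

/-- The supremum is attained at `z = 0`. -/
theorem fenchelConj_costL_of_forall_le [IsFiniteMeasure (volume.restrict Ω)] {r : ℝ} (hr : 1 < r)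
    {p : DualSpace Ω q} (hp : ∀ z : PrimalSpace Ω q, ENNReal.ofReal (dualPairing p z) ≤ costL r z) :
    fenchelConj (fun z : PrimalSpace Ω q => costL r z) p = 0 := by
  refine le_antisymm (iSup_le fun z => ?_) ?_
  · have := coe_dualPairing_le_of_ofReal_le (hp z)
    exact EReal.sub_nonpos.2 this
  · refine le_iSup_of_le 0 (le_of_eq ?_)
    have h0 : costL r (0 : PrimalSpace Ω q) = 0 := by
      have := costL_smul (q := q) (Ω := Ω) hr le_rfl 0
      simpa using this
    simp only [h0]
    simp [dualPairing_eq_lpPairing]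

/-- Along the multiples of a `z` at which `p` exceeds the functional, the difference is unbounded by
positive homogeneity. -/
theorem fenchelConj_costL_of_lt [IsFiniteMeasure (volume.restrict Ω)] {r : ℝ} (hr : 1 < r)
    {p : DualSpace Ω q} {z : PrimalSpace Ω q} (hz : costL r z < ENNReal.ofReal (dualPairing p z)) :
    fenchelConj (fun z : PrimalSpace Ω q => costL r z) p = ⊤ := by
  lift costL r z to ℝ≥0 using hz.ne_top with L hL
  have hlt : (L : ℝ) < dualPairing p z := by
    rw [← ENNReal.ofReal_coe_nnreal, ENNReal.ofReal_lt_ofReal_iff_of_nonneg L.coe_nonneg] at hz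
    exact hz
  rw [fenchelConj, EReal.eq_top_iff_forall_lt]
  intro y
  obtain ⟨n, hn⟩ := exists_nat_gt (y / (dualPairing p z - L))
  have hn' : y < n * (dualPairing p z - L) := (div_lt_iff₀ (sub_pos.2 hlt)).1 hn
  refine lt_of_lt_of_le ?_ (le_iSup _ ((n : ℝ) • z))
  rw [costL_smul hr n.cast_nonneg, ← hL, dualPairing_smul, EReal.coe_ennreal_mul,
    EReal.coe_ennreal_ofReal, max_eq_left n.cast_nonneg]
  have : (((L : ℝ≥0) : ℝ≥0∞) : EReal) = ((L : ℝ) : EReal) := rfl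
  rw [this]
  rw [← EReal.coe_mul, ← EReal.coe_sub, EReal.coe_lt_coe_iff]
  linarith

end

/-! ### Functionals on the continuous functions on the closure -/

/-- The extension by zero of a continuous function on `closure Ω`. -/
noncomputable def extendZero {d : ℕ} {Ω : Set (Rd d)} (φ : C(closure Ω, ℝ)) (x : Rd d) : ℝ :=
  open Classical in if h : x ∈ closure Ω then φ ⟨x, h⟩ else 0

section
variable {d : ℕ} {Ω : Set (Rd d)}

theorem extendZero_of_mem (φ : C(closure Ω, ℝ)) {x : Rd d} (hx : x ∈ closure Ω) :
    extendZero φ x = φ ⟨x, hx⟩ := dif_pos hx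

theorem extendZero_coe (φ : C(closure Ω, ℝ)) (x : closure Ω) : extendZero φ x = φ x :=
  extendZero_of_mem φ x.2

theorem extendZero_add (φ ψ : C(closure Ω, ℝ)) (x : Rd d) :
    extendZero (φ + ψ) x = extendZero φ x + extendZero ψ x := by
  unfold extendZero; split_ifs <;> simp

theorem extendZero_smul (c : ℝ) (φ : C(closure Ω, ℝ)) (x : Rd d) :
    extendZero (c • φ) x = c * extendZero φ x := by
  unfold extendZero; split_ifs <;> simp

theorem continuousOn_extendZero (φ : C(closure Ω, ℝ)) :
    ContinuousOn (extendZero φ) (closure Ω) := by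
  rw [continuousOn_iff_continuous_domRestrict]
  exact φ.continuous.congr fun x => (extendZero_coe φ x).symm

theorem extendZero_nonneg {φ : C(closure Ω, ℝ)} (h : ∀ x, 0 ≤ φ x) (x : Rd d) :
    0 ≤ extendZero φ x := by
  unfold extendZero; split_ifs
  · exact h _
  · exact le_rfl

theorem abs_extendZero_le [CompactSpace (closure Ω)] (φ : C(closure Ω, ℝ)) (x : Rd d) :
    |extendZero φ x| ≤ ‖φ‖ := by
  unfold extendZero; split_ifs
  · exact φ.norm_coe_le_norm _
  · simp

theorem aestronglyMeasurable_of_continuousOn_closure (hΩ : IsOpen Ω) {f : Rd d → ℝ}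
    (hf : ContinuousOn f (closure Ω)) : AEStronglyMeasurable f (volume.restrict Ω) :=
  (hf.mono subset_closure).aestronglyMeasurable hΩ.measurableSet

/-- The functional `φ ↦ ∫_Ω φ h dx` on `C(closure Ω)` for an integrable weight `h`. -/
noncomputable def weightFunctional [CompactSpace (closure Ω)] (hΩ : IsOpen Ω) {h : Rd d → ℝ}
    (hh : Integrable h (volume.restrict Ω)) : C(closure Ω, ℝ) →ₗ[ℝ] ℝ where
  toFun φ := ∫ x in Ω, extendZero φ x * h x
  map_add' φ ψ := by
    have hi : ∀ φ : C(closure Ω, ℝ), Integrable (fun x => extendZero φ x * h x)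
        (volume.restrict Ω) := fun φ => hh.bdd_mul
      (aestronglyMeasurable_of_continuousOn_closure hΩ (continuousOn_extendZero φ))
      (.of_forall fun x => abs_extendZero_le φ x)
    rw [← integral_add (hi φ) (hi ψ)]
    simp_rw [extendZero_add, add_mul]
  map_smul' c φ := by
    simp_rw [extendZero_smul, mul_assoc]
    rw [integral_const_mul]
    rfl

theorem weightFunctional_apply [CompactSpace (closure Ω)] (hΩ : IsOpen Ω) {h : Rd d → ℝ}
    (hh : Integrable h (volume.restrict Ω)) (φ : C(closure Ω, ℝ)) :
    weightFunctional hΩ hh φ = ∫ x in Ω, extendZero φ x * h x := rfl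

instance isFiniteMeasure_variation_signedMeasure {X : Type*} [MeasurableSpace X]
    (α : SignedMeasure X) : IsFiniteMeasure α.variation := by
  rw [← α.totalVariation_eq_variation, SignedMeasure.totalVariation]
  infer_instance

theorem integrable_signedMeasure [CompactSpace (closure Ω)] (α : SignedMeasure (closure Ω))
    (φ : C(closure Ω, ℝ)) : α.Integrable φ :=
  φ.continuous.integrable_of_hasCompactSupport (HasCompactSupport.of_compactSpace φ)

/-- The functional `φ ↦ ∫ φ dα` on `C(closure Ω)` for a signed measure `α`. -/
noncomputable def signedFunctional [CompactSpace (closure Ω)] (α : SignedMeasure (closure Ω)) :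
    C(closure Ω, ℝ) →ₗ[ℝ] ℝ where
  toFun φ := ∫ᵛ x : closure Ω, φ x ∂<•α
  map_add' φ ψ :=
    VectorMeasure.integral_add (integrable_signedMeasure α φ) (integrable_signedMeasure α ψ)
  map_smul' c φ := VectorMeasure.integral_smul φ α _ c

theorem signedFunctional_apply [CompactSpace (closure Ω)] (α : SignedMeasure (closure Ω))
    (φ : C(closure Ω, ℝ)) : signedFunctional α φ = ∫ᵛ x : closure Ω, φ x ∂<•α := rfl

/-- A functional which is non-positive on non-negative functions is bounded by its value at `1`. -/
theorem abs_le_of_nonpos_on_nonneg {X : Type*} [TopologicalSpace X] [CompactSpace X]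
    (T : C(X, ℝ) →ₗ[ℝ] ℝ) (hT : ∀ φ, (∀ x, 0 ≤ φ x) → T φ ≤ 0) {φ : C(X, ℝ)} {M : ℝ}
    (hφ : ∀ x, |φ x| ≤ M) : |T φ| ≤ -T 1 * M := by
  have h1 := hT (M • 1 + φ) fun x => by
    have := (abs_le.1 (hφ x)).1
    simp; linarith
  have h2 := hT (M • 1 - φ) fun x => by
    have := (abs_le.1 (hφ x)).2
    simp; linarith
  rw [map_add, map_smul, smul_eq_mul] at h1
  rw [map_sub, map_smul, smul_eq_mul] at h2
  rw [abs_le]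
  constructor <;> linarith

section eval
variable {q : ℝ} [Fact (1 < q)]

/-- The embedding of `W^{1,q}(Ω)` into `C(closure Ω)` attached to a continuous family of
evaluations. -/
noncomputable def evalMap (F : Rd d → (SobolevW1 Ω q →L[ℝ] ℝ)) (hF : ContinuousOn F (closure Ω)) :
    SobolevW1 Ω q →ₗ[ℝ] C(closure Ω, ℝ) where
  toFun m := ⟨fun x => F x m, (continuous_eval_const m).comp
    (continuousOn_iff_continuous_domRestrict.1 hF)⟩
  map_add' m m' := by ext x; simp
  map_smul' c m := by ext x; simp

theorem extendZero_evalMap (F : Rd d → (SobolevW1 Ω q →L[ℝ] ℝ)) (hF : ContinuousOn F (closure Ω))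
    (m : SobolevW1 Ω q) {x : Rd d} (hx : x ∈ closure Ω) :
    extendZero (evalMap F hF m) x = F x m := extendZero_of_mem _ hx

variable {F : Rd d → (SobolevW1 Ω q →L[ℝ] ℝ)}

theorem isContRep_eval (hF : ContinuousOn F (closure Ω))
    (hFm : ∀ m : SobolevW1 Ω q, m.1.1 =ᵐ[volume.restrict Ω] fun x => F x m) (m : SobolevW1 Ω q) :
    IsContRep m fun x => F x m :=
  ⟨(continuous_eval_const m).comp_continuousOn hF, hFm m⟩

theorem IsContRep.eq_eval (hΩ : IsOpen Ω) (hF : ContinuousOn F (closure Ω))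
    (hFm : ∀ m : SobolevW1 Ω q, m.1.1 =ᵐ[volume.restrict Ω] fun x => F x m) {m : SobolevW1 Ω q}
    {f : Rd d → ℝ} (hf : IsContRep m f) {x : Rd d} (hx : x ∈ closure Ω) : f x = F x m := by
  refine eq_of_ae_eq_of_continuousOn hΩ isOpen_univ (by simpa using hf.1)
    (by simpa using (isContRep_eval hF hFm m).1) ?_ ⟨mem_univ x, hx⟩
  filter_upwards [hf.2, hFm m] with y h1 h2 _
  rw [← h1, h2]

theorem IsContRep.signedIntegral_eq [CompactSpace (closure Ω)] (hΩ : IsOpen Ω)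
    (hF : ContinuousOn F (closure Ω))
    (hFm : ∀ m : SobolevW1 Ω q, m.1.1 =ᵐ[volume.restrict Ω] fun x => F x m) {m : SobolevW1 Ω q}
    {f : Rd d → ℝ} (hf : IsContRep m f) (α : SignedMeasure (closure Ω)) :
    ∫ᵛ x : closure Ω, f x ∂<•α = signedFunctional α (evalMap F hF m) := by
  rw [signedFunctional_apply]
  congr 1
  ext x
  exact hf.eq_eval hΩ hF hFm x.2

theorem weightFunctional_evalMap [CompactSpace (closure Ω)] (hΩ : IsOpen Ω)
    (hF : ContinuousOn F (closure Ω))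
    (hFm : ∀ m : SobolevW1 Ω q, m.1.1 =ᵐ[volume.restrict Ω] fun x => F x m) {h : Rd d → ℝ}
    (hh : Integrable h (volume.restrict Ω)) (m : SobolevW1 Ω q) :
    weightFunctional hΩ hh (evalMap F hF m) = ∫ x in Ω, m.1.1 x * h x := by
  rw [weightFunctional_apply]
  refine integral_congr_ae ?_
  filter_upwards [hFm m, ae_restrict_mem hΩ.measurableSet] with x hx hxΩ
  rw [hx, extendZero_evalMap F hF m (subset_closure hxΩ)]

/-- The constant function `1` belongs to `W^{1,q}(Ω)`. -/
theorem exists_sobolev_one [IsFiniteMeasure (volume.restrict Ω)] :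
    ∃ m : SobolevW1 Ω q, m.1.1 =ᵐ[volume.restrict Ω] fun _ => 1 := by
  have h1 : MemLp (fun _ : Rd d => (1 : ℝ)) (ENNReal.ofReal q) (volume.restrict Ω) :=
    memLp_const 1
  refine ⟨⟨(h1.toLp _, 0), ?_⟩, h1.coeFn_toLp⟩
  intro φ hφ hc hs i
  have e1 : ∫ x in Ω, (h1.toLp _ : LpOn Ω ℝ (ENNReal.ofReal q)) x *
      fderiv ℝ φ x (EuclideanSpace.single i 1)
      = ∫ x in Ω, fderiv ℝ φ x (EuclideanSpace.single i 1) := by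
    refine integral_congr_ae ?_
    filter_upwards [h1.coeFn_toLp] with x hx
    rw [hx, one_mul]
  have e2 : ∫ x in Ω, (0 : LpOn Ω (Rd d) (ENNReal.ofReal q)) x i * φ x = 0 := by
    refine integral_eq_zero_of_ae ?_
    filter_upwards [Lp.coeFn_zero (Rd d) (ENNReal.ofReal q) (volume.restrict Ω)] with x hx
    rw [hx]; simp
  have e3 : ∫ x in Ω, fderiv ℝ φ x (EuclideanSpace.single i 1)
      = ∫ x, fderiv ℝ φ x (EuclideanSpace.single i 1) := by
    refine setIntegral_eq_integral_of_forall_compl_eq_zero fun x hx => ?_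
    have : fderiv ℝ φ x = 0 := by
      by_contra h
      exact hx (hs (support_fderiv_subset ℝ h))
    rw [this]; rfl
  have hD := continuous_partial hφ (EuclideanSpace.single i (1 : ℝ))
  have hDc := hasCompactSupport_partial hc (EuclideanSpace.single i (1 : ℝ))
  have hDi := hD.integrable_of_hasCompactSupport (μ := volume) hDc
  have e4 := integral_mul_fderiv_eq_neg_fderiv_mul_of_integrable (μ := (volume : Measure (Rd d)))
    (f := fun _ : Rd d => (1 : ℝ)) (g := φ) (v := EuclideanSpace.single i (1 : ℝ))
    (by simp) (by simpa using hDi)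
    (by simpa using hφ.continuous.integrable_of_hasCompactSupport (μ := volume) hc)
    (by fun_prop) (fun x _ => hφ.differentiable (by simp) x)
  simp only [one_mul, fderiv_fun_const, Pi.zero_apply, zero_apply, zero_mul, integral_zero,
    neg_zero] at e4
  exact e1.trans ((e3.trans e4).trans (by rw [e2, neg_zero]))

end eval
end

/-! ### Measure pairs belong to the closure -/

section
variable {d : ℕ} {Ω : Set (Rd d)}

/-- A compact closure carries partitions of unity with arbitrarily small supports. -/
theorem exists_partition [CompactSpace (closure Ω)] {δ : ℝ} (hδ : 0 < δ) :
    ∃ (t : Finset (closure Ω)) (ψ : closure Ω → C(closure Ω, ℝ)), (∀ i x, 0 ≤ ψ i x) ∧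
      (∀ x, ∑ i ∈ t, ψ i x = 1) ∧ ∀ i x, ψ i x ≠ 0 → dist x i < δ := by
  obtain ⟨t, -, ht⟩ := isCompact_univ.elim_nhds_subcover (fun x : closure Ω => ball x δ)
    (fun x _ => ball_mem_nhds x hδ)
  have hpos : ∀ x : closure Ω, 0 < ∑ i ∈ t, max 0 (δ - dist x i) := by
    intro x
    obtain ⟨i, hi, hxi⟩ := mem_iUnion₂.1 (ht (mem_univ x))
    refine Finset.sum_pos' (fun i _ => le_max_left _ _) ⟨i, hi, lt_max_of_lt_right ?_⟩
    exact sub_pos.2 hxi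
  refine ⟨t, fun i => ⟨fun x => max 0 (δ - dist x i) / ∑ j ∈ t, max 0 (δ - dist x j), ?_⟩,
    fun i x => div_nonneg (le_max_left _ _) (hpos x).le, fun x => ?_, fun i x hx => ?_⟩
  · exact Continuous.div (by fun_prop) (by fun_prop) fun x => (hpos x).ne'
  · simp only [ContinuousMap.coe_mk]
    rw [← Finset.sum_div, div_self (hpos x).ne']
  · by_contra h
    apply hx
    simp only [ContinuousMap.coe_mk]
    rw [max_eq_left (by linarith), zero_div]

theorem integrable_norm_rpow_of_Lp {s : ℝ} (hs : 0 < s) (β : LpOn Ω (Rd d) (ENNReal.ofReal s)) :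
    Integrable (fun x => ‖β x‖ ^ s) (volume.restrict Ω) := by
  have := (Lp.memLp β).integrable_norm_rpow (by simpa using hs) ENNReal.ofReal_ne_top
  rwa [ENNReal.toReal_ofReal hs.le] at this

/-- The difference `α + (1/s) |β|^s` as a functional on `C(closure Ω)`. -/
noncomputable def gapFunctional [CompactSpace (closure Ω)] (hΩ : IsOpen Ω) {s : ℝ} (hs : 0 < s)
    (c : SignedMeasure (closure Ω) × LpOn Ω (Rd d) (ENNReal.ofReal s)) : C(closure Ω, ℝ) →ₗ[ℝ] ℝ :=
  signedFunctional c.1 + (1 / s) • weightFunctional hΩ (integrable_norm_rpow_of_Lp hs c.2)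

theorem signedFunctional_eq_gapFunctional_sub [CompactSpace (closure Ω)] (hΩ : IsOpen Ω) {s : ℝ}
    (hs : 0 < s) (c : SignedMeasure (closure Ω) × LpOn Ω (Rd d) (ENNReal.ofReal s))
    (φ : C(closure Ω, ℝ)) :
    signedFunctional c.1 φ = gapFunctional hΩ hs c φ
      - 1 / s * weightFunctional hΩ (integrable_norm_rpow_of_Lp hs c.2) φ := by
  rw [gapFunctional, LinearMap.add_apply, LinearMap.smul_apply, smul_eq_mul, add_sub_cancel_right]

theorem gapFunctional_nonpos [CompactSpace (closure Ω)] (hΩ : IsOpen Ω) {s : ℝ} (hs : 0 < s)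
    {c : SignedMeasure (closure Ω) × LpOn Ω (Rd d) (ENNReal.ofReal s)} (hc : c ∈ measA Ω s)
    (φ : C(closure Ω, ℝ)) (hφ : ∀ x, 0 ≤ φ x) : gapFunctional hΩ hs c φ ≤ 0 := by
  have := hc (extendZero φ) (continuousOn_extendZero φ) fun x _ => extendZero_nonneg hφ x
  simp_rw [extendZero_coe] at this
  exact this

theorem conjExponent_le_conjExponent {q r : ℝ} (hr : 1 < r) (hrq : r ≤ q) :
    q.conjExponent ≤ r.conjExponent := by
  rw [Real.conjExponent, Real.conjExponent, div_le_div_iff₀ (by linarith) (by linarith)]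
  linarith

theorem eventually_eLpNorm_tail_le {p : ℝ≥0∞} {β : Rd d → Rd d}
    (hβ : MemLp β p (volume.restrict Ω)) (hm : StronglyMeasurable β) {ε : ℝ} (hε : 0 < ε) :
    ∀ᶠ n : ℕ in atTop, eLpNorm ({x | (n : ℝ) ≤ ‖β x‖}.indicator β) p (volume.restrict Ω)
      ≤ ENNReal.ofReal ε := by
  obtain ⟨M, hM⟩ := hβ.eLpNorm_indicator_norm_ge_le hm hε
  obtain ⟨N, hN⟩ := exists_nat_ge M
  filter_upwards [eventually_ge_atTop N] with n hn
  refine (eLpNorm_mono fun x => ?_).trans hM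
  refine norm_indicator_le_of_subset (fun x hx => ?_) β x
  have h1 : (n : ℝ) ≤ ‖β x‖ := hx
  have h2 : (N : ℝ) ≤ n := by exact_mod_cast hn
  change M ≤ ‖β x‖
  linarith

theorem tendsto_integral_tail {β : Rd d → Rd d} (hm : StronglyMeasurable β) {h : Rd d → ℝ}
    (hh : Integrable h (volume.restrict Ω)) :
    Tendsto (fun n : ℕ => ∫ x in Ω, ‖{x | (n : ℝ) ≤ ‖β x‖}.indicator h x‖) atTop (𝓝 0) := by
  have hms : ∀ n : ℕ, MeasurableSet {x | (n : ℝ) ≤ ‖β x‖} := fun n =>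
    measurableSet_le measurable_const hm.measurable.norm
  have := tendsto_integral_of_dominated_convergence (μ := volume.restrict Ω) (f := fun _ => 0)
    (F := fun (n : ℕ) x => ‖{x | (n : ℝ) ≤ ‖β x‖}.indicator h x‖) (fun x => ‖h x‖)
    (fun n => (hh.indicator (hms n)).norm.aestronglyMeasurable) hh.norm
    (fun n => .of_forall fun x => by rw [norm_norm]; exact norm_indicator_le_norm_self _ _)
    (.of_forall fun x => by
      obtain ⟨N, hN⟩ := exists_nat_gt ‖β x‖
      refine tendsto_const_nhds.congr' ?_
      filter_upwards [eventually_ge_atTop N] with n hn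
      have h2 : (N : ℝ) ≤ n := by exact_mod_cast hn
      have : x ∉ {x | (n : ℝ) ≤ ‖β x‖} := fun h => by
        have h3 : (n : ℝ) ≤ ‖β x‖ := h
        linarith
      rw [indicator_of_notMem this, norm_zero])
  simpa using this

variable {q : ℝ} [Fact (1 < q)] {F : Rd d → (SobolevW1 Ω q →L[ℝ] ℝ)}

/-- On small balls the mean of `m` is uniformly close to the values of `m`. -/
theorem abs_eval_sub_average_le [IsFiniteMeasure (volume.restrict Ω)]
    (hΩ : IsOpen Ω)
    (hFm : ∀ m : SobolevW1 Ω q, m.1.1 =ᵐ[volume.restrict Ω] fun x => F x m) {ε δ : ℝ} (hδ : 0 < δ)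
    (hFδ : ∀ x ∈ closure Ω, ∀ y ∈ closure Ω, dist x y < 2 * δ → ‖F x - F y‖ ≤ ε)
    (m : SobolevW1 Ω q) {i x : Rd d} (hi : i ∈ closure Ω) (hx : x ∈ closure Ω)
    (hxi : dist x i < δ) :
    |F x m - ⨍ y in ball i δ, m.1.1 y ∂(volume.restrict Ω)| ≤ ε * ‖m‖ := by
  have hmem := (convex_closedBall (F x m) (ε * ‖m‖)).set_average_mem isClosed_closedBall
    (μ := volume.restrict Ω) (t := ball i δ) (f := m.1.1) ?_ (measure_ne_top _ _) ?_
    (integrable_of_memLp_sobolev m.1.1).integrableOn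
  · rwa [mem_closedBall, dist_comm, Real.dist_eq] at hmem
  · rw [Measure.restrict_apply measurableSet_ball]
    obtain ⟨y, hy⟩ := mem_closure_iff.1 hi _ isOpen_ball (mem_ball_self hδ)
    exact ((isOpen_ball.inter hΩ).measure_pos _ ⟨y, hy⟩).ne'
  · filter_upwards [ae_restrict_of_ae (hFm m), ae_restrict_mem measurableSet_ball,
      ae_restrict_of_ae (ae_restrict_mem hΩ.measurableSet)] with y hy hyb hyΩ
    rw [hy, mem_closedBall, Real.dist_eq, abs_sub_comm]
    have hop := (F x - F y).le_opNorm m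
    rw [sub_apply, Real.norm_eq_abs] at hop
    refine hop.trans ?_
    refine mul_le_mul_of_nonneg_right (hFδ x hx y (subset_closure hyΩ) ?_) (norm_nonneg _)
    have : dist y i < δ := hyb
    linarith [dist_triangle_right x y i]

end

section
variable {d : ℕ} {Ω : Set (Rd d)} {q : ℝ} [Fact (1 < q)] {F : Rd d → (SobolevW1 Ω q →L[ℝ] ℝ)}

theorem exists_eval_bound [CompactSpace (closure Ω)] (hF : ContinuousOn F (closure Ω)) :
    ∃ B, 0 ≤ B ∧ ∀ x ∈ closure Ω, ‖F x‖ ≤ B := by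
  obtain ⟨B, hB⟩ := (isCompact_iff_compactSpace.2 ‹_›).exists_bound_of_continuousOn
    (E := SobolevW1 Ω q →L[ℝ] ℝ) (f := F) hF
  exact ⟨max B 0, le_max_right _ _, fun x hx => (hB x hx).trans (le_max_left _ _)⟩

theorem abs_eval_le {B : ℝ} (hB : ∀ x ∈ closure Ω, ‖F x‖ ≤ B) (m : SobolevW1 Ω q) {x : Rd d}
    (hx : x ∈ closure Ω) : |F x m| ≤ B * ‖m‖ :=
  ((F x).le_opNorm m).trans (mul_le_mul_of_nonneg_right (hB x hx) (norm_nonneg _))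

theorem abs_weightFunctional_le [CompactSpace (closure Ω)] (hΩ : IsOpen Ω) {h : Rd d → ℝ}
    (hh : Integrable h (volume.restrict Ω)) {φ : C(closure Ω, ℝ)} {M : ℝ} (hφ : ∀ x, |φ x| ≤ M) :
    |weightFunctional hΩ hh φ| ≤ (∫ x in Ω, ‖h x‖) * M := by
  rw [weightFunctional_apply, mul_comm, ← integral_const_mul, ← Real.norm_eq_abs]
  refine norm_integral_le_of_norm_le (hh.norm.const_mul _) ?_
  filter_upwards [ae_restrict_mem hΩ.measurableSet] with x hxΩ
  rw [norm_mul, extendZero_of_mem _ (subset_closure hxΩ)]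
  exact mul_le_mul_of_nonneg_right (hφ _) (norm_nonneg _)

theorem abs_signedFunctional_le [CompactSpace (closure Ω)] (hΩ : IsOpen Ω) {s : ℝ} (hs : 0 < s)
    {c : SignedMeasure (closure Ω) × LpOn Ω (Rd d) (ENNReal.ofReal s)} (hc : c ∈ measA Ω s)
    {φ : C(closure Ω, ℝ)} {M : ℝ} (hφ : ∀ x, |φ x| ≤ M) :
    |signedFunctional c.1 φ|
      ≤ (-gapFunctional hΩ hs c 1 + 1 / s * ∫ x in Ω, ‖‖c.2 x‖ ^ s‖) * M := by
  have h1 := abs_le_of_nonpos_on_nonneg _ (gapFunctional_nonpos hΩ hs hc) hφ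
  have h2 := abs_weightFunctional_le hΩ (integrable_norm_rpow_of_Lp hs c.2) hφ
  rw [signedFunctional_eq_gapFunctional_sub hΩ hs]
  refine (abs_sub _ _).trans ?_
  rw [abs_mul, abs_of_pos (by positivity : 0 < 1 / s)]
  have h4 := mul_le_mul_of_nonneg_left h2 (by positivity : 0 ≤ 1 / s)
  linarith

/-- The first component is bounded on `W^{1,q}(Ω)` because the evaluations are uniformly bounded on
`closure Ω`. -/
theorem exists_isMeasPair [IsFiniteMeasure (volume.restrict Ω)] [CompactSpace (closure Ω)]
    (hΩ : IsOpen Ω) (hF : ContinuousOn F (closure Ω))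
    (hFm : ∀ m : SobolevW1 Ω q, m.1.1 =ᵐ[volume.restrict Ω] fun x => F x m) {s : ℝ} (hs : 0 < s)
    (hqs : q.conjExponent ≤ s)
    {c : SignedMeasure (closure Ω) × LpOn Ω (Rd d) (ENNReal.ofReal s)} (hc : c ∈ measA Ω s) :
    ∃ p : DualSpace Ω q, IsMeasPair p c := by
  obtain ⟨B, hB0, hB⟩ := exists_eval_bound hF
  have hβ : MemLp c.2 (ENNReal.ofReal q.conjExponent) (volume.restrict Ω) :=
    (Lp.memLp c.2).mono_exponent (ENNReal.ofReal_le_ofReal hqs)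
  have hbound : ∀ m : SobolevW1 Ω q, ‖(signedFunctional c.1 ∘ₗ evalMap F hF) m‖
      ≤ (-gapFunctional hΩ hs c 1 + 1 / s * ∫ x in Ω, ‖‖c.2 x‖ ^ s‖) * B * ‖m‖ := by
    intro m
    rw [mul_assoc]
    exact abs_signedFunctional_le hΩ hs hc fun x => abs_eval_le hB m x.2
  exact ⟨((signedFunctional c.1 ∘ₗ evalMap F hF).mkContinuous _ hbound, hβ.toLp _),
    fun m => ⟨fun x => F x m, isContRep_eval hF hFm m, rfl⟩, hβ.coeFn_toLp⟩

/-- Equicontinuity of the unit ball of `W^{1,q}(Ω)` on `closure Ω`. -/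
theorem exists_eval_modulus [CompactSpace (closure Ω)] (hF : ContinuousOn F (closure Ω)) {ε : ℝ}
    (hε : 0 < ε) : ∃ δ > 0, ∀ x ∈ closure Ω, ∀ y ∈ closure Ω, dist x y < 2 * δ →
      ‖F x - F y‖ ≤ ε := by
  have hu := (isCompact_iff_compactSpace.2 ‹_›).uniformContinuousOn_of_continuous
    (β := SobolevW1 Ω q →L[ℝ] ℝ) (f := F) hF
  obtain ⟨δ, hδ, h⟩ := (Metric.uniformContinuousOn_iff
    (β := SobolevW1 Ω q →L[ℝ] ℝ) (f := F)).1 hu ε hε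
  refine ⟨δ / 2, half_pos hδ, fun x hx y hy hxy => ?_⟩
  have := h x hx y hy (by linarith)
  exact (dist_eq_norm (F x) (F y)).symm.le.trans this.le

/-- The bounded function `∑ i, τ i 1_{B(i, δ)} / |B(i, δ) ∩ Ω|`, which represents the functional
`m ↦ ∑ i, τ i ⨍_{B(i, δ) ∩ Ω} m`. -/
noncomputable def averagingDensity {d : ℕ} {Ω : Set (Rd d)} (t : Finset (closure Ω))
    (τ : closure Ω → ℝ) (δ : ℝ) (x : Rd d) : ℝ :=
  ∑ i ∈ t, τ i * ((volume.restrict Ω).real (ball i δ))⁻¹ *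
    (ball (i : Rd d) δ).indicator (fun _ => 1) x

theorem averagingDensity_nonpos {t : Finset (closure Ω)} {τ : closure Ω → ℝ} (hτ : ∀ i, τ i ≤ 0)
    (δ : ℝ) (x : Rd d) : averagingDensity t τ δ x ≤ 0 := by
  refine Finset.sum_nonpos fun i _ => ?_
  exact mul_nonpos_of_nonpos_of_nonneg
    (mul_nonpos_of_nonpos_of_nonneg (hτ i) (by positivity))
    (indicator_nonneg (fun _ _ => zero_le_one) x)

theorem memLp_top_averagingDensity (t : Finset (closure Ω)) (τ : closure Ω → ℝ) (δ : ℝ) :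
    MemLp (averagingDensity t τ δ) ∞ (volume.restrict Ω) :=
  memLp_finsetSum t fun _ _ =>
    ((memLp_top_const (1 : ℝ)).indicator measurableSet_ball).const_mul _

theorem integral_averagingDensity_mul [IsFiniteMeasure (volume.restrict Ω)]
    (t : Finset (closure Ω)) (τ : closure Ω → ℝ) (δ : ℝ) (m : SobolevW1 Ω q) :
    ∫ x in Ω, averagingDensity t τ δ x * m.1.1 x
      = ∑ i ∈ t, τ i * ⨍ y in ball (i : Rd d) δ, m.1.1 y ∂(volume.restrict Ω) := by
  have hm := integrable_of_memLp_sobolev m.1.1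
  have hterm : ∀ (i : closure Ω) x, τ i * ((volume.restrict Ω).real (ball i δ))⁻¹ *
      (ball (i : Rd d) δ).indicator (fun _ => 1) x * m.1.1 x
      = τ i * ((volume.restrict Ω).real (ball i δ))⁻¹ *
        (ball (i : Rd d) δ).indicator (fun x => m.1.1 x) x := by
    intro i x
    by_cases hx : x ∈ ball (i : Rd d) δ <;> simp [hx]
  simp_rw [averagingDensity, Finset.sum_mul, hterm]
  rw [integral_finsetSum _ fun i _ => (hm.indicator measurableSet_ball).const_mul _]
  refine Finset.sum_congr rfl fun i _ => ?_
  rw [integral_const_mul, integral_indicator measurableSet_ball, setAverage_eq, smul_eq_mul,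
    mul_assoc]

/-- Along a partition of unity `ψ`, `T φ` is close to `∑ i, T (ψ i) A i` for any numbers `A i` close
to the values of `φ` on the support of `ψ i`. -/
theorem abs_apply_sub_sum_le {X : Type*} [TopologicalSpace X] [CompactSpace X]
    {T : C(X, ℝ) →ₗ[ℝ] ℝ} (hT : ∀ φ, (∀ x, 0 ≤ φ x) → T φ ≤ 0)
    {t : Finset X} {ψ : X → C(X, ℝ)} (hψ0 : ∀ i x, 0 ≤ ψ i x)
    (hψ1 : ∀ x, ∑ i ∈ t, ψ i x = 1) {φ : C(X, ℝ)} {A : X → ℝ} {M : ℝ}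
    (hA : ∀ i x, ψ i x ≠ 0 → |φ x - A i| ≤ M) :
    |T φ - ∑ i ∈ t, T (ψ i) * A i| ≤ -T 1 * M := by
  have h1 : T φ - ∑ i ∈ t, T (ψ i) * A i = T (φ - ∑ i ∈ t, A i • ψ i) := by
    rw [map_sub, map_sum]
    congr 1
    refine Finset.sum_congr rfl fun i _ => ?_
    rw [map_smul, smul_eq_mul, mul_comm]
  rw [h1]
  refine abs_le_of_nonpos_on_nonneg T hT fun x => ?_
  have h2 : (φ - ∑ i ∈ t, A i • ψ i) x = ∑ i ∈ t, ψ i x * (φ x - A i) := by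
    rw [ContinuousMap.sub_apply, ContinuousMap.sum_apply]
    simp_rw [mul_sub]
    rw [Finset.sum_sub_distrib, ← Finset.sum_mul, hψ1, one_mul]
    congr 1
    refine Finset.sum_congr rfl fun i _ => ?_
    rw [ContinuousMap.smul_apply, smul_eq_mul, mul_comm]
  rw [h2]
  refine (Finset.abs_sum_le_sum_abs _ _).trans ?_
  calc ∑ i ∈ t, |ψ i x * (φ x - A i)| ≤ ∑ i ∈ t, ψ i x * M := by
        refine Finset.sum_le_sum fun i _ => ?_
        rw [abs_mul, abs_of_nonneg (hψ0 i x)]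
        by_cases hi : ψ i x = 0
        · rw [hi, zero_mul, zero_mul]
        · exact mul_le_mul_of_nonneg_left (hA i x hi) (hψ0 i x)
    _ = M := by rw [← Finset.sum_mul, hψ1, one_mul]

end

section
variable {d : ℕ} {Ω : Set (Rd d)} {q : ℝ} [Fact (1 < q)] {F : Rd d → (SobolevW1 Ω q →L[ℝ] ℝ)}

theorem rpow_norm_indicator_compl {s : ℝ} (hs : 0 < s) (β : Rd d → Rd d) (A : Set (Rd d))
    (x : Rd d) :
    ‖Aᶜ.indicator β x‖ ^ s = ‖β x‖ ^ s - A.indicator (fun x => ‖β x‖ ^ s) x := by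
  by_cases hx : x ∈ A
  · rw [indicator_of_notMem (notMem_compl_iff.2 hx), indicator_of_mem hx, norm_zero,
      Real.zero_rpow hs.ne', sub_self]
  · rw [indicator_of_mem (mem_compl hx), indicator_of_notMem hx, sub_zero]

theorem norm_indicator_compl_le (β : Rd d → Rd d) (n : ℕ) (x : Rd d) :
    ‖{x | (n : ℝ) ≤ ‖β x‖}ᶜ.indicator β x‖ ≤ n := by
  by_cases hx : x ∈ {x | (n : ℝ) ≤ ‖β x‖}
  · rw [indicator_of_notMem (notMem_compl_iff.2 hx), norm_zero]; exact n.cast_nonneg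
  · rw [indicator_of_mem (mem_compl hx)]
    exact (not_le.1 hx).le

theorem memLp_top_rpow_norm {μ : Measure (Rd d)} {s : ℝ} (hs : 0 < s) {b : Rd d → Rd d}
    (hb : StronglyMeasurable b) {n : ℝ} (hn : ∀ x, ‖b x‖ ≤ n) :
    MemLp (fun x => ‖b x‖ ^ s) ∞ μ := by
  refine memLp_top_of_bound (hb.norm.measurable.pow_const s).aestronglyMeasurable (n ^ s)
    (.of_forall fun x => ?_)
  rw [Real.norm_eq_abs, abs_of_nonneg (Real.rpow_nonneg (norm_nonneg _) s)]
  exact Real.rpow_le_rpow (norm_nonneg _) (hn x) hs.le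

theorem dist_le_of_forall_abs_sub_le {E : Type*} [SeminormedAddCommGroup E] [NormedSpace ℝ E]
    {L L' : E →L[ℝ] ℝ} {C : ℝ} (hC : 0 ≤ C) (h : ∀ m, |L m - L' m| ≤ C * ‖m‖) : dist L L' ≤ C :=
  (dist_eq_norm _ _).le.trans (ContinuousLinearMap.opNorm_le_bound _ hC h)

theorem weightFunctional_const_mul_sub_add [CompactSpace (closure Ω)] (hΩ : IsOpen Ω)
    {h g D a : Rd d → ℝ} (hh : Integrable h (volume.restrict Ω))
    (hg : Integrable g (volume.restrict Ω)) (hD : Integrable D (volume.restrict Ω))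
    (ha : Integrable a (volume.restrict Ω)) {κ : ℝ} (had : ∀ x, a x = κ * (h x - g x) + D x)
    (φ : C(closure Ω, ℝ)) :
    weightFunctional hΩ ha φ = κ * (weightFunctional hΩ hh φ - weightFunctional hΩ hg φ)
      + weightFunctional hΩ hD φ := by
  have hi : ∀ {f : Rd d → ℝ}, Integrable f (volume.restrict Ω) →
      Integrable (fun x => extendZero φ x * f x) (volume.restrict Ω) := fun hf => hf.bdd_mul
    (aestronglyMeasurable_of_continuousOn_closure hΩ (continuousOn_extendZero φ))
    (.of_forall fun x => abs_extendZero_le φ x)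
  have hsub : Integrable (fun x => κ * (extendZero φ x * h x - extendZero φ x * g x))
      (volume.restrict Ω) := ((hi hh).sub (hi hg)).const_mul κ
  simp_rw [weightFunctional_apply]
  rw [← integral_sub (hi hh) (hi hg), ← integral_const_mul, ← integral_add hsub (hi hD)]
  refine integral_congr_ae (.of_forall fun x => ?_)
  simp only [had]
  ring

/-- Truncating `β` keeps the constraint `a + (1/s) |b|^s ≤ 0`, with room for a non-positive `D`. -/
theorem exists_mem_calADual_truncation [IsFiniteMeasure (volume.restrict Ω)]
    [CompactSpace (closure Ω)] (hΩ : IsOpen Ω) (hF : ContinuousOn F (closure Ω))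
    (hFm : ∀ m : SobolevW1 Ω q, m.1.1 =ᵐ[volume.restrict Ω] fun x => F x m) {s : ℝ} (hs : 0 < s)
    {β : Rd d → Rd d} (hβm : StronglyMeasurable β)
    (hint : Integrable (fun x => ‖β x‖ ^ s) (volume.restrict Ω)) (n : ℕ)
    (hintA : Integrable ({x | (n : ℝ) ≤ ‖β x‖}.indicator fun x => ‖β x‖ ^ s) (volume.restrict Ω))
    {D : Rd d → ℝ} (hD0 : ∀ x, D x ≤ 0) (hDtop : MemLp D ∞ (volume.restrict Ω))
    (hDi : Integrable D (volume.restrict Ω)) :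
    ∃ p' ∈ calADual Ω q s, p'.2 =ᵐ[volume.restrict Ω] {x | (n : ℝ) ≤ ‖β x‖}ᶜ.indicator β ∧
      ∀ m : SobolevW1 Ω q, p'.1 m = -(1 / s) * (weightFunctional hΩ hint (evalMap F hF m)
        - weightFunctional hΩ hintA (evalMap F hF m))
        + weightFunctional hΩ hDi (evalMap F hF m) := by
  set A : Set (Rd d) := {x | (n : ℝ) ≤ ‖β x‖} with hA
  have hAm : MeasurableSet A := measurableSet_le measurable_const hβm.measurable.norm
  have hbm : StronglyMeasurable (Aᶜ.indicator β) := hβm.indicator hAm.compl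
  have hbs : ∀ x, ‖Aᶜ.indicator β x‖ ^ s = ‖β x‖ ^ s - A.indicator (fun x => ‖β x‖ ^ s) x :=
    rpow_norm_indicator_compl hs _ A
  have hbtop : MemLp (Aᶜ.indicator β) ∞ (volume.restrict Ω) :=
    memLp_top_of_bound hbm.aestronglyMeasurable n (.of_forall (norm_indicator_compl_le β n))
  have hgtop : MemLp (fun x => ‖β x‖ ^ s - A.indicator (fun x => ‖β x‖ ^ s) x) ∞
      (volume.restrict Ω) :=
    (memLp_top_rpow_norm hs hbm (norm_indicator_compl_le β n)).ae_eq (.of_forall hbs)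
  have hatop : MemLp (fun x => -(1 / s) * (‖β x‖ ^ s - A.indicator (fun x => ‖β x‖ ^ s) x) + D x)
      ∞ (volume.restrict Ω) :=
    (hgtop.const_mul _).add hDtop
  have hai : Integrable (fun x => -(1 / s) * (‖β x‖ ^ s - A.indicator (fun x => ‖β x‖ ^ s) x) + D x)
      (volume.restrict Ω) := ((hint.sub hintA).const_mul _).add hDi
  obtain ⟨p', hp', h1, h2⟩ := exists_mem_calADual (q := q) (s := s) hatop hbtop
    (.of_forall fun x => by
      have h4 : 1 / s * ‖Aᶜ.indicator β x‖ ^ s = _ := congrArg (1 / s * ·) (hbs x)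
      have h5 : -(1 / s) * (‖β x‖ ^ s - A.indicator (fun x => ‖β x‖ ^ s) x) + D x
          + 1 / s * ‖Aᶜ.indicator β x‖ ^ s ≤ 0 := by linarith [hD0 x]
      exact h5)
  refine ⟨p', hp', h2, fun m => ?_⟩
  have h3 : weightFunctional hΩ hai (evalMap F hF m) = p'.1 m :=
    (weightFunctional_evalMap hΩ hF hFm hai m).trans
      ((integral_congr_ae (.of_forall fun x => mul_comm _ _)).trans (h1 m).symm)
  exact h3.symm.trans (weightFunctional_const_mul_sub_add hΩ hint hintA hDi hai (fun _ => rfl) _)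

theorem abs_sub_le_of_decomposition {σ T W V S κ X Y p : ℝ} (hσ : σ = T - κ * W) (hκ : 0 ≤ κ)
    (hp : p = -κ * (W - V) + S) (h1 : |T - S| ≤ X) (h2 : |V| ≤ Y) : |σ - p| ≤ X + κ * Y := by
  have h3 : κ * |V| ≤ κ * Y := mul_le_mul_of_nonneg_left h2 hκ
  have h4 : σ - p = (T - S) - κ * V := by rw [hσ, hp]; ring
  rw [h4]
  refine (abs_sub _ _).trans ?_
  rw [abs_mul, abs_of_nonneg hκ]
  linarith

/-- Truncation of `β` and averaging of the defect `α + (1/s) |β|^s` over small balls: the error in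
the first component. -/
theorem exists_mem_calADual_approx [IsFiniteMeasure (volume.restrict Ω)] [CompactSpace (closure Ω)]
    (hΩ : IsOpen Ω) (hF : ContinuousOn F (closure Ω))
    (hFm : ∀ m : SobolevW1 Ω q, m.1.1 =ᵐ[volume.restrict Ω] fun x => F x m) {s : ℝ} (hs : 0 < s)
    {c : SignedMeasure (closure Ω) × LpOn Ω (Rd d) (ENNReal.ofReal s)} (hc : c ∈ measA Ω s)
    {B : ℝ} (hB : ∀ x ∈ closure Ω, ‖F x‖ ≤ B) (hB0 : 0 ≤ B) {ε : ℝ} (hε : 0 < ε) (n : ℕ)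
    (htail : ∫ x in Ω, ‖{x | (n : ℝ) ≤ ‖c.2 x‖}.indicator (fun x => ‖c.2 x‖ ^ s) x‖ ≤ ε) :
    ∃ p' ∈ calADual Ω q s, p'.2 =ᵐ[volume.restrict Ω] {x | (n : ℝ) ≤ ‖c.2 x‖}ᶜ.indicator c.2 ∧
      ∀ m : SobolevW1 Ω q, |signedFunctional c.1 (evalMap F hF m) - p'.1 m|
        ≤ -gapFunctional hΩ hs c 1 * (ε * ‖m‖) + 1 / s * (ε * (B * ‖m‖)) := by
  have hβm : StronglyMeasurable c.2 := Lp.stronglyMeasurable c.2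
  have hint := integrable_norm_rpow_of_Lp hs c.2
  have hintA := hint.indicator (s := {x | (n : ℝ) ≤ ‖c.2 x‖})
    (measurableSet_le measurable_const hβm.measurable.norm)
  obtain ⟨δ, hδ, hFδ⟩ := exists_eval_modulus hF hε
  obtain ⟨t, ψ, hψ0, hψ1, hψδ⟩ := exists_partition (Ω := Ω) hδ
  have hT := gapFunctional_nonpos hΩ hs hc
  have hDtop := memLp_top_averagingDensity t (fun i => gapFunctional hΩ hs c (ψ i)) δ
  have hDi := hDtop.integrable le_top
  obtain ⟨p', hp', h2, h1⟩ := exists_mem_calADual_truncation hΩ hF hFm hs hβm hint n hintA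
    (averagingDensity_nonpos (fun i => hT _ (hψ0 i)) δ) hDtop hDi
  refine ⟨p', hp', h2, fun m => ?_⟩
  have hval : weightFunctional hΩ hDi (evalMap F hF m)
      = ∑ i ∈ t, gapFunctional hΩ hs c (ψ i) *
        ⨍ y in ball (i : Rd d) δ, m.1.1 y ∂(volume.restrict Ω) :=
    ((weightFunctional_evalMap hΩ hF hFm hDi m).trans
      (integral_congr_ae (.of_forall fun x => mul_comm _ _))).trans
      (integral_averagingDensity_mul _ _ _ _)
  have hsig := signedFunctional_eq_gapFunctional_sub hΩ hs c (evalMap F hF m)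
  have hb1 := abs_apply_sub_sum_le hT hψ0 hψ1 (φ := evalMap F hF m) (M := ε * ‖m‖)
    (A := fun i => ⨍ y in ball (i : Rd d) δ, m.1.1 y ∂(volume.restrict Ω))
    fun i x hix => abs_eval_sub_average_le hΩ hFm hδ hFδ m i.2 x.2 (hψδ i x hix)
  have hb2 := abs_weightFunctional_le hΩ hintA (φ := evalMap F hF m) (M := B * ‖m‖)
    fun x => abs_eval_le hB m x.2
  have hm0 : 0 ≤ B * ‖m‖ := mul_nonneg hB0 (norm_nonneg m)
  exact abs_sub_le_of_decomposition hsig (by positivity) (h1 m) (hval ▸ hb1)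
    (hb2.trans (mul_le_mul_of_nonneg_right htail hm0))

theorem approximation_constant_le {g κ B ε M : ℝ} (hg : 0 ≤ g) (hκ : 0 ≤ κ) (hB : 0 ≤ B)
    (hε : 0 < ε) (hM : 0 ≤ M) :
    g * (ε / 2 / (g + κ * B + 1) * M) + κ * (ε / 2 / (g + κ * B + 1) * (B * M))
      ≤ ε / 2 * M := by
  have hC : 0 ≤ g + κ * B := by positivity
  calc _ = ε / 2 * ((g + κ * B) / (g + κ * B + 1)) * M := by ring
    _ ≤ ε / 2 * 1 * M := by
        gcongr
        rw [div_le_one (by positivity)]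
        linarith
    _ = ε / 2 * M := by rw [mul_one]

/-- The pairs `(α, β)` are approximated by bounded functions: `β` is truncated and the defect
`α + (1/s) |β|^s` is averaged over small balls. The constraint survives because the defect is
non-positive, and the error in the dual norm is small because of the equicontinuity of the unit
ball of `W^{1,q}(Ω)`. -/
theorem mem_closure_of_isMeasPair [IsFiniteMeasure (volume.restrict Ω)] [CompactSpace (closure Ω)]
    (hΩ : IsOpen Ω) (hF : ContinuousOn F (closure Ω))
    (hFm : ∀ m : SobolevW1 Ω q, m.1.1 =ᵐ[volume.restrict Ω] fun x => F x m) {s : ℝ} (hs : 0 < s)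
    (hqs : q.conjExponent ≤ s)
    {c : SignedMeasure (closure Ω) × LpOn Ω (Rd d) (ENNReal.ofReal s)} (hc : c ∈ measA Ω s)
    {p : DualSpace Ω q} (hp : IsMeasPair p c) : p ∈ closure (calADual Ω q s) := by
  obtain ⟨B, hB0, hB⟩ := exists_eval_bound hF
  have hβm : StronglyMeasurable c.2 := Lp.stronglyMeasurable c.2
  have hβ : MemLp c.2 (ENNReal.ofReal q.conjExponent) (volume.restrict Ω) :=
    (Lp.memLp c.2).mono_exponent (ENNReal.ofReal_le_ofReal hqs)
  have hA0 : 0 ≤ -gapFunctional hΩ hs c 1 :=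
    neg_nonneg.2 (gapFunctional_nonpos hΩ hs hc 1 fun x => zero_le_one)
  refine (Metric.mem_closure_iff (α := DualSpace Ω q)).2 fun ε hε => ?_
  have hη : 0 < ε / 2 / (-gapFunctional hΩ hs c 1 + 1 / s * B + 1) := by positivity
  obtain ⟨n, hn1, hn2⟩ := ((eventually_eLpNorm_tail_le hβ hβm (half_pos hε)).and
    ((tendsto_integral_tail hβm (integrable_norm_rpow_of_Lp hs c.2)).eventually
      (ge_mem_nhds hη))).exists
  obtain ⟨p', hp', h2, h1⟩ := exists_mem_calADual_approx hΩ hF hFm hs hc hB hB0 hη n hn2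
  refine ⟨p', hp', ?_⟩
  refine max_lt ?_ ?_
  · refine lt_of_le_of_lt (dist_le_of_forall_abs_sub_le (E := SobolevW1 Ω q) (half_pos hε).le
      fun m => ?_) (half_lt_self hε)
    obtain ⟨f, hf, hpf⟩ := hp.1 m
    have hval : p.1 m = signedFunctional c.1 (evalMap F hF m) :=
      hpf.trans (hf.signedIntegral_eq hΩ hF hFm c.1)
    refine (congrArg (fun y => |y - p'.1 m|) hval).le.trans ?_
    refine (h1 m).trans ?_
    exact approximation_constant_le hA0 (one_div_pos.2 hs).le hB0 hε (norm_nonneg m)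
  · rw [Lp.dist_def]
    refine lt_of_le_of_lt (ENNReal.toReal_le_of_le_ofReal (half_pos hε).le ?_) (half_lt_self hε)
    refine le_trans (le_of_eq (eLpNorm_congr_ae ?_)) hn1
    filter_upwards [hp.2, h2] with x hx hx2
    rw [Pi.sub_apply, hx, hx2]
    by_cases hxA : x ∈ {x | (n : ℝ) ≤ ‖c.2 x‖}
    · rw [indicator_of_mem hxA, indicator_of_notMem (notMem_compl_iff.2 hxA), sub_zero]
    · rw [indicator_of_notMem hxA, indicator_of_mem (mem_compl hxA), sub_self]

end

/-! ### Extension and representation of positive functionals -/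

/-- A linear functional on `V` which is non-negative on the preimage of the non-negative functions
factors through a positive functional on `C(X)`, as soon as the constants are attained. -/
theorem exists_positive_extension {V X : Type*} [AddCommGroup V] [Module ℝ V] [TopologicalSpace X]
    [CompactSpace X] (R : V →ₗ[ℝ] C(X, ℝ)) (ℓ : V →ₗ[ℝ] ℝ)
    (hℓ : ∀ m, (∀ x, 0 ≤ R m x) → 0 ≤ ℓ m) {m₁ : V} (hm₁ : ∀ x, R m₁ x = 1) :
    ∃ g : C(X, ℝ) →ₗ[ℝ] ℝ, (∀ φ, (∀ x, 0 ≤ φ x) → 0 ≤ g φ) ∧ ∀ m, g (R m) = ℓ m := by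
  have hker : LinearMap.ker R ≤ LinearMap.ker ℓ := by
    intro m hm
    rw [LinearMap.mem_ker] at hm ⊢
    have h1 := hℓ m fun x => by rw [hm]; simp
    have h2 := hℓ (-m) fun x => by rw [map_neg, hm]; simp
    rw [map_neg] at h2
    linarith
  let f : C(X, ℝ) →ₗ.[ℝ] ℝ :=
    ⟨LinearMap.range R, (LinearMap.ker R).liftQ ℓ hker ∘ₗ R.quotKerEquivRange.symm.toLinearMap⟩
  have hf : ∀ m (h : R m ∈ f.domain), f ⟨R m, h⟩ = ℓ m := by
    intro m h
    change (LinearMap.ker R).liftQ ℓ hker (R.quotKerEquivRange.symm ⟨R m, h⟩) = ℓ m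
    rw [LinearMap.quotKerEquivRange_symm_apply_image, Submodule.mkQ_apply, Submodule.liftQ_apply]
  let P : PointedCone ℝ C(X, ℝ) :=
    { carrier := {φ | ∀ x, 0 ≤ φ x}
      zero_mem' := fun x => le_rfl
      add_mem' := fun h1 h2 x => add_nonneg (h1 x) (h2 x)
      smul_mem' := fun c φ h x => mul_nonneg c.2 (h x) }
  obtain ⟨g, hg1, hg2⟩ := riesz_extension P f
    (by rintro ⟨_, m, rfl⟩ h; exact (hℓ m h).trans_eq (hf m ⟨m, rfl⟩).symm)
    (fun y => ⟨⟨R (‖y‖ • m₁), _, rfl⟩, fun x => by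
      have := (abs_le.1 (y.norm_coe_le_norm x)).1
      simp only [map_smul, ContinuousMap.add_apply, ContinuousMap.smul_apply, hm₁, smul_eq_mul]
      linarith⟩)
  exact ⟨g, hg2, fun m => (hg1 ⟨R m, m, rfl⟩).trans (hf m _)⟩

/-- The Riesz representation theorem on a compact space. -/
theorem exists_measure_of_positive {X : Type*} [TopologicalSpace X] [CompactSpace X] [T2Space X]
    [MeasurableSpace X] [BorelSpace X] (G : C(X, ℝ) →ₗ[ℝ] ℝ)
    (hG : ∀ φ, (∀ x, 0 ≤ φ x) → 0 ≤ G φ) :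
    ∃ μ : Measure X, IsFiniteMeasure μ ∧ ∀ φ : C(X, ℝ), ∫ x, φ x ∂μ = G φ := by
  let L : CompactlySupportedContinuousMap X ℝ →ₗ[ℝ] ℝ :=
    { toFun := fun f => G f.toContinuousMap
      map_add' := fun f g => map_add G f.toContinuousMap g.toContinuousMap
      map_smul' := fun c f => map_smul G c f.toContinuousMap }
  let Λ := PositiveLinearMap.mk₀ L fun f hf => hG _ fun x =>
    CompactlySupportedContinuousMap.le_def.1 hf x
  refine ⟨RealRMK.rieszMeasure Λ, inferInstance, fun φ => ?_⟩
  exact RealRMK.integral_rieszMeasure Λ (CompactlySupportedContinuousMap.continuousMapEquiv φ)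

section
variable {d : ℕ} {Ω : Set (Rd d)} {q : ℝ} [Fact (1 < q)] {F : Rd d → (SobolevW1 Ω q →L[ℝ] ℝ)}

/-! ### Dual elements below the functional are measure pairs -/

theorem norm_rpow_smul_self {s : ℝ} (hs : 1 < s) (b : Rd d) :
    ‖‖b‖ ^ (s - 2) • b‖ = ‖b‖ ^ (s - 1) := by
  rcases eq_or_ne b 0 with rfl | hb
  · rw [smul_zero, norm_zero, Real.zero_rpow (by linarith)]
  · have hb' : 0 < ‖b‖ := norm_pos_iff.2 hb
    rw [norm_smul, Real.norm_eq_abs, abs_of_nonneg (Real.rpow_nonneg hb'.le _)]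
    nth_rewrite 2 [← Real.rpow_one ‖b‖]
    rw [← Real.rpow_add hb']
    congr 1
    ring

theorem norm_rpow_smul_self_rpow {r s : ℝ} (h : r.HolderConjugate s) (b : Rd d) :
    ‖‖b‖ ^ (s - 2) • b‖ ^ r = ‖b‖ ^ s := by
  rw [norm_rpow_smul_self h.symm.lt, ← Real.rpow_mul (norm_nonneg b)]
  congr 1
  have := h.symm.mul_eq_add
  linarith

theorem inner_rpow_smul_self {s : ℝ} (hs : 0 < s) (b : Rd d) :
    inner ℝ b (‖b‖ ^ (s - 2) • b) = ‖b‖ ^ s := by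
  rw [inner_smul_right, real_inner_self_eq_norm_sq]
  rcases eq_or_ne b 0 with rfl | hb
  · rw [norm_zero, Real.zero_rpow hs.ne']; simp
  · rw [← Real.rpow_natCast, ← Real.rpow_add (norm_pos_iff.2 hb)]
    congr 1
    push_cast
    ring

/-- The integral of the cost along `w = m v`. -/
theorem costL_smul_field {r : ℝ} (hr : 0 < r) {z : PrimalSpace Ω q} {v : Rd d → Rd d}
    (h0 : 0 ≤ᵐ[volume.restrict Ω] z.1.1.1)
    (hw : z.2 =ᵐ[volume.restrict Ω] fun x => z.1.1.1 x • v x)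
    (hi : Integrable (fun x => z.1.1.1 x * ‖v x‖ ^ r) (volume.restrict Ω)) :
    costL r z = ENNReal.ofReal (1 / r * ∫ x in Ω, z.1.1.1 x * ‖v x‖ ^ r) := by
  rw [← integral_const_mul, ofReal_integral_eq_lintegral_ofReal (hi.const_mul _)]
  · refine lintegral_congr_ae ?_
    filter_upwards [h0, hw] with x hx hwx
    rw [hwx, ellFun_smul hx]
  · filter_upwards [h0] with x hx
    exact mul_nonneg (one_div_pos.2 hr).le (mul_nonneg hx (Real.rpow_nonneg (norm_nonneg _) _))

/-- Testing the inequality `⟨p, z⟩ ≤ 𝓛_r(z)` with `z = (m, m |b|^{s-2} b)`, where `b` is the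
truncation of the vector part `β` of `p`, gives the constraint for `b`. -/
theorem apply_add_integral_truncation_nonpos [IsFiniteMeasure (volume.restrict Ω)] {r : ℝ}
    (hr : 1 < r) {p : DualSpace Ω q}
    (hp : ∀ z : PrimalSpace Ω q, ENNReal.ofReal (dualPairing p z) ≤ costL r z)
    {m : SobolevW1 Ω q} (h0 : 0 ≤ᵐ[volume.restrict Ω] m.1.1) (n : ℕ) :
    p.1 m + 1 / r.conjExponent *
      ∫ x in Ω, m.1.1 x * ‖{x | (n : ℝ) ≤ ‖p.2 x‖}ᶜ.indicator p.2 x‖ ^ r.conjExponent ≤ 0 := by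
  have hconj : r.HolderConjugate r.conjExponent := Real.HolderConjugate.conjExponent hr
  set s := r.conjExponent
  have hβm : StronglyMeasurable p.2 := Lp.stronglyMeasurable p.2
  have hAm : MeasurableSet {x | (n : ℝ) ≤ ‖p.2 x‖} :=
    measurableSet_le measurable_const hβm.measurable.norm
  have hbm := hβm.indicator hAm.compl
  have hbn := norm_indicator_compl_le p.2 n
  have hinner : ∀ x, inner ℝ (p.2 x) ({x | (n : ℝ) ≤ ‖p.2 x‖}ᶜ.indicator p.2 x)
      = inner ℝ ({x | (n : ℝ) ≤ ‖p.2 x‖}ᶜ.indicator p.2 x)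
        ({x | (n : ℝ) ≤ ‖p.2 x‖}ᶜ.indicator p.2 x) := by
    intro x
    by_cases hx : x ∈ {x | (n : ℝ) ≤ ‖p.2 x‖}ᶜ
    · rw [indicator_of_mem hx]
    · rw [indicator_of_notMem hx, inner_zero_right, inner_zero_right]
  generalize {x | (n : ℝ) ≤ ‖p.2 x‖}ᶜ.indicator p.2 = b at hbm hbn hinner
  have hbtop : MemLp (fun x => ‖b x‖ ^ s) ∞ (volume.restrict Ω) :=
    memLp_top_rpow_norm hconj.symm.pos hbm hbn
  have hi : Integrable (fun x => m.1.1 x * ‖b x‖ ^ s) (volume.restrict Ω) :=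
    (integrable_of_memLp_sobolev m.1.1).mul_of_top_left hbtop
  have hvm : StronglyMeasurable fun x => ‖b x‖ ^ (s - 2) • b x :=
    (hbm.norm.measurable.pow_const _).stronglyMeasurable.smul hbm
  have hvtop : MemLp (fun x => ‖b x‖ ^ (s - 2) • b x) ∞ (volume.restrict Ω) := by
    refine memLp_top_of_bound hvm.aestronglyMeasurable ((n : ℝ) ^ (s - 1))
      (.of_forall fun x => ?_)
    rw [norm_rpow_smul_self hconj.symm.lt]
    exact Real.rpow_le_rpow (norm_nonneg _) (hbn x) (by linarith [hconj.symm.lt])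
  have hw : MemLp (fun x => m.1.1 x • (‖b x‖ ^ (s - 2) • b x)) (ENNReal.ofReal q)
      (volume.restrict Ω) := hvtop.smul (Lp.memLp m.1.1)
  have hvr : (fun x => m.1.1 x * ‖‖b x‖ ^ (s - 2) • b x‖ ^ r) = fun x => m.1.1 x * ‖b x‖ ^ s :=
    funext fun x => congrArg _ (norm_rpow_smul_self_rpow hconj (b x))
  have hcost := costL_smul_field (z := (m, hw.toLp _)) hconj.pos h0 hw.coeFn_toLp
    (by rw [hvr]; exact hi)
  rw [hvr] at hcost
  have hpair : dualPairing p (m, hw.toLp _) = p.1 m + ∫ x in Ω, m.1.1 x * ‖b x‖ ^ s := by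
    refine congrArg (p.1 m + ·) (integral_congr_ae ?_)
    filter_upwards [hw.coeFn_toLp] with x hx
    rw [hx, inner_smul_right, inner_smul_right, hinner, ← inner_smul_right,
      inner_rpow_smul_self hconj.symm.pos]
  have hI : 0 ≤ ∫ x in Ω, m.1.1 x * ‖b x‖ ^ s := by
    refine integral_nonneg_of_ae ?_
    filter_upwards [h0] with x hx
    exact mul_nonneg hx (Real.rpow_nonneg (norm_nonneg _) _)
  have hle := hp (m, hw.toLp _)
  rw [hcost, hpair, ENNReal.ofReal_le_ofReal_iff (mul_nonneg (one_div_pos.2 hconj.pos).le hI)]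
    at hle
  have hsum : 1 / r + 1 / s = 1 := by
    have := hconj.inv_add_inv_eq_one
    rwa [one_div, one_div]
  generalize (∫ x in Ω, m.1.1 x * ‖b x‖ ^ s) = I at hle
  have h1 : 1 / s = 1 - 1 / r := by linarith
  rw [h1]
  linarith

theorem tendsto_rpow_norm_indicator_compl {s : ℝ} (β : Rd d → Rd d) (x : Rd d) :
    Tendsto (fun n : ℕ => ‖{x | (n : ℝ) ≤ ‖β x‖}ᶜ.indicator β x‖ ^ s) atTop
      (𝓝 (‖β x‖ ^ s)) := by
  obtain ⟨N, hN⟩ := exists_nat_gt ‖β x‖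
  refine tendsto_const_nhds.congr' ?_
  filter_upwards [eventually_ge_atTop N] with n hn
  have hx : x ∈ {x | (n : ℝ) ≤ ‖β x‖}ᶜ := not_le.2 (hN.trans_le (Nat.cast_le.2 hn))
  rw [indicator_of_mem hx]

/-- The vector part of a dual element below `𝓛_r` lies in `L^{r'}`: the bound comes from the
constant function `m = 1`, by Fatou's lemma. -/
theorem memLp_of_forall_le_costL [IsFiniteMeasure (volume.restrict Ω)] {r : ℝ}
    (hr : 1 < r) {p : DualSpace Ω q}
    (hp : ∀ z : PrimalSpace Ω q, ENNReal.ofReal (dualPairing p z) ≤ costL r z) :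
    MemLp p.2 (ENNReal.ofReal r.conjExponent) (volume.restrict Ω) := by
  have hconj : r.HolderConjugate r.conjExponent := Real.HolderConjugate.conjExponent hr
  obtain ⟨m, hm⟩ := exists_sobolev_one (Ω := Ω) (q := q)
  have h0 : 0 ≤ᵐ[volume.restrict Ω] m.1.1 := by
    filter_upwards [hm] with x hx
    rw [hx]; exact zero_le_one
  have htest := apply_add_integral_truncation_nonpos hr hp h0
  have hs := hconj.symm.pos
  generalize r.conjExponent = s at htest hs
  have hβm : StronglyMeasurable p.2 := Lp.stronglyMeasurable p.2
  have hAm : ∀ n : ℕ, MeasurableSet {x | (n : ℝ) ≤ ‖p.2 x‖} := fun n =>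
    measurableSet_le measurable_const hβm.measurable.norm
  have hbi : ∀ n : ℕ, Integrable
      (fun x => ‖{x | (n : ℝ) ≤ ‖p.2 x‖}ᶜ.indicator p.2 x‖ ^ s) (volume.restrict Ω) := fun n =>
    (memLp_top_rpow_norm hs (hβm.indicator (hAm n).compl)
      (norm_indicator_compl_le p.2 n)).integrable le_top
  have hbound : ∀ n : ℕ, ∫⁻ x in Ω,
      ENNReal.ofReal (‖{x | (n : ℝ) ≤ ‖p.2 x‖}ᶜ.indicator p.2 x‖ ^ s)
        ≤ ENNReal.ofReal (s * -p.1 m) := by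
    intro n
    rw [← ofReal_integral_eq_lintegral_ofReal (hbi n)
      (.of_forall fun x => Real.rpow_nonneg (norm_nonneg _) s)]
    refine ENNReal.ofReal_le_ofReal ?_
    have h1 : ∫ x in Ω, m.1.1 x * ‖{x | (n : ℝ) ≤ ‖p.2 x‖}ᶜ.indicator p.2 x‖ ^ s
        = ∫ x in Ω, ‖{x | (n : ℝ) ≤ ‖p.2 x‖}ᶜ.indicator p.2 x‖ ^ s := by
      refine integral_congr_ae ?_
      filter_upwards [hm] with x hx
      rw [hx, one_mul]
    have h2 := htest n
    rw [h1] at h2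
    generalize (∫ x in Ω, ‖{x | (n : ℝ) ≤ ‖p.2 x‖}ᶜ.indicator p.2 x‖ ^ s) = I at h2
    have h3 : s * (1 / s * I) ≤ s * -p.1 m := mul_le_mul_of_nonneg_left (by linarith) hs.le
    rwa [← mul_assoc, mul_one_div_cancel hs.ne', one_mul] at h3
  have hfatou : ∫⁻ x in Ω, ENNReal.ofReal (‖p.2 x‖ ^ s) ≤ ENNReal.ofReal (s * -p.1 m) := by
    have h1 : ∀ x, liminf (fun n : ℕ =>
        ENNReal.ofReal (‖{x | (n : ℝ) ≤ ‖p.2 x‖}ᶜ.indicator p.2 x‖ ^ s)) atTop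
        = ENNReal.ofReal (‖p.2 x‖ ^ s) := fun x =>
      (ENNReal.tendsto_ofReal (tendsto_rpow_norm_indicator_compl p.2 x)).liminf_eq
    simp_rw [← h1]
    refine (lintegral_liminf_le fun n => ?_).trans ?_
    · exact ((hβm.indicator (hAm n).compl).norm.measurable.pow_const s).ennreal_ofReal
    · exact (liminf_le_liminf (.of_forall hbound)).trans_eq (liminf_const _)
  refine (integrable_norm_rpow_iff hβm.aestronglyMeasurable (ENNReal.ofReal_pos.2 hs).ne'
    ENNReal.ofReal_ne_top).1 ?_
  rw [ENNReal.toReal_ofReal hs.le]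
  refine ⟨(hβm.norm.measurable.pow_const s).aestronglyMeasurable, ?_⟩
  rw [hasFiniteIntegral_iff_ofReal (.of_forall fun x => Real.rpow_nonneg (norm_nonneg _) s)]
  exact hfatou.trans_lt ENNReal.ofReal_lt_top

/-- The constraint without truncation, on the elements with a non-negative representative. -/
theorem apply_add_weightFunctional_nonpos [IsFiniteMeasure (volume.restrict Ω)]
    [CompactSpace (closure Ω)] (hΩ : IsOpen Ω) (hF : ContinuousOn F (closure Ω))
    (hFm : ∀ m : SobolevW1 Ω q, m.1.1 =ᵐ[volume.restrict Ω] fun x => F x m) {r : ℝ}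
    (hr : 1 < r) {p : DualSpace Ω q}
    (hp : ∀ z : PrimalSpace Ω q, ENNReal.ofReal (dualPairing p z) ≤ costL r z)
    (hint : Integrable (fun x => ‖p.2 x‖ ^ r.conjExponent) (volume.restrict Ω))
    {m : SobolevW1 Ω q} (hm : ∀ x, 0 ≤ evalMap F hF m x) :
    p.1 m + 1 / r.conjExponent * weightFunctional hΩ hint (evalMap F hF m) ≤ 0 := by
  have h0 : 0 ≤ᵐ[volume.restrict Ω] m.1.1 := by
    filter_upwards [hFm m, ae_restrict_mem hΩ.measurableSet] with x hx hxΩ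
    rw [hx]
    exact hm ⟨x, subset_closure hxΩ⟩
  have htest := apply_add_integral_truncation_nonpos hr hp h0
  have hs := (Real.HolderConjugate.conjExponent hr).symm.pos
  generalize r.conjExponent = s at htest hint hs
  have hβm : StronglyMeasurable p.2 := Lp.stronglyMeasurable p.2
  have hmi : Integrable (fun x => m.1.1 x * ‖p.2 x‖ ^ s) (volume.restrict Ω) := by
    refine hint.bdd_mul (c := ‖evalMap F hF m‖) (Lp.memLp m.1.1).aestronglyMeasurable ?_
    filter_upwards [hFm m, ae_restrict_mem hΩ.measurableSet] with x hx hxΩ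
    rw [hx]
    exact (evalMap F hF m).norm_coe_le_norm ⟨x, subset_closure hxΩ⟩
  have hlim : Tendsto (fun n : ℕ => ∫ x in Ω, m.1.1 x *
      ‖{x | (n : ℝ) ≤ ‖p.2 x‖}ᶜ.indicator p.2 x‖ ^ s) atTop
      (𝓝 (∫ x in Ω, m.1.1 x * ‖p.2 x‖ ^ s)) := by
    refine tendsto_integral_of_dominated_convergence (fun x => ‖m.1.1 x * ‖p.2 x‖ ^ s‖)
      (fun n => ?_) hmi.norm (fun n => .of_forall fun x => ?_) (.of_forall fun x =>
        (tendsto_rpow_norm_indicator_compl p.2 x).const_mul _)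
    · exact (Lp.memLp m.1.1).aestronglyMeasurable.mul ((hβm.indicator
        (measurableSet_le measurable_const hβm.measurable.norm).compl).norm.measurable.pow_const
        s).aestronglyMeasurable
    · rw [norm_mul, norm_mul]
      refine mul_le_mul_of_nonneg_left ?_ (norm_nonneg _)
      rw [Real.norm_of_nonneg (Real.rpow_nonneg (norm_nonneg _) _),
        Real.norm_of_nonneg (Real.rpow_nonneg (norm_nonneg _) _)]
      exact Real.rpow_le_rpow (norm_nonneg _) (norm_indicator_le_norm_self _ _) hs.le
  rw [weightFunctional_evalMap hΩ hF hFm]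
  exact le_of_tendsto' ((hlim.const_mul (1 / s)).const_add (p.1 m)) htest

end

section
variable {d : ℕ} {Ω : Set (Rd d)} {q : ℝ} [Fact (1 < q)] {F : Rd d → (SobolevW1 Ω q →L[ℝ] ℝ)}

theorem weightFunctional_congr [CompactSpace (closure Ω)] (hΩ : IsOpen Ω) {h h' : Rd d → ℝ}
    (hh : Integrable h (volume.restrict Ω)) (hh' : Integrable h' (volume.restrict Ω))
    (heq : h =ᵐ[volume.restrict Ω] h') : weightFunctional hΩ hh = weightFunctional hΩ hh' := by
  ext φ
  refine integral_congr_ae ?_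
  filter_upwards [heq] with x hx
  rw [hx]

theorem weightFunctional_nonneg [CompactSpace (closure Ω)] (hΩ : IsOpen Ω) {h : Rd d → ℝ}
    (hh : Integrable h (volume.restrict Ω)) (h0 : ∀ x, 0 ≤ h x) {φ : C(closure Ω, ℝ)}
    (hφ : ∀ x, 0 ≤ φ x) : 0 ≤ weightFunctional hΩ hh φ :=
  integral_nonneg fun x => mul_nonneg (extendZero_nonneg hφ x) (h0 x)

theorem signedFunctional_neg_toSignedMeasure [CompactSpace (closure Ω)]
    (μ : Measure (closure Ω)) [IsFiniteMeasure μ] (φ : C(closure Ω, ℝ)) :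
    signedFunctional (-μ.toSignedMeasure) φ = -∫ x, φ x ∂μ := by
  rw [signedFunctional_apply, VectorMeasure.integral_neg_vectorMeasure,
    VectorMeasure.integral_toSignedMeasure]

/-- The inequality defining `measA` only has to be tested on `C(closure Ω)`. -/
theorem mem_measA_of_gapFunctional_nonpos [CompactSpace (closure Ω)] (hΩ : IsOpen Ω) {s : ℝ}
    (hs : 0 < s) {c : SignedMeasure (closure Ω) × LpOn Ω (Rd d) (ENNReal.ofReal s)}
    (hc : ∀ φ : C(closure Ω, ℝ), (∀ x, 0 ≤ φ x) → gapFunctional hΩ hs c φ ≤ 0) :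
    c ∈ measA Ω s := by
  intro φ hφ hφ0
  refine le_of_eq_of_le ?_ (hc ⟨fun x => φ x, continuousOn_iff_continuous_domRestrict.1 hφ⟩
    fun x => hφ0 x x.2)
  refine congrArg (fun y => (∫ᵛ x : closure Ω, φ x ∂<•c.1) + 1 / s * y) (integral_congr_ae ?_)
  filter_upwards [ae_restrict_mem hΩ.measurableSet] with x hx
  rw [extendZero_of_mem _ (subset_closure hx)]
  rfl

/-- A dual element below `𝓛_r` is a pair of a measure and a field in `L^{r'}`. Its first component
plus `(1/r') |β|^{r'}` is a non-positive functional on `W^{1,q}(Ω)`; it extends to a non-positive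
functional on `C(closure Ω)`, which is represented by a measure. -/
theorem exists_mem_measA_of_forall_le_costL [IsFiniteMeasure (volume.restrict Ω)]
    [CompactSpace (closure Ω)] (hΩ : IsOpen Ω) (hF : ContinuousOn F (closure Ω))
    (hFm : ∀ m : SobolevW1 Ω q, m.1.1 =ᵐ[volume.restrict Ω] fun x => F x m) {r : ℝ}
    (hr : 1 < r) {p : DualSpace Ω q}
    (hp : ∀ z : PrimalSpace Ω q, ENNReal.ofReal (dualPairing p z) ≤ costL r z) :
    ∃ c ∈ measA Ω r.conjExponent, IsMeasPair p c := by
  have hβ := memLp_of_forall_le_costL hr hp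
  have htest := fun hint (m : SobolevW1 Ω q) (hm : ∀ x, 0 ≤ evalMap F hF m x) =>
    apply_add_weightFunctional_nonpos hΩ hF hFm hr hp hint hm
  have hs := (Real.HolderConjugate.conjExponent hr).symm.pos
  generalize r.conjExponent = s at hβ htest hs
  have hint := integrable_norm_rpow_of_Lp hs (hβ.toLp p.2)
  have hβae : (fun x => ‖hβ.toLp p.2 x‖ ^ s) =ᵐ[volume.restrict Ω] fun x => ‖p.2 x‖ ^ s := by
    filter_upwards [hβ.coeFn_toLp] with x hx
    rw [hx]
  have hint' : Integrable (fun x => ‖p.2 x‖ ^ s) (volume.restrict Ω) := hint.congr hβae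
  obtain ⟨m₁, hm₁⟩ := exists_sobolev_one (Ω := Ω) (q := q)
  have hone : IsContRep m₁ fun _ => 1 := ⟨continuousOn_const, hm₁⟩
  have hweight : ∀ φ : C(closure Ω, ℝ), (∀ x, 0 ≤ φ x) → 0 ≤ weightFunctional hΩ hint φ :=
    fun φ => weightFunctional_nonneg hΩ hint fun x => Real.rpow_nonneg (norm_nonneg _) s
  obtain ⟨g, hg0, hg⟩ := exists_positive_extension (evalMap F hF)
    (-((p.1 : SobolevW1 Ω q →ₗ[ℝ] ℝ) + (1 / s) • weightFunctional hΩ hint ∘ₗ evalMap F hF))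
    (fun m hm => by
      have h1 := htest hint' m hm
      rw [← weightFunctional_congr hΩ hint hint' hβae] at h1
      exact neg_nonneg.2 h1)
    (m₁ := m₁) (fun x => (hone.eq_eval hΩ hF hFm x.2).symm)
  obtain ⟨μ, hμ, hμg⟩ := exists_measure_of_positive (g + (1 / s) • weightFunctional hΩ hint)
    fun φ hφ => add_nonneg (hg0 φ hφ) (mul_nonneg (one_div_pos.2 hs).le (hweight φ hφ))
  have hsigned : ∀ φ : C(closure Ω, ℝ), signedFunctional (-μ.toSignedMeasure) φ
      = -(g φ + 1 / s * weightFunctional hΩ hint φ) := fun φ =>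
    (signedFunctional_neg_toSignedMeasure μ φ).trans (congrArg Neg.neg (hμg φ))
  refine ⟨(-μ.toSignedMeasure, hβ.toLp p.2), ?_, fun m => ⟨fun x => F x m,
    isContRep_eval hF hFm m, ?_⟩, hβ.coeFn_toLp.symm⟩
  · refine mem_measA_of_gapFunctional_nonpos hΩ hs fun φ hφ => ?_
    have h1 := hsigned φ
    have h2 := hg0 φ hφ
    change signedFunctional (-μ.toSignedMeasure) φ + 1 / s * weightFunctional hΩ hint φ ≤ 0
    linarith
  · refine Eq.symm ((hsigned (evalMap F hF m)).trans ?_)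
    have h1 : g (evalMap F hF m) = -(p.1 m + 1 / s * weightFunctional hΩ hint (evalMap F hF m)) :=
      hg m
    rw [h1]
    ring

theorem IsMeasPair.dualPairing_eq [CompactSpace (closure Ω)] (hΩ : IsOpen Ω)
    (hF : ContinuousOn F (closure Ω))
    (hFm : ∀ m : SobolevW1 Ω q, m.1.1 =ᵐ[volume.restrict Ω] fun x => F x m) {s : ℝ}
    {p : DualSpace Ω q} {c : SignedMeasure (closure Ω) × LpOn Ω (Rd d) (ENNReal.ofReal s)}
    (hp : IsMeasPair p c) (z : PrimalSpace Ω q) :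
    dualPairing p z
      = (∫ᵛ x : closure Ω, F x z.1 ∂<•c.1) + ∫ x in Ω, inner ℝ (c.2 x) (z.2 x) := by
  obtain ⟨f, hf, hpf⟩ := hp.1 z.1
  refine congrArg₂ (· + ·) (hpf.trans (hf.signedIntegral_eq hΩ hF hFm c.1)) (integral_congr_ae ?_)
  filter_upwards [hp.2] with x hx
  rw [hx]

end

theorem lemma2p1 (d : ℕ) (hd : 2 ≤ d) (Ω : Set (Rd d)) (hΩ_nonempty : Ω.Nonempty)
    (hΩ_open : IsOpen Ω) (hΩ_bounded : Bornology.IsBounded Ω) (hΩ_smooth : HasSmoothBoundary Ω)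
    (q : ℝ) [Fact (1 < q)] (hq : (d : ℝ) < q) (r : ℝ) (hr : 1 < r) (hrq : r ≤ q) :
    -- (i) the closure consists exactly of the measure pairs
    (closure (calADual Ω q r.conjExponent)
        = {p : DualSpace Ω q | ∃ c ∈ measA Ω r.conjExponent, IsMeasPair p c} ∧
      ∀ c ∈ measA Ω r.conjExponent, ∃ p : DualSpace Ω q, IsMeasPair p c) ∧
    -- (ii) convexity, lower semicontinuity, supremum formulas and conjugate
    ConvexOn ℝ≥0 Set.univ (fun z : PrimalSpace Ω q => costL r z) ∧
    LowerSemicontinuous (fun z : PrimalSpace Ω q => costL r z) ∧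
    (∀ z : PrimalSpace Ω q,
      ((costL r z : ℝ≥0∞) : EReal)
          = ⨆ c ∈ calA Ω r.conjExponent,
              ((∫ x in Ω, (c.1 x * z.1.1.1 x + inner ℝ (c.2 x) (z.2 x)) : ℝ) : EReal) ∧
      ((costL r z : ℝ≥0∞) : EReal)
          = ⨆ p ∈ closure (calADual Ω q r.conjExponent), ((dualPairing p z : ℝ) : EReal) ∧
      ∃ f : Rd d → ℝ, IsContRep z.1 f ∧
        ((costL r z : ℝ≥0∞) : EReal)
          = ⨆ c ∈ measA Ω r.conjExponent,
              (((∫ᵛ x : closure Ω, f x ∂<•c.1)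
                + ∫ x in Ω, inner ℝ (c.2 x) (z.2 x) : ℝ) : EReal)) ∧
    ∀ p : DualSpace Ω q,
      fenchelConj (fun z : PrimalSpace Ω q => costL r z) p
        = convexIndicator (closure (calADual Ω q r.conjExponent)) p := by
  have hcompact : CompactSpace (closure Ω) :=
    isCompact_iff_compactSpace.1 hΩ_bounded.isCompact_closure
  have hfin : IsFiniteMeasure (volume.restrict Ω) :=
    isFiniteMeasure_restrict_of_isBounded hΩ_bounded
  obtain ⟨F, hF, hFm⟩ := exists_continuousOn_eval hΩ_open hΩ_bounded hΩ_smooth hq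
  have hs : 0 < r.conjExponent := (Real.HolderConjugate.conjExponent hr).symm.pos
  have hqs := conjExponent_le_conjExponent hr hrq
  have hmeas : ∀ p : DualSpace Ω q,
      (∀ z : PrimalSpace Ω q, ENNReal.ofReal (dualPairing p z) ≤ costL r z) →
      ∃ c ∈ measA Ω r.conjExponent, IsMeasPair p c := fun p hp =>
    exists_mem_measA_of_forall_le_costL hΩ_open hF hFm hr hp
  have hclosure : ∀ (p : DualSpace Ω q), ∀ c ∈ measA Ω r.conjExponent, IsMeasPair p c →
      p ∈ closure (calADual Ω q r.conjExponent) := fun p c hc hpc =>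
    mem_closure_of_isMeasPair hΩ_open hF hFm hs hqs hc hpc
  have hexists : ∀ c ∈ measA Ω r.conjExponent, ∃ p : DualSpace Ω q, IsMeasPair p c :=
    fun c hc => exists_isMeasPair hΩ_open hF hFm hs hqs hc
  refine ⟨⟨?_, hexists⟩, convexOn_costL hr, lowerSemicontinuous_costL hr, fun z =>
    ⟨coe_costL_eq_iSup_calA hr z, coe_costL_eq_iSup_closure hr z,
      fun x => F x z.1, isContRep_eval hF hFm z.1, ?_⟩, fun p => ?_⟩
  · refine Subset.antisymm (fun p hp => hmeas p (dualPairing_le_costL_of_mem_closure hr hp)) ?_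
    rintro p ⟨c, hc, hpc⟩
    exact hclosure p c hc hpc
  · rw [coe_costL_eq_iSup_closure hr z]
    refine le_antisymm (iSup₂_le fun p hp => ?_) (iSup₂_le fun c hc => ?_)
    · obtain ⟨c, hc, hpc⟩ := hmeas p (dualPairing_le_costL_of_mem_closure hr hp)
      rw [hpc.dualPairing_eq hΩ_open hF hFm z]
      exact le_iSup₂_of_le c hc le_rfl
    · obtain ⟨p, hpc⟩ := hexists c hc
      rw [← hpc.dualPairing_eq hΩ_open hF hFm z]
      exact le_iSup₂_of_le p (hclosure p c hc hpc) le_rfl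
  · by_cases hp : p ∈ closure (calADual Ω q r.conjExponent)
    · rw [convexIndicator, if_pos hp]
      exact fenchelConj_costL_of_forall_le hr (dualPairing_le_costL_of_mem_closure hr hp)
    · rw [convexIndicator, if_neg hp]
      obtain ⟨z, hz⟩ : ∃ z : PrimalSpace Ω q, costL r z < ENNReal.ofReal (dualPairing p z) := by
        by_contra! h
        obtain ⟨c, hc, hpc⟩ := hmeas p h
        exact hp (hclosure p c hc hpc)
      exact fenchelConj_costL_of_lt hr hz
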